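/- **Definitions.** A *dependence alphabet* $\mathcal D=(A,D)$ is a finite set $A$ of letters with a reflexive and symmetric relation $D\subseteq A\times A$. For $a\in A$ let $D(a)=\{b\mid (a,b)\in D\}$, and for a word $w\in A^*$ let $D(w)$ be the union of the sets $D(a)$ over all letters $a$ of $w$. The *twin index* $\mathrm{TI}(\mathcal D)$ is the number of classes of the equivalence relation $D(a)=D(b)$ on $A$. Let $\sim$ be the least monoid congruence on $A^*$ with $ab\sim ba$ for all $(a,b)\notin D$, let $[w]$ be the class of $w$, and let $\mathbb M=A^*/{\sim}$ be the trace monoid. For words $u,v$ write $u\parallel v$ if no letter of $u$ is dependent from a letter of $v$. A *pushdown system* over $A$ is a pair $\mathfrak P=(Q,\Delta)$ of a finite set $Q$ of states and a finite set $\Delta\subseteq Q\times A\times A^*\times Q$ of transitions. Its configurations (in trace semantics) are the elements of $Q\times\mathbb M$, and $(p,[u])\vdash(q,[v])$ holds if there are $(p,a,w,q)\in\Delta$ and $x\in A^*$ with $[u]=[ax]$ and $[v]=[wx]$. It is a *trace-pushdown system* over $\mathcal D$ if * $D(w)\subseteq D(a)$ for all $(p,a,w,q)\in\Delta$, and * whenever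 $(p,a,v,q),(q,b,w,r)\in\Delta$ with $av\parallel bw$, there is $q'\in Q$ with $(p,b,w,q'),(q',a,v,r)\in\Delta$. Its size is $\|\mathfrak P\|=|Q|+|A|+k\cdot|\Delta|$, where $k-1$ is the maximal length of a word occurring in $\Delta$. For $p,q\in Q$ let $\mathrm{Reach}_{p,q}(\mathfrak P)=\{([u],[v])\mid (p,[u])\vdash^*(q,[v])\}$. A word relation $R\subseteq A^*\times A^*$ is *rational* if it is obtained from finite relations by union, multiplication and Kleene star. It is *left-closed* if $u\sim u'$ and $(u',v')\in R$ imply that there is $v\in A^*$ with $(u,v)\in R$ and $v\sim v'$. Put $[R]=\{([u],[v])\mid(u,v)\in R\}$. A trace relation $\mathcal R\subseteq\mathbb M\times\mathbb M$ is *lc-rational* if $\mathcal R=[R]$ for some left-closed rational word relation $R$. A *transducer* $\mathfrak T$ over $A$ is a finite automaton whose transitions are labeled by pairs $(u,v)$ of words with $|uv|\le 1$; it accepts a word relation $R(\mathfrak T)$, and it is *left-closed* if $R(\mathfrak T)$ is left-closed. **Theorem.** Let $\mathcal D=(A,D)$ be a dependence alphabet and $\mathfrak P=(Q,\Delta)$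 a trace-pushdown system over $\mathcal D$. 1. For all $p,q\in Q$, the trace relation $\mathrm{Reach}_{p,q}(\mathfrak P)$ is lc-rational. 2. There are an algorithm and polynomials $f,g$, all independent of $\mathcal D$ and $\mathfrak P$, such that the algorithm, on input $\mathcal D$, $\mathfrak P$ and $p,q\in Q$, constructs in time at most $f\bigl(\|\mathfrak P\|^{\,g(\mathrm{TI}(\mathcal D))}\bigr)$ a left-closed transducer $\mathfrak T$ with $[R(\mathfrak T)]=\mathrm{Reach}_{p,q}(\mathfrak P)$. 3. This generalizes Caucal's rationality of pushdown reachability: if $D=A\times A$, then every pushdown system over $A$ is a trace-pushdown system over $\mathcal D$ and the map $w\mapsto[w]$ is injective, and for every pushdown system $(Q,\Delta)$ and all $p,q\in Q$ the reachability relation $\{(u,v)\in A^*\times A^*\mid (p,u)\vdash^*(q,v)\}$ of the classical semantics on words (where $(p,ax)\vdash(q,wx)$ for $(p,a,w,q)\in\Delta$ and $x\in A^*$) is rational. -/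

import Mathlib

open scoped Pointwise

/-! ### Words, dependence alphabets and the trace monoid

Words over `A` are the elements of Mathlib's `FreeMonoid A`. -/

/-- A dependence relation on the alphabet `A`: reflexive and symmetric. (The alphabet itself is the
type `A`, which is required to be finite wherever a dependence alphabet is used.) -/
structure DepAlphabet (A : Type*) where
  Dep : A → A → Prop
  refl : ∀ a, Dep a a
  symm : ∀ a b, Dep a b → Dep b a

namespace DepAlphabet

variable {A : Type*} (D : DepAlphabet A)

/-- `D(a)`, the set of letters dependent from the letter `a`. -/
def ofLetter (a : A) : Set A := {b | D.Dep a b}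

/-- `D(w)`, the set of letters dependent from some letter of the word `w`. -/
def ofWord (w : FreeMonoid A) : Set A := {b | ∃ a ∈ w.toList, D.Dep a b}

/-- `u ∥ v`: every letter of `u` is independent from every letter of `v`. (Independent letters are
distinct, as `Dep` is reflexive.) -/
def Parallel (u v : FreeMonoid A) : Prop :=
  ∀ a ∈ u.toList, ∀ b ∈ v.toList, ¬ D.Dep a b

/-- The set of twins of the letter `a`. -/
def twins (a : A) : Set A := {b | D.ofLetter a = D.ofLetter b}

/-- The twin index `TI(D)`: the number of equivalence classes of the relation "twin". -/
noncomputable def twinIndex : ℕ := (Set.range D.twins).ncard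

/-- The least monoid congruence on words with `ab ∼ ba` for all independent `a`, `b`. -/
def traceCon : Con (FreeMonoid A) :=
  conGen fun u v => ∃ a b : A, ¬ D.Dep a b ∧
    u = FreeMonoid.of a * FreeMonoid.of b ∧ v = FreeMonoid.of b * FreeMonoid.of a

/-- The trace monoid. -/
abbrev Trace : Type _ := D.traceCon.Quotient

/-- The trace `[w]` induced by the word `w`. -/
def trace (w : FreeMonoid A) : D.Trace := D.traceCon.mk' w

/-- The dependence alphabet in which any two letters are dependent. -/
def full (A : Type*) : DepAlphabet A where
  Dep _ _ := True
  refl _ := trivial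
  symm _ _ _ := trivial

end DepAlphabet

/-! ### Rational and lc-rational relations -/

/-- Rational subsets of a monoid: those obtained from finite subsets by union, multiplication and
Kleene star (the submonoid generated by a set). -/
inductive IsRational {M : Type*} [Monoid M] : Set M → Prop
  | finite (S : Set M) : S.Finite → IsRational S
  | union (S T : Set M) : IsRational S → IsRational T → IsRational (S ∪ T)
  | mul (S T : Set M) : IsRational S → IsRational T → IsRational (S * T)
  | star (S : Set M) : IsRational S → IsRational (Submonoid.closure S : Set M)

section Relations

variable {A : Type*} (D : DepAlphabet A)

/-- A word relation `R` is left-closed if `u ∼ u' R v'` implies `u R v ∼ v'` for some `v`. -/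
def LeftClosed (R : Set (FreeMonoid A × FreeMonoid A)) : Prop :=
  ∀ u u' v' : FreeMonoid A, D.traceCon u u' → (u', v') ∈ R →
    ∃ v : FreeMonoid A, (u, v) ∈ R ∧ D.traceCon v v'

/-- The trace relation `[R]` induced by the word relation `R`. -/
def traceRel (R : Set (FreeMonoid A × FreeMonoid A)) : Set (D.Trace × D.Trace) :=
  {x | ∃ u v : FreeMonoid A, (u, v) ∈ R ∧ x = (D.trace u, D.trace v)}

/-- A trace relation is lc-rational if it is induced by some left-closed and rational word
relation. -/
def LCRational (𝓡 : Set (D.Trace × D.Trace)) : Prop :=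
  ∃ R : Set (FreeMonoid A × FreeMonoid A), IsRational R ∧ LeftClosed D R ∧ 𝓡 = traceRel D R

end Relations

/-! ### Transducers -/

/-- A transducer over the alphabet `A` with (finite) set of states `S`. -/
structure Transducer (A S : Type*) where
  init : Set S
  trans : Set (S × (FreeMonoid A × FreeMonoid A) × S)
  final : Set S
  label_le : ∀ p u v q, (p, (u, v), q) ∈ trans → (u * v).length ≤ 1

namespace Transducer

variable {A S : Type*} (T : Transducer A S)

/-- `T.Path p x q`: there is a path from `p` to `q` that is labeled by the pair of words `x`. -/
inductive Path : S → FreeMonoid A × FreeMonoid A → S → Prop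
  | refl (p : S) : Path p 1 p
  | step (p q r : S) (x y : FreeMonoid A × FreeMonoid A) :
      (p, x, q) ∈ T.trans → Path q y r → Path p (x * y) r

/-- The word relation `R(T)` accepted by the transducer. -/
def accepted : Set (FreeMonoid A × FreeMonoid A) :=
  {x | ∃ p ∈ T.init, ∃ q ∈ T.final, T.Path p x q}

end Transducer

/-! ### Pushdown systems with trace semantics -/

/-- A pushdown system over the alphabet `A` with (finite) set of states `Q`: a finite set of
transitions `(p, a, w, q)`. -/
structure PushdownSystem (A Q : Type*) where
  trans : Finset (Q × A × FreeMonoid A × Q)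

namespace PushdownSystem

variable {A Q : Type*} (P : PushdownSystem A Q)

/-- The classical one-step relation, on configurations whose pushdown holds a word. -/
def WordStep (c d : Q × FreeMonoid A) : Prop :=
  ∃ (a : A) (w x : FreeMonoid A), (c.1, a, w, d.1) ∈ P.trans ∧
    c.2 = FreeMonoid.of a * x ∧ d.2 = w * x

/-- The one-step relation in trace semantics, on configurations whose pushdown holds a trace. -/
def Step (D : DepAlphabet A) (c d : Q × D.Trace) : Prop :=
  ∃ (a : A) (w x : FreeMonoid A), (c.1, a, w, d.1) ∈ P.trans ∧
    c.2 = D.trace (FreeMonoid.of a * x) ∧ d.2 = D.trace (w * x)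

/-- `Reach_{p,q}(P)`, the pairs of traces `(s, t)` such that the configuration `(q, t)` is reachable
from the configuration `(p, s)`. -/
def Reach (D : DepAlphabet A) (p q : Q) : Set (D.Trace × D.Trace) :=
  {x | Relation.ReflTransGen (P.Step D) (p, x.1) (q, x.2)}

/-- `P` is a trace-pushdown system over `D`. -/
structure IsTPDS (D : DepAlphabet A) : Prop where
  dep_subset : ∀ p a w q, (p, a, w, q) ∈ P.trans → D.ofWord w ⊆ D.ofLetter a
  diamond : ∀ p a v q b w r, (p, a, v, q) ∈ P.trans → (q, b, w, r) ∈ P.trans →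
    D.Parallel (FreeMonoid.of a * v) (FreeMonoid.of b * w) →
    ∃ q', (p, b, w, q') ∈ P.trans ∧ (q', a, v, r) ∈ P.trans

/-- The size `|Q| + |A| + k * |Δ|`, where `k - 1` is the maximal length of a word in a transition. -/
def size [Fintype A] [Fintype Q] : ℕ :=
  Fintype.card Q + Fintype.card A +
    (P.trans.sup (fun t => t.2.2.1.length) + 1) * P.trans.card

end PushdownSystem

/-! ### The model of computation

A while-language whose data are binary trees. Each execution of an instruction is charged the size
of the tree it is executed on, so that the running time also bounds the size of all trees that are
built, and running times agree with those of Turing machines up to a polynomial. -/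

/-- Binary trees. -/
inductive BTree : Type
  | nil : BTree
  | node : BTree → BTree → BTree

namespace BTree

/-- The number of nodes and leaves. -/
def size : BTree → ℕ
  | nil => 1
  | node l r => l.size + r.size + 1

/-- The left subtree (`nil` for the leaf `nil`). -/
def left : BTree → BTree
  | nil => nil
  | node l _ => l

/-- The right subtree (`nil` for the leaf `nil`). -/
def right : BTree → BTree
  | nil => nil
  | node _ r => r

end BTree

/-- Programs; every program transforms one tree into another. -/
inductive Prog : Type
  /-- leave the tree unchanged -/
  | id : Prog
  /-- return the leaf `nil` -/
  | nil : Prog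
  /-- return the left subtree -/
  | left : Prog
  /-- return the right subtree -/
  | right : Prog
  /-- run both programs on the given tree and join the results to one tree -/
  | pair : Prog → Prog → Prog
  /-- run the first program, then run the second one on its result -/
  | seq : Prog → Prog → Prog
  /-- run the second program if the first one returns some node, and the third one otherwise -/
  | cond : Prog → Prog → Prog → Prog
  /-- as long as the first program returns some node, transform the tree by the second one -/
  | loop : Prog → Prog → Prog

/-- `Runs c x y t`: started on the tree `x`, the program `c` halts after time `t` with result `y`. -/
inductive Runs : Prog → BTree → BTree → ℕ → Prop
  | id (x : BTree) : Runs Prog.id x x x.size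
  | nil (x : BTree) : Runs Prog.nil x BTree.nil x.size
  | left (x : BTree) : Runs Prog.left x x.left x.size
  | right (x : BTree) : Runs Prog.right x x.right x.size
  | pair (c d : Prog) (x y z : BTree) (s t : ℕ) : Runs c x y s → Runs d x z t →
      Runs (Prog.pair c d) x (BTree.node y z) (x.size + s + t)
  | seq (c d : Prog) (x y z : BTree) (s t : ℕ) : Runs c x y s → Runs d y z t →
      Runs (Prog.seq c d) x z (x.size + s + t)
  | cond_node (b c d : Prog) (x l r y : BTree) (s t : ℕ) :
      Runs b x (BTree.node l r) s → Runs c x y t →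
      Runs (Prog.cond b c d) x y (x.size + s + t)
  | cond_nil (b c d : Prog) (x y : BTree) (s t : ℕ) :
      Runs b x BTree.nil s → Runs d x y t →
      Runs (Prog.cond b c d) x y (x.size + s + t)
  | loop_node (b c : Prog) (x l r y z : BTree) (s t u : ℕ) :
      Runs b x (BTree.node l r) s → Runs c x y t → Runs (Prog.loop b c) y z u →
      Runs (Prog.loop b c) x z (x.size + s + t + u)
  | loop_nil (b c : Prog) (x : BTree) (s : ℕ) :
      Runs b x BTree.nil s → Runs (Prog.loop b c) x x (x.size + s)

/-! ### Encoding of the input and the output -/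

/-- Types whose elements are encoded by binary trees. -/
class TreeEncoding (α : Type) where
  enc : α → BTree

/-- Natural numbers are encoded in unary. -/
def encodeNat : ℕ → BTree
  | 0 => BTree.nil
  | n + 1 => BTree.node BTree.nil (encodeNat n)

/-- A list is encoded by a tree with the encodings of its entries along the right spine. -/
def encodeList {α : Type} [TreeEncoding α] : List α → BTree
  | [] => BTree.nil
  | x :: l => BTree.node (TreeEncoding.enc x) (encodeList l)

instance instTreeEncodingNat : TreeEncoding ℕ := ⟨encodeNat⟩

instance instTreeEncodingFin (n : ℕ) : TreeEncoding (Fin n) := ⟨fun i => encodeNat i.val⟩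

instance instTreeEncodingList (α : Type) [TreeEncoding α] : TreeEncoding (List α) := ⟨encodeList⟩

instance instTreeEncodingFreeMonoid (α : Type) [TreeEncoding α] : TreeEncoding (FreeMonoid α) :=
  ⟨fun w => encodeList w.toList⟩

instance instTreeEncodingProd (α β : Type) [TreeEncoding α] [TreeEncoding β] :
    TreeEncoding (α × β) :=
  ⟨fun x => BTree.node (TreeEncoding.enc x.1) (TreeEncoding.enc x.2)⟩

/-- The list `l` enumerates the set `s`, possibly with repetitions. -/
def IsListing {α : Type} (l : List α) (s : Set α) : Prop := ∀ x, x ∈ l ↔ x ∈ s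

/-- `x` encodes a dependence alphabet with letters `0, …, n - 1`, a pushdown system with states
`0, …, m - 1`, and two states; the dependence relation and the set of transitions are listed in an
arbitrary order, but without repetitions. -/
def EncodesInput {n m : ℕ} (D : DepAlphabet (Fin n)) (P : PushdownSystem (Fin n) (Fin m))
    (p q : Fin m) (x : BTree) : Prop :=
  ∃ (deps : List (Fin n × Fin n)) (trans : List (Fin m × Fin n × FreeMonoid (Fin n) × Fin m)),
    deps.Nodup ∧ IsListing deps {e | D.Dep e.1 e.2} ∧
    trans.Nodup ∧ IsListing trans {t | t ∈ P.trans} ∧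
    x = TreeEncoding.enc (n, deps, m, trans, p, q)

/-- `y` encodes the transducer `T` with letters `0, …, n - 1` and states `0, …, k - 1`. -/
def EncodesTransducer {n k : ℕ} (T : Transducer (Fin n) (Fin k)) (y : BTree) : Prop :=
  ∃ (init : List (Fin k))
    (trans : List (Fin k × (FreeMonoid (Fin n) × FreeMonoid (Fin n)) × Fin k))
    (final : List (Fin k)),
    IsListing init T.init ∧ IsListing trans T.trans ∧ IsListing final T.final ∧
    y = TreeEncoding.enc (n, k, init, trans, final)

/-! ### Traces of reversed words and runs -/

namespace DepAlphabet

variable {A : Type*} (D : DepAlphabet A)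

/-! Reachability is first described by runs on words. A run goes through a word from left to right
and keeps each letter, or replaces it by a transition and processes the new word recursively; a
letter may be replaced only if it is independent from all earlier output. Since D(w) ⊆ D(a) for
every transition, output never depends on more letters than the input it comes from. Hence a
replaced letter commutes with the earlier output, and so does everything it produces, which makes
runs sound (`Run.reach`). Conversely, the first transition of a computation consumes a letter that
can be moved to the front of the word. The diamond condition lets this transition be postponed until
the run has passed the independent letters before it (`Run.swap`, `Run.unstep`). Thus runs capture
reachability on every word that represents the initial trace (`reach_iff_run`), and this
independence of the representative is what yields left-closedness.

The recursion of runs is unbounded, so a finite transducer needs another evaluation order. Let the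
prefix before a replaced letter b yield the output o, and let the word pushed for b yield o'. Then
o' is independent from o, and the two may be written in either order. A machine working from right
to left therefore puts the pushed word on a stack, finishes the prefix first, and requires the
prefix to write only letters independent from b. These requirements are kept in a list F that
matters only through D(F), so it can be kept free of twins. Replaced letters without output are
consumed at once, by consulting a table of output-free runs. Every stored item may then be assumed
to have some output letter. One such letter per stored item gives pairwise independent letters,
hence letters of distinct twin classes, so height TI(D) + 1 suffices for the stack
(`Run.generates`). That no wrong output arises is `Generates.denotes`, which needs no bound.
Reversing the moves between bounded states gives the transducer, and Kleene's construction makes its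
relation rational. If all letters are dependent, the trace congruence is equality, and Caucal's
theorem results.

For the running time, `PolyTimeIn` collects families of functions that a single program computes in
time polynomial in a prescribed weight. It is closed under the usual list operations, and the
transducer is built by such operations. The only super-polynomial steps enumerate lists of length at
most TI(D) or TI(D) + 1; the twin index itself is computed from the listing of the dependence
relation. A weight that dominates these enumerations is bounded by a power of the size with exponent
polynomial in TI(D) (`powLE_weight`). -/

/-- The trace of the word whose letters are listed from right to left. -/
def revTrace (x : List A) : D.Trace := D.trace (FreeMonoid.ofList x.reverse)

theorem trace_mul (u v : FreeMonoid A) : D.trace (u * v) = D.trace u * D.trace v :=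
  map_mul _ _ _

theorem trace_eq_iff (u v : FreeMonoid A) : D.trace u = D.trace v ↔ D.traceCon u v :=
  Con.eq _

@[simp] theorem revTrace_nil : D.revTrace [] = 1 := rfl

theorem revTrace_append (x y : List A) : D.revTrace (x ++ y) = D.revTrace y * D.revTrace x := by
  rw [revTrace, List.reverse_append, FreeMonoid.ofList_append, trace_mul]; rfl

theorem revTrace_cons (b : A) (x : List A) :
    D.revTrace (b :: x) = D.revTrace x * D.trace (FreeMonoid.of b) := by
  rw [revTrace, List.reverse_cons, FreeMonoid.ofList_append, trace_mul]; rfl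

theorem trace_of_comm {a b : A} (h : ¬ D.Dep a b) :
    D.trace (FreeMonoid.of a) * D.trace (FreeMonoid.of b) =
      D.trace (FreeMonoid.of b) * D.trace (FreeMonoid.of a) := by
  rw [← trace_mul, ← trace_mul, trace_eq_iff]
  exact ConGen.Rel.of _ _ ⟨a, b, h, rfl, rfl⟩

theorem commute_revTrace_of {a : A} {x : List A} (h : ∀ e ∈ x, ¬ D.Dep a e) :
    D.trace (FreeMonoid.of a) * D.revTrace x = D.revTrace x * D.trace (FreeMonoid.of a) := by
  induction x with
  | nil => simp
  | cons b x ih =>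
    rw [revTrace_cons, ← mul_assoc, ih fun e he => h e (List.mem_cons_of_mem _ he), mul_assoc,
      D.trace_of_comm (h b (by simp)), mul_assoc]

theorem commute_revTrace {x y : List A} (h : ∀ a ∈ x, ∀ e ∈ y, ¬ D.Dep a e) :
    D.revTrace x * D.revTrace y = D.revTrace y * D.revTrace x := by
  induction x with
  | nil => simp
  | cons b x ih =>
    rw [revTrace_cons, mul_assoc, D.commute_revTrace_of (h b (by simp)), ← mul_assoc,
      ih fun e he => h e (List.mem_cons_of_mem _ he), mul_assoc]

theorem mem_toList_of_traceCon {u v : FreeMonoid A} (h : D.traceCon u v) (a : A) :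
    a ∈ u.toList ↔ a ∈ v.toList := by
  induction h with
  | of u v h =>
    obtain ⟨b, c, -, rfl, rfl⟩ := h
    simp [FreeMonoid.toList_mul, or_comm]
  | refl => rfl
  | symm _ ih => exact ih.symm
  | trans _ _ ih₁ ih₂ => exact ih₁.trans ih₂
  | mul _ _ ih₁ ih₂ => simp only [FreeMonoid.toList_mul, List.mem_append, ih₁, ih₂]

/-! ### Moving a letter to the front of a trace. -/

/-- The letter `a` can be moved to the front of `u`, which leaves the trace of `x`. -/
def Extracts (a : A) (u x : FreeMonoid A) : Prop :=
  ∃ u₁ u₂ : FreeMonoid A, u = u₁ * (FreeMonoid.of a * u₂) ∧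
    (∀ e ∈ u₁.toList, ¬ D.Dep a e) ∧ D.traceCon (u₁ * u₂) x

theorem Extracts.congr_right {D : DepAlphabet A} {a : A} {u x y : FreeMonoid A}
    (h : D.Extracts a u x) (hxy : D.traceCon x y) : D.Extracts a u y := by
  obtain ⟨u₁, u₂, h₁, h₂, h₃⟩ := h
  exact ⟨u₁, u₂, h₁, h₂, D.traceCon.trans h₃ hxy⟩

/-- The moved occurrence lies in one of the two factors. This case distinction carries the induction
over products of congruent words. -/
theorem extracts_mul {a : A} {u v x : FreeMonoid A} (h : D.Extracts a (u * v) x) :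
    (∃ y, D.Extracts a u y ∧ D.traceCon (y * v) x) ∨
      ((∀ e ∈ u.toList, ¬ D.Dep a e) ∧ ∃ y, D.Extracts a v y ∧ D.traceCon (u * y) x) := by
  obtain ⟨u₁, u₂, h₁, h₂, h₃⟩ := h
  have h₁' : u.toList ++ v.toList = u₁.toList ++ a :: u₂.toList := by
    simpa using congrArg FreeMonoid.toList h₁
  rcases List.append_eq_append_iff.1 h₁' with ⟨w, hw, hv⟩ | ⟨w, hw, hv⟩
  · right
    have hw' : u₁ = u * FreeMonoid.ofList w := FreeMonoid.toList.injective (by simpa using hw)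
    have hv' : v = FreeMonoid.ofList w * (FreeMonoid.of a * u₂) :=
      FreeMonoid.toList.injective (by simpa using hv)
    refine ⟨fun e he => h₂ e ?_, FreeMonoid.ofList w * u₂,
      ⟨FreeMonoid.ofList w, u₂, hv', fun e he => h₂ e ?_, D.traceCon.refl _⟩, ?_⟩
    · rw [hw]; exact List.mem_append_left _ he
    · rw [hw]; exact List.mem_append_right _ he
    · rw [← mul_assoc, ← hw']; exact h₃
  · cases w with
    | nil =>
      right
      have hw' : u = u₁ := FreeMonoid.toList.injective (by simpa using hw)
      have hv' : v = FreeMonoid.of a * u₂ := FreeMonoid.toList.injective (by simpa using hv.symm)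
      subst hw'
      exact ⟨h₂, u₂, ⟨1, u₂, by rw [hv', one_mul], by simp, D.traceCon.refl _⟩, h₃⟩
    | cons b w =>
      left
      obtain ⟨rfl, hv⟩ := List.cons.inj hv
      have hw' : u = u₁ * (FreeMonoid.of a * FreeMonoid.ofList w) :=
        FreeMonoid.toList.injective (by simpa using hw)
      have hv' : u₂ = FreeMonoid.ofList w * v := FreeMonoid.toList.injective (by simpa using hv)
      refine ⟨u₁ * FreeMonoid.ofList w, ⟨u₁, _, hw', h₂, D.traceCon.refl _⟩, ?_⟩
      rw [mul_assoc, ← hv']; exact h₃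

theorem Extracts.mul_right {D : DepAlphabet A} {a : A} {u x : FreeMonoid A}
    (h : D.Extracts a u x) (v : FreeMonoid A) : D.Extracts a (u * v) (x * v) := by
  obtain ⟨u₁, u₂, rfl, h₂, h₃⟩ := h
  exact ⟨u₁, u₂ * v, by simp only [mul_assoc], h₂, by
    rw [← mul_assoc]; exact D.traceCon.mul h₃ (D.traceCon.refl v)⟩

theorem Extracts.mul_left {D : DepAlphabet A} {a : A} {u x : FreeMonoid A}
    (h : D.Extracts a u x) {v : FreeMonoid A} (hv : ∀ e ∈ v.toList, ¬ D.Dep a e) :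
    D.Extracts a (v * u) (v * x) := by
  obtain ⟨u₁, u₂, rfl, h₂, h₃⟩ := h
  refine ⟨v * u₁, u₂, by simp only [mul_assoc], fun e he => ?_, by
    rw [mul_assoc]; exact D.traceCon.mul (D.traceCon.refl v) h₃⟩
  rw [FreeMonoid.toList_mul, List.mem_append] at he
  exact he.elim (hv e) (h₂ e)

/-- Induction on the generation of the congruence. Only a single swap needs a computation; for
products the moved letter lies in one factor, and congruent words have the same letters, so the
independence of the other factor is not lost. This plays the role of Levi's lemma for one letter. -/
theorem extracts_iff_of_traceCon {u v : FreeMonoid A} (h : D.traceCon u v) (a : A)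
    (x : FreeMonoid A) : D.Extracts a u x ↔ D.Extracts a v x := by
  have swap : ∀ b c : A, ¬ D.Dep b c → ∀ x, D.Extracts a (FreeMonoid.of b * FreeMonoid.of c) x →
      D.Extracts a (FreeMonoid.of c * FreeMonoid.of b) x := by
    intro b c hbc x h
    have hone : ∀ (e : A) (y : FreeMonoid A), D.Extracts a (FreeMonoid.of e) y →
        e = a ∧ D.traceCon 1 y := by
      rintro e y ⟨u₁, u₂, h₁, -, h₃⟩
      have h₁' : [e] = u₁.toList ++ a :: u₂.toList := by
        simpa using congrArg FreeMonoid.toList h₁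
      cases hu : u₁.toList with
      | nil =>
        rw [hu] at h₁'
        simp only [List.nil_append, List.cons.injEq] at h₁'
        have e₁ : u₁ = 1 := FreeMonoid.toList.injective hu
        have e₂ : u₂ = 1 := FreeMonoid.toList.injective h₁'.2.symm
        rw [e₁, e₂] at h₃
        exact ⟨h₁'.1, by simpa using h₃⟩
      | cons f l => rw [hu] at h₁'; simp at h₁'
    have self : ∀ w : FreeMonoid A, D.Extracts a (FreeMonoid.of a * w) w := fun w =>
      ⟨1, w, by rw [one_mul], by simp, by rw [one_mul]; exact D.traceCon.refl _⟩
    rcases D.extracts_mul h with ⟨y, hy, hyx⟩ | ⟨hb, y, hy, hyx⟩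
    · obtain ⟨rfl, h1⟩ := hone _ _ hy
      refine ⟨FreeMonoid.of c, 1, by simp, by simpa using hbc, ?_⟩
      refine D.traceCon.trans ?_ hyx
      simpa using D.traceCon.mul h1 (D.traceCon.refl (FreeMonoid.of c))
    · obtain ⟨rfl, h1⟩ := hone _ _ hy
      refine (self _).congr_right (D.traceCon.trans ?_ hyx)
      simpa using D.traceCon.mul (D.traceCon.refl (FreeMonoid.of b)) h1
  induction h generalizing x with
  | of u v h =>
    obtain ⟨b, c, hbc, rfl, rfl⟩ := h
    exact ⟨swap b c hbc x, swap c b (fun h => hbc (D.symm _ _ h)) x⟩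
  | refl => rfl
  | symm _ ih => exact (ih x).symm
  | trans _ _ ih₁ ih₂ => exact (ih₁ x).trans (ih₂ x)
  | @mul u u' v v' h₁ h₂ ih₁ ih₂ =>
    have h₁ : D.traceCon u u' := h₁
    have h₂ : D.traceCon v v' := h₂
    constructor
    · intro h
      rcases D.extracts_mul h with ⟨y, hy, hyx⟩ | ⟨hb, y, hy, hyx⟩
      · exact (((ih₁ y).1 hy).mul_right v').congr_right
          (D.traceCon.trans (D.traceCon.mul (D.traceCon.refl y) (D.traceCon.symm h₂)) hyx)
      · exact (((ih₂ y).1 hy).mul_left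
            fun e he => hb e ((D.mem_toList_of_traceCon h₁ e).2 he)).congr_right
          (D.traceCon.trans (D.traceCon.mul (D.traceCon.symm h₁) (D.traceCon.refl y)) hyx)
    · intro h
      rcases D.extracts_mul h with ⟨y, hy, hyx⟩ | ⟨hb, y, hy, hyx⟩
      · exact (((ih₁ y).2 hy).mul_right v).congr_right
          (D.traceCon.trans (D.traceCon.mul (D.traceCon.refl y) h₂) hyx)
      · exact (((ih₂ y).2 hy).mul_left
            fun e he => hb e ((D.mem_toList_of_traceCon h₁ e).1 he)).congr_right
          (D.traceCon.trans (D.traceCon.mul h₁ (D.traceCon.refl y)) hyx)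

/-- A letter in front of a trace is an extractable letter of each word that represents it. -/
theorem exists_of_revTrace_eq {y : List A} {a : A} {x : FreeMonoid A}
    (h : D.revTrace y = D.trace (FreeMonoid.of a * x)) :
    ∃ y₁ y₂ : List A, y = y₂ ++ a :: y₁ ∧ (∀ e ∈ y₁, ¬ D.Dep a e) ∧
      D.revTrace (y₂ ++ y₁) = D.trace x := by
  have h₀ : D.Extracts a (FreeMonoid.of a * x) x :=
    ⟨1, x, by rw [one_mul], by simp, by rw [one_mul]; exact D.traceCon.refl _⟩
  obtain ⟨u₁, u₂, h₁, h₂, h₃⟩ :=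
    (D.extracts_iff_of_traceCon ((D.trace_eq_iff _ _).1 h) a x).2 h₀
  have h₁' : y.reverse = u₁.toList ++ a :: u₂.toList := by
    simpa using congrArg FreeMonoid.toList h₁
  refine ⟨u₁.toList.reverse, u₂.toList.reverse, ?_, by simpa using h₂, ?_⟩
  · rw [← List.reverse_reverse y, h₁']; simp
  · rw [revTrace]
    simpa using (D.trace_eq_iff _ _).2 h₃

end DepAlphabet

/-! ### Runs on words and their equivalence with reachability of traces. -/

namespace PushdownSystem

variable {A Q : Type*} (P : PushdownSystem A Q) (D : DepAlphabet A)

/-- `P.Run D r x s o`: the letters of the reversed word `x` are processed from right to left in the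
list (left to right in the word), each of them being kept, or being replaced by a transition and
processed recursively; the control state changes from `r` to `s` and the output is the reversed
word `o`. A letter may be replaced only if it is independent from all previous output. -/
inductive Run : Q → List A → Q → List A → Prop
  | nil (r : Q) : Run r [] r []
  | keep {r s : Q} {x o : List A} (b : A) : Run r x s o → Run r (b :: x) s (b :: o)
  | touch {r t r' s : Q} {x o o' : List A} {b : A} {v : FreeMonoid A} :
      Run r x t o → (∀ e ∈ o, ¬ D.Dep b e) → (t, b, v, r') ∈ P.trans →
      Run r' v.toList.reverse s o' → Run r (b :: x) s (o' ++ o)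

variable {P D}

theorem IsTPDS.dep_of_dep (h : P.IsTPDS D) {p q : Q} {a c d : A} {w : FreeMonoid A}
    (ht : (p, a, w, q) ∈ P.trans) (hc : c ∈ w.toList) (hd : D.Dep c d) : D.Dep a d :=
  h.dep_subset p a w q ht ⟨c, hc, hd⟩

/-- The inclusion D(w) ⊆ D(a) of single transitions propagates through the recursion: the output of
a run has no dependences that its input lacks. -/
theorem Run.dep (h : P.IsTPDS D) {r s : Q} {x o : List A} (hr : P.Run D r x s o) :
    ∀ e ∈ o, ∀ d, D.Dep e d → ∃ b ∈ x, D.Dep b d := by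
  induction hr with
  | nil => simp
  | keep b _ ih =>
    intro e he d hd
    rcases List.mem_cons.1 he with rfl | he
    · exact ⟨e, by simp, hd⟩
    · obtain ⟨c, hc, hcd⟩ := ih e he d hd
      exact ⟨c, List.mem_cons_of_mem _ hc, hcd⟩
  | @touch r t r' s x o o' b v _ _ ht _ ih₁ ih₂ =>
    intro e he d hd
    rcases List.mem_append.1 he with he | he
    · obtain ⟨c, hc, hcd⟩ := ih₂ e he d hd
      exact ⟨b, by simp, h.dep_of_dep ht (List.mem_reverse.1 hc) hcd⟩
    · obtain ⟨c, hc, hcd⟩ := ih₁ e he d hd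
      exact ⟨c, List.mem_cons_of_mem _ hc, hcd⟩

theorem Run.not_dep (h : P.IsTPDS D) {r s : Q} {x o : List A} (hr : P.Run D r x s o) {a : A}
    (ha : ∀ b ∈ x, ¬ D.Dep a b) : ∀ e ∈ o, ¬ D.Dep a e := by
  intro e he hae
  obtain ⟨b, hb, hba⟩ := hr.dep h e he a (D.symm _ _ hae)
  exact ha b hb (D.symm _ _ hba)

/-- The output of a transition's word is independent from every letter that is independent from the
letter that was replaced. -/
theorem Run.not_dep_of_trans (h : P.IsTPDS D) {t r' s : Q} {o' : List A} {a b : A}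
    {v : FreeMonoid A} (ht : (t, b, v, r') ∈ P.trans) (hr : P.Run D r' v.toList.reverse s o')
    (ha : ¬ D.Dep b a) : ∀ e ∈ o', ¬ D.Dep e a := by
  intro e he hea
  obtain ⟨c, hc, hca⟩ := hr.dep h e he a hea
  exact ha (h.dep_of_dep ht (List.mem_reverse.1 hc) hca)

/-- Cutting a run only weakens its side conditions, as a replacement in the later part need no
longer be independent from the output of the earlier part. For this reason gluing two runs is not
possible in general. -/
theorem Run.append_split {r s : Q} {y x o : List A} (hr : P.Run D r (y ++ x) s o) :
    ∃ t o₁ o₂, P.Run D r x t o₁ ∧ P.Run D t y s o₂ ∧ o = o₂ ++ o₁ := by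
  induction y generalizing s o with
  | nil => exact ⟨s, o, [], hr, .nil s, rfl⟩
  | cons b y ih =>
    cases hr with
    | keep _ hr =>
      obtain ⟨t, o₁, o₂, h₁, h₂, rfl⟩ := ih hr
      exact ⟨t, o₁, b :: o₂, h₁, .keep b h₂, rfl⟩
    | touch hr hb ht hr' =>
      obtain ⟨t, o₁, o₂, h₁, h₂, rfl⟩ := ih hr
      exact ⟨t, o₁, _ ++ o₂, h₁,
        .touch h₂ (fun e he => hb e (List.mem_append_left _ he)) ht hr', by simp⟩

/-- A transition commutes with a run on letters that are independent from its letter. -/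
theorem Run.swap (h : P.IsTPDS D) {p p' s : Q} {a : A} {w : FreeMonoid A} {y o : List A}
    (ht : (p, a, w, p') ∈ P.trans) (hr : P.Run D p' y s o) (ha : ∀ e ∈ y, ¬ D.Dep a e) :
    ∃ t, P.Run D p y t o ∧ (t, a, w, s) ∈ P.trans := by
  induction hr generalizing p with
  | nil r => exact ⟨p, .nil p, ht⟩
  | keep b _ ih =>
    obtain ⟨t, h₁, h₂⟩ := ih ht fun e he => ha e (List.mem_cons_of_mem _ he)
    exact ⟨t, .keep b h₁, h₂⟩
  | @touch r t r' s x o o' b v hr hb hbt hr' ih₁ ih₂ =>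
    obtain ⟨t₁, h₁, h₂⟩ := ih₁ ht fun e he => ha e (List.mem_cons_of_mem _ he)
    have hab : ¬ D.Dep a b := ha b (by simp)
    have hav : ∀ e ∈ v.toList, ¬ D.Dep a e := fun e he hae =>
      hab (D.symm _ _ (h.dep_of_dep hbt he (D.symm _ _ hae)))
    -- The diamond condition applies because D(w) ⊆ D(a) and D(v) ⊆ D(b) extend the independence of
    -- `a` and `b` to the pushed words. The exchanged `a`-transition then starts before the
    -- recursive run on `v`, past which the second induction hypothesis moves it.
    obtain ⟨q', h₃, h₄⟩ := h.diamond t₁ a w t b v r' h₂ hbt (by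
      intro c hc d hd hcd
      have hcd' : D.Dep a d := by
        rw [FreeMonoid.toList_mul, List.mem_append] at hc
        rcases hc with hc | hc
        · simp at hc; exact hc ▸ hcd
        · exact h.dep_of_dep h₂ hc hcd
      rw [FreeMonoid.toList_mul, List.mem_append] at hd
      rcases hd with hd | hd
      · simp at hd; exact hab (hd ▸ hcd')
      · exact hav d hd hcd')
    obtain ⟨t₂, h₅, h₆⟩ := ih₂ h₄ fun e he => hav e (List.mem_reverse.1 he)
    exact ⟨t₂, .touch h₁ hb h₃ h₅, h₆⟩

/-- The transition made at the start is postponed past `y₁` by `Run.swap` and becomes the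
replacement of `a`. The recursive run on `w` is the part of the given run that follows `y₁`, and the
letters of `y₂` are treated as before. -/
theorem Run.unstep (h : P.IsTPDS D) {p p' s : Q} {a : A} {w : FreeMonoid A} {y₁ y₂ o : List A}
    (ht : (p, a, w, p') ∈ P.trans) (ha : ∀ e ∈ y₁, ¬ D.Dep a e)
    (hr : P.Run D p' (y₂ ++ (w.toList.reverse ++ y₁)) s o) : P.Run D p (y₂ ++ a :: y₁) s o := by
  induction y₂ generalizing s o with
  | nil =>
    obtain ⟨t, o₁, o₂, h₁, h₂, rfl⟩ :=
      Run.append_split (y := w.toList.reverse) (x := y₁) hr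
    obtain ⟨t', h₃, h₄⟩ := h₁.swap h ht ha
    exact .touch h₃ (h₃.not_dep h ha) h₄ h₂
  | cons b y ih =>
    cases hr with
    | keep _ hr => exact .keep b (ih hr)
    | touch hr hb ht hr' => exact .touch (ih hr) hb ht hr'

theorem Run.keepAll (r : Q) (x : List A) : P.Run D r x r x := by
  induction x with
  | nil => exact .nil r
  | cons b x ih => exact .keep b ih

/-- Induction from the first step of the computation, for all representing words at once: the
successor trace is represented by replacing, inside the given word, the letter that was moved to the
front. -/
theorem exists_run_of_reach (h : P.IsTPDS D) {c d : Q × D.Trace}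
    (hr : Relation.ReflTransGen (P.Step D) c d) (u : List A) (hu : D.revTrace u = c.2) :
    ∃ o, P.Run D c.1 u d.1 o ∧ D.revTrace o = d.2 := by
  induction hr using Relation.ReflTransGen.head_induction_on generalizing u with
  | refl => exact ⟨u, .keepAll _ _, hu⟩
  | @head c c' hs _ ih =>
    obtain ⟨a, w, x, ht, hc, hc'⟩ := hs
    obtain ⟨y₁, y₂, rfl, hy, hx⟩ := D.exists_of_revTrace_eq (hu.trans hc)
    -- The pushed word inherits the independence of `a` from `y₁`, so it may stand at the place of
    -- `a` instead of at the front.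
    have hw : ∀ e ∈ w.toList, ∀ b ∈ y₁, ¬ D.Dep e b := fun e he b hb heb =>
      hy b hb (h.dep_of_dep ht he heb)
    obtain ⟨o, ho, ho'⟩ := ih (y₂ ++ (w.toList.reverse ++ y₁)) (by
      rw [hc', D.trace_mul, ← hx, D.revTrace_append, D.revTrace_append, D.revTrace_append]
      rw [D.commute_revTrace (x := y₁) (y := w.toList.reverse), mul_assoc]
      · simp [DepAlphabet.revTrace]
      · exact fun b hb e he heb => hw e (List.mem_reverse.1 he) b hb (D.symm _ _ heb))
    exact ⟨o, Run.unstep h ht hy ho, ho'⟩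

theorem reach_mul {c d : Q × D.Trace} (hr : Relation.ReflTransGen (P.Step D) c d) (y : D.Trace) :
    Relation.ReflTransGen (P.Step D) (c.1, c.2 * y) (d.1, d.2 * y) := by
  induction hr with
  | refl => exact .refl
  | tail _ hs ih =>
    refine ih.tail ?_
    obtain ⟨a, w, x, ht, hc, hd⟩ := hs
    obtain ⟨z, rfl⟩ := Con.mk'_surjective y
    exact ⟨a, w, x * z, ht, by rw [← mul_assoc, D.trace_mul, ← hc]; rfl,
      by rw [← mul_assoc, D.trace_mul, ← hd]; rfl⟩

/-- When a letter is replaced, it is independent from the output so far and can be brought to the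
front, where the transition and the computation of the pushed word take place. -/
theorem Run.reach (h : P.IsTPDS D) {r s : Q} {x o : List A} (hr : P.Run D r x s o) :
    Relation.ReflTransGen (P.Step D) (r, D.revTrace x) (s, D.revTrace o) := by
  induction hr with
  | nil => exact .refl
  | keep b _ ih =>
    rw [D.revTrace_cons, D.revTrace_cons]
    exact reach_mul ih _
  | @touch r t r' s x o o' b v _ hb ht hr' ih₁ ih₂ =>
    -- The new output arises in front of the earlier one, but a run lists it behind; both orders
    -- give the same trace.
    have e₁ : D.revTrace o' * D.revTrace o = D.revTrace (o' ++ o) := by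
      rw [D.revTrace_append]
      exact D.commute_revTrace fun e he c hc =>
        Run.not_dep_of_trans h ht hr' (hb c hc) e he
    rw [D.revTrace_cons, ← e₁]
    refine (reach_mul ih₁ (D.trace (FreeMonoid.of b))).trans
      (Relation.ReflTransGen.head ?_ (reach_mul ih₂ (D.revTrace o)))
    refine ⟨b, v, FreeMonoid.ofList o.reverse, ht, ?_, ?_⟩
    · rw [D.trace_mul]; exact (D.commute_revTrace_of hb).symm
    · rw [D.trace_mul]; simp [DepAlphabet.revTrace]

/-- Reachability in trace semantics is described by runs on an arbitrary representing word. -/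
theorem reach_iff_run (h : P.IsTPDS D) (p q : Q) (u : List A) (y : D.Trace) :
    (D.revTrace u, y) ∈ P.Reach D p q ↔ ∃ o, P.Run D p u q o ∧ D.revTrace o = y := by
  constructor
  · exact fun hr => exists_run_of_reach h hr u rfl
  · rintro ⟨o, ho, rfl⟩
    exact ho.reach h

end PushdownSystem

/-! ### The machine that generates the outputs of runs -/

namespace DepAlphabet

variable {A : Type*} (D : DepAlphabet A)

theorem length_le_twinIndex [Finite A] {l : List A}
    (h : l.Pairwise fun a b => D.ofLetter a ≠ D.ofLetter b) : l.length ≤ D.twinIndex := by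
  classical
  have hn : (l.map D.twins).Nodup := by
    rw [List.Nodup, List.pairwise_map]
    refine h.imp fun {a b} hab htw => hab ?_
    have : b ∈ D.twins a := by rw [htw]; exact rfl
    exact this
  rw [← List.length_map (f := D.twins), ← List.toFinset_card_of_nodup hn, twinIndex,
    ← Set.ncard_coe_finset]
  refine Set.ncard_le_ncard (fun x hx => ?_) (Set.toFinite _)
  simp only [List.coe_toFinset, List.mem_map, Set.mem_ofPred_eq] at hx
  obtain ⟨a, -, rfl⟩ := hx
  exact ⟨a, rfl⟩

theorem ofLetter_ne_of_not_dep {a b : A} (h : ¬ D.Dep a b) : D.ofLetter a ≠ D.ofLetter b := by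
  intro hab
  have : b ∈ D.ofLetter b := D.refl b
  rw [← hab] at this
  exact h this

end DepAlphabet

namespace PushdownSystem

/-- An item `(r, x, s, F)` stands for the outputs of runs from `r` to `s` on the reversed word `x`
that are independent from all letters of `F`. -/
abbrev Item (A Q : Type*) : Type _ := Q × List A × Q × List A

/-- The states of the machine: a stack of items, and a flag telling whether input may be read. -/
abbrev MachineState (A Q : Type*) : Type _ := Bool × List (Item A Q)

variable {A Q : Type*} (P : PushdownSystem A Q) (D : DepAlphabet A)

/-- `F'` represents the union of `D(F)` and `D(b)`. -/
def Extends (b : A) (F F' : List A) : Prop :=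
  F' = b :: F ∨ (F' = F ∧ ∃ e ∈ F, ∀ d, D.Dep b d → D.Dep e d)

/-- The moves of the machine, labeled by the input and the output. The input is read and the output
is generated from right to left. -/
inductive Move : MachineState A Q → List A × List A → MachineState A Q → Prop
  | drop (f : Bool) (r : Q) (F : List A) (k : List (Item A Q)) :
      Move (f, (r, [], r, F) :: k) ([], []) (false, k)
  | keep (f : Bool) (r s : Q) (b : A) (x F : List A) (k : List (Item A Q)) :
      (∀ e ∈ F, ¬ D.Dep b e) →
      Move (f, (r, b :: x, s, F) :: k) ([], [b]) (f, (r, x, s, F) :: k)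
  | pop (f : Bool) (r t r' s : Q) (b : A) (v : FreeMonoid A) (x F F' : List A)
      (k : List (Item A Q)) :
      (t, b, v, r') ∈ P.trans → P.Run D r' v.toList.reverse s [] → Extends D b F F' →
      Move (f, (r, b :: x, s, F) :: k) ([], []) (f, (r, x, t, F') :: k)
  | touch (f : Bool) (r t r' s : Q) (b : A) (v : FreeMonoid A) (x F F' : List A)
      (k : List (Item A Q)) :
      (t, b, v, r') ∈ P.trans → Extends D b F F' →
      Move (f, (r, b :: x, s, F) :: k) ([], [])
        (f, (r, x, t, F') :: (r', v.toList.reverse, s, F) :: k)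
  | read (r s : Q) (c : A) (F : List A) (k : List (Item A Q)) :
      Move (true, (r, [], s, F) :: k) ([c], []) (true, (r, [c], s, F) :: k)

variable {P D} in
theorem Move.length_le {σ σ' : MachineState A Q} {u v : List A} (h : P.Move D σ (u, v) σ') :
    u.length + v.length ≤ 1 := by
  cases h <;> simp

variable {P D} in
theorem Move.reverse_eq {σ σ' : MachineState A Q} {u v : List A} (h : P.Move D σ (u, v) σ') :
    u.reverse = u ∧ v.reverse = v := by
  cases h <;> simp

/-- The transducer whose states are labeled by states of the machine, and whose transitions are the
reversed moves. -/
def machineTransducer {κ : Type*} (π : κ → MachineState A Q) (p q : Q) : Transducer A κ where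
  init := {i | π i = (false, [])}
  trans := {t | ∃ u v, P.Move D (π t.2.2) (u, v) (π t.1) ∧
    t.2.1 = (FreeMonoid.ofList u, FreeMonoid.ofList v)}
  final := {i | π i = (true, [(p, [], q, [])])}
  label_le := by
    rintro i u v j ⟨u', v', h, he⟩
    obtain ⟨rfl, rfl⟩ := Prod.mk.inj he
    rw [FreeMonoid.length_mul]
    exact h.length_le

/-- `P.Generates D S σ u v`: from the state `σ` the machine reaches the empty stack, visiting only
states from `S`, reading `u` and writing `v` (both reversed). -/
inductive Generates (S : Set (MachineState A Q)) : MachineState A Q → List A → List A → Prop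
  | empty : (false, []) ∈ S → Generates S (false, []) [] []
  | move {σ σ' : MachineState A Q} {a b u v : List A} : σ ∈ S → P.Move D σ (a, b) σ' →
      Generates S σ' u v → Generates S σ (a ++ u) (b ++ v)

variable {P D}

theorem Generates.mem {S : Set (MachineState A Q)} {σ : MachineState A Q} {u v : List A}
    (h : P.Generates D S σ u v) : σ ∈ S := by
  cases h <;> assumption

/-- Transitions are reversed moves, so a path from `i` to `j` is a computation of the machine from
`π j` to `π i`, with the words of its label read backwards. The labeling `π` need not be injective:
a machine state may have several numbers. -/
theorem generates_of_path {κ : Type*} {π : κ → MachineState A Q} {p q : Q} {i j : κ}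
    {x : FreeMonoid A × FreeMonoid A} (h : (P.machineTransducer D π p q).Path i x j) :
    ∀ u v : List A, P.Generates D (Set.range π) (π i) u v →
      P.Generates D (Set.range π) (π j) (x.1.toList.reverse ++ u) (x.2.toList.reverse ++ v) := by
  induction h with
  | refl => intro u v h; exact h
  | step i j k x y ht _ ih =>
    intro u v h
    obtain ⟨a, b, hm, he⟩ := ht
    have he : x = (FreeMonoid.ofList a, FreeMonoid.ofList b) := he
    have hm' : P.Move D (π j) (a, b) (π i) := hm
    have hr : a.reverse = a ∧ b.reverse = b := hm'.reverse_eq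
    subst he
    have := ih _ _ (.move ⟨j, rfl⟩ hm' h)
    simpa [FreeMonoid.toList_mul, hr.1, hr.2] using this

theorem path_snoc {S : Type*} {T : Transducer A S} {i j k : S} {x y : FreeMonoid A × FreeMonoid A}
    (h : T.Path i x j) (ht : (j, y, k) ∈ T.trans) : T.Path i (x * y) k := by
  induction h with
  | refl => simpa using Transducer.Path.step _ _ _ y 1 ht (.refl _)
  | step i j l x z hx _ ih =>
    rw [mul_assoc]
    exact .step _ _ _ _ _ hx (ih ht)

theorem path_of_generates {κ : Type*} {π : κ → MachineState A Q} {p q : Q} {σ : MachineState A Q}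
    {u v : List A} (h : P.Generates D (Set.range π) σ u v) : ∀ j, π j = σ → ∃ i,
      π i = (false, []) ∧ (P.machineTransducer D π p q).Path i
        (FreeMonoid.ofList u.reverse, FreeMonoid.ofList v.reverse) j := by
  induction h with
  | empty _ => exact fun j hj => ⟨j, hj, .refl j⟩
  | @move σ σ' a b u v _ hm hg ih =>
    intro j hj
    obtain ⟨l, hl⟩ := hg.mem
    obtain ⟨i, hi, hp⟩ := ih l hl
    refine ⟨i, hi, ?_⟩
    have hr : a.reverse = a ∧ b.reverse = b := hm.reverse_eq
    have := path_snoc hp (y := (FreeMonoid.ofList a, FreeMonoid.ofList b)) (k := j)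
      ⟨a, b, by simpa only [hj, hl] using hm, rfl⟩
    simpa [FreeMonoid.ofList_append, hr.1, hr.2] using this

theorem mem_accepted_iff {κ : Type*} {π : κ → MachineState A Q} {p q : Q} (u v : List A) :
    (FreeMonoid.ofList u.reverse, FreeMonoid.ofList v.reverse) ∈
        (P.machineTransducer D π p q).accepted ↔
      P.Generates D (Set.range π) (true, [(p, [], q, [])]) u v := by
  constructor
  · rintro ⟨i, hi, j, hj, h⟩
    have hi : π i = _ := hi
    have hj : π j = _ := hj
    have := generates_of_path h [] [] (by rw [hi]; exact .empty ⟨i, hi⟩)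
    rw [hj] at this
    simpa using this
  · intro h
    obtain ⟨j, hj⟩ := h.mem
    obtain ⟨i, hi, hp⟩ := path_of_generates (p := p) (q := q) h j hj
    exact ⟨i, hi, j, hj, hp⟩

/-! ### Soundness -/

/-- The meaning of a state of the machine: the reversed word `v` is composed of outputs of the items
of the stack, where `u` is appended to the word of the top item if the flag is set. -/
def Denotes (P : PushdownSystem A Q) (D : DepAlphabet A) :
    Bool → List (Item A Q) → List A → List A → Prop
  | f, [], u, v => f = false ∧ u = [] ∧ v = []
  | f, (r, x, s, F) :: k, u, v => ∃ z v', (f = false → u = []) ∧ P.Run D r (x ++ u) s z ∧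
      (∀ a ∈ z, ∀ e ∈ F, ¬ D.Dep a e) ∧ Denotes P D false k [] v' ∧
      D.revTrace v = D.revTrace v' * D.revTrace z

theorem Extends.not_dep {b : A} {F F' : List A} (h : Extends D b F F') {a : A}
    (ha : ∀ e ∈ F', ¬ D.Dep a e) : ¬ D.Dep a b ∧ ∀ e ∈ F, ¬ D.Dep a e := by
  rcases h with rfl | ⟨rfl, e, he, hbe⟩
  · exact ⟨ha b (by simp), fun e he => ha e (List.mem_cons_of_mem _ he)⟩
  · exact ⟨fun hab => ha e he (D.symm _ _ (hbe a (D.symm _ _ hab))), ha⟩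

/-- Induction backwards from the empty stack: each move undoes one rule of a run on the top item. A
`touch` merges the two topmost items again; the requirement recorded in `F'` is exactly the side
condition of the replacement. No bound on the stack is involved. -/
theorem Generates.denotes (h : P.IsTPDS D) {S : Set (MachineState A Q)} {σ : MachineState A Q}
    {u v : List A} (hg : P.Generates D S σ u v) : Denotes P D σ.1 σ.2 u v := by
  induction hg with
  | empty => exact ⟨rfl, rfl, rfl⟩
  | @move σ σ' a b u v _ hm _ ih =>
    cases hm with
    | drop f r F k =>
      cases k with
      | nil =>
        obtain ⟨-, rfl, rfl⟩ := ih
        exact ⟨[], [], by simp, .nil r, by simp, ⟨rfl, rfl, rfl⟩, by simp⟩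
      | cons i k =>
        obtain ⟨r', x, s, F'⟩ := i
        obtain ⟨z, v', hu, hz⟩ := id ih
        -- The flag is unset after `drop`, so no input remains for the items below.
        obtain rfl := hu rfl
        exact ⟨[], v, by simp, .nil r, by simp, ih, by simp⟩
    | keep f r s b x F k hb =>
      obtain ⟨z, v', hu, hz, hF, hv, hvz⟩ := ih
      refine ⟨b :: z, v', hu, .keep b hz, ?_, hv, ?_⟩
      · intro a ha
        rcases List.mem_cons.1 ha with rfl | ha
        · exact hb
        · exact hF a ha
      · simp only [List.singleton_append, D.revTrace_cons, hvz, mul_assoc]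
    | pop f r t r' s b w x F F' k ht hw hE =>
      obtain ⟨z, v', hu, hz, hF, hv, hvz⟩ := ih
      exact ⟨[] ++ z, v', hu, .touch hz
        (fun e he hbe => (hE.not_dep (hF e he)).1 (D.symm _ _ hbe)) ht hw,
        fun a ha => (hE.not_dep (hF a ha)).2, hv, hvz⟩
    | touch f r t r' s b w x F F' k ht hE =>
      obtain ⟨z, v', hu, hz, hF, ⟨y, v'', -, hy, hyF, hv'', hvy⟩, hvz⟩ := ih
      have hzb : ∀ e ∈ z, ¬ D.Dep b e := fun e he hbe =>
        (hE.not_dep (hF e he)).1 (D.symm _ _ hbe)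
      rw [List.append_nil] at hy
      refine ⟨y ++ z, v'', hu, .touch hz hzb ht hy, ?_, hv'', ?_⟩
      · intro a ha
        rcases List.mem_append.1 ha with ha | ha
        · exact hyF a ha
        · exact (hE.not_dep (hF a ha)).2
      -- The machine has written the output of the prefix first, that is, to the right of the output
      -- of the pushed word. A run puts it to the left.
      · have hc : D.revTrace y * D.revTrace z = D.revTrace z * D.revTrace y :=
          D.commute_revTrace fun e he c hc =>
            Run.not_dep_of_trans h ht hy (hzb c hc) e he
        show D.revTrace v = _
        rw [D.revTrace_append, hvz, hvy, mul_assoc, hc]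
    | read r s c F k =>
      obtain ⟨z, v', hu, hz, hF, hv, hvz⟩ := ih
      exact ⟨z, v', by simp, hz, hF, hv, hvz⟩

/-! ### Completeness -/

/-- The words that occur in items: the reversed prefixes of words of transitions, and the words of
length at most one. -/
def ItemWord (P : PushdownSystem A Q) (x : List A) : Prop :=
  x = [] ∨ (∃ c, x = [c]) ∨ ∃ t b v r', (t, b, v, r') ∈ P.trans ∧ x <:+ v.toList.reverse

theorem ItemWord.tail {x : List A} {b : A} (h : P.ItemWord (b :: x)) : P.ItemWord x := by
  rcases h with h | ⟨c, h⟩ | ⟨t, a, v, r', ht, hx⟩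
  · simp at h
  · exact .inl (List.cons.inj h).2
  · exact .inr (.inr ⟨t, a, v, r', ht, (List.suffix_cons b x).trans hx⟩)

/-- The states of the machine that suffice to generate all outputs. -/
def boundedStates (P : PushdownSystem A Q) (D : DepAlphabet A) : Set (MachineState A Q) :=
  {σ | σ.2.length ≤ D.twinIndex + 1 ∧
    ∀ i ∈ σ.2, P.ItemWord i.2.1 ∧ i.2.2.2.length ≤ D.twinIndex}

/-- No two letters are twins. -/
def Untwinned (D : DepAlphabet A) (F : List A) : Prop :=
  F.Pairwise fun a b => D.ofLetter a ≠ D.ofLetter b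

/-- If D(b) is contained in D(e) for some listed letter `e`, nothing has to be added. Otherwise `b`
is a twin of no listed letter, so adding it keeps the list free of twins. -/
theorem exists_extends {F : List A} (hF : Untwinned D F) (b : A) :
    ∃ F', Extends D b F F' ∧ Untwinned D F' ∧ ∀ e ∈ F', e = b ∨ e ∈ F := by
  by_cases h : ∃ e ∈ F, ∀ d, D.Dep b d → D.Dep e d
  · exact ⟨F, .inr ⟨rfl, h⟩, hF, fun e he => .inr he⟩
  · refine ⟨b :: F, .inl rfl, List.pairwise_cons.2 ⟨fun e he hbe => h ⟨e, he, ?_⟩, hF⟩, by simp⟩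
    intro d hd
    have : d ∈ D.ofLetter e := hbe ▸ hd
    exact this

/-- The list `es` holds one output letter of each item below the top. These witnesses are pairwise
independent, and the output of the current run is independent from all of them; both properties
survive a push, since the output of a pushed word is independent from that of the prefix.
Independent letters are not twins, whence the height of the stack. Because output is reordered, only
the trace of `o` is reproduced. -/
theorem Run.generates [Finite A] (h : P.IsTPDS D) {S : Set (MachineState A Q)}
    (hS : P.boundedStates D ⊆ S) {r s : Q} {x o : List A} (hr : P.Run D r x s o) :
    ∀ (f : Bool) (x₁ x₂ F es : List A) (k : List (Item A Q)), x = x₁ ++ x₂ →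
      (f = false → x₂ = []) → P.ItemWord x₁ → Untwinned D F →
      (∀ a ∈ o, ∀ e ∈ F, ¬ D.Dep a e) → es.length = k.length →
      es.Pairwise (fun a b => ¬ D.Dep a b) → (∀ a ∈ o, ∀ e ∈ es, ¬ D.Dep a e) →
      (∀ i ∈ k, P.ItemWord i.2.1 ∧ i.2.2.2.length ≤ D.twinIndex) →
      ∀ v, P.Generates D S (false, k) [] v →
      ∃ o', D.revTrace o' = D.revTrace o ∧
        P.Generates D S (f, (r, x₁, s, F) :: k) x₂ (o' ++ v) := by
  -- The witnesses account for the items below the top, and the top item is the additional one in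
  -- the height TI + 1.
  have bound : ∀ {f : Bool} {r s : Q} {x₁ F es : List A} {k : List (Item A Q)}, P.ItemWord x₁ →
      Untwinned D F → es.length = k.length → es.Pairwise (fun a b => ¬ D.Dep a b) →
      (∀ i ∈ k, P.ItemWord i.2.1 ∧ i.2.2.2.length ≤ D.twinIndex) →
      (f, (r, x₁, s, F) :: k) ∈ S := by
    intro f r s x₁ F es k hx hF hes hp hk
    refine hS ⟨?_, fun i hi => ?_⟩
    · rw [List.length_cons, ← hes]
      exact Nat.succ_le_succ (D.length_le_twinIndex (hp.imp D.ofLetter_ne_of_not_dep))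
    · rcases List.mem_cons.1 hi with rfl | hi
      · exact ⟨hx, D.length_le_twinIndex hF⟩
      · exact hk i hi
  induction hr with
  | nil r =>
    intro f x₁ x₂ F es k hx _ hw hF hFo hes hp _ hk v hv
    obtain ⟨rfl, rfl⟩ := List.append_eq_nil_iff.1 hx.symm
    exact ⟨[], rfl, .move (bound hw hF hes hp hk) (.drop f r F k) hv⟩
  | @keep r s x o b hr ih =>
    -- Here `b` already belongs to the top item. If the word of the item is exhausted, the flag must
    -- be set, and `b` is first read from the input.
    have key : ∀ (f : Bool) (x₁ x₂ F es : List A) (k : List (Item A Q)), x = x₁ ++ x₂ →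
        (f = false → x₂ = []) → P.ItemWord (b :: x₁) → Untwinned D F →
        (∀ a ∈ b :: o, ∀ e ∈ F, ¬ D.Dep a e) → es.length = k.length →
        es.Pairwise (fun a b => ¬ D.Dep a b) → (∀ a ∈ b :: o, ∀ e ∈ es, ¬ D.Dep a e) →
        (∀ i ∈ k, P.ItemWord i.2.1 ∧ i.2.2.2.length ≤ D.twinIndex) →
        ∀ v, P.Generates D S (false, k) [] v →
        ∃ o', D.revTrace o' = D.revTrace (b :: o) ∧
          P.Generates D S (f, (r, b :: x₁, s, F) :: k) x₂ (o' ++ v) := by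
      intro f x₁ x₂ F es k hx hf hw hF hFo hes hp hpo hk v hv
      obtain ⟨o', ho', hg⟩ := ih f x₁ x₂ F es k hx hf hw.tail hF
        (fun a ha => hFo a (List.mem_cons_of_mem _ ha)) hes hp
        (fun a ha => hpo a (List.mem_cons_of_mem _ ha)) hk v hv
      exact ⟨b :: o', by rw [D.revTrace_cons, D.revTrace_cons, ho'],
        .move (bound hw hF hes hp hk) (.keep f r s b x₁ F k (hFo b (by simp))) hg⟩
    intro f x₁ x₂ F es k hx hf hw hF hFo hes hp hpo hk v hv
    cases x₁ with
    | cons c x₁ =>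
      obtain ⟨rfl, hx'⟩ := List.cons.inj hx
      exact key f x₁ x₂ F es k hx' hf hw hF hFo hes hp hpo hk v hv
    | nil =>
      cases f with
      | false => rw [hf rfl] at hx; simp at hx
      | true =>
        rw [List.nil_append] at hx
        subst hx
        obtain ⟨o', ho', hg⟩ := key true [] x F es k rfl (by simp) (.inr (.inl ⟨b, rfl⟩)) hF hFo
          hes hp hpo hk v hv
        exact ⟨o', ho', .move (bound hw hF hes hp hk) (.read r s b F k) hg⟩
  | @touch r t r' s x o o' b w hr hb ht hr' ih₁ ih₂ =>
    have key : ∀ (f : Bool) (x₁ x₂ F es : List A) (k : List (Item A Q)), x = x₁ ++ x₂ →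
        (f = false → x₂ = []) → P.ItemWord (b :: x₁) → Untwinned D F →
        (∀ a ∈ o' ++ o, ∀ e ∈ F, ¬ D.Dep a e) → es.length = k.length →
        es.Pairwise (fun a b => ¬ D.Dep a b) → (∀ a ∈ o' ++ o, ∀ e ∈ es, ¬ D.Dep a e) →
        (∀ i ∈ k, P.ItemWord i.2.1 ∧ i.2.2.2.length ≤ D.twinIndex) →
        ∀ v, P.Generates D S (false, k) [] v →
        ∃ z, D.revTrace z = D.revTrace (o' ++ o) ∧
          P.Generates D S (f, (r, b :: x₁, s, F) :: k) x₂ (z ++ v) := by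
      intro f x₁ x₂ F es k hx hf hw hF hFo hes hp hpo hk v hv
      obtain ⟨F', hE, hF', hFF⟩ := exists_extends hF b
      have hoF' : ∀ a ∈ o, ∀ e ∈ F', ¬ D.Dep a e := by
        intro a ha e he
        rcases hFF e he with rfl | he
        · exact fun hae => hb a ha (D.symm _ _ hae)
        · exact hFo a (List.mem_append_right _ ha) e he
      have hwt : P.ItemWord w.toList.reverse := .inr (.inr ⟨t, b, w, r', ht, List.suffix_rfl⟩)
      have hoo : ∀ e ∈ o', ∀ c ∈ o, ¬ D.Dep e c := fun e he c hc =>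
        Run.not_dep_of_trans h ht hr' (hb c hc) e he
      -- A pushed word without output could supply no witness and would raise the stack without
      -- control; it is resolved by `pop`. Otherwise any letter of `o'` is the witness of the new
      -- item.
      by_cases hn : o' = []
      · subst hn
        obtain ⟨z, hz, hg⟩ := ih₁ f x₁ x₂ F' es k hx hf hw.tail hF' hoF' hes hp hpo hk v hv
        exact ⟨z, hz, .move (bound hw hF hes hp hk) (.pop f r t r' s b w x₁ F F' k ht hr' hE) hg⟩
      · obtain ⟨e, he⟩ := List.exists_mem_of_ne_nil _ hn
        obtain ⟨y, hy, hgy⟩ := ih₂ false w.toList.reverse [] F es k (by simp) (by simp) hwt hF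
          (fun a ha => hFo a (List.mem_append_left _ ha)) hes hp
          (fun a ha => hpo a (List.mem_append_left _ ha)) hk v hv
        obtain ⟨z, hz, hg⟩ := ih₁ f x₁ x₂ F' (e :: es) ((r', w.toList.reverse, s, F) :: k) hx hf
          hw.tail hF' hoF' (by simp [hes])
          (List.pairwise_cons.2 ⟨fun c hc => hpo e (List.mem_append_left _ he) c hc, hp⟩)
          (by
            intro a ha c hc
            rcases List.mem_cons.1 hc with rfl | hc
            · exact fun hac => hoo c he a ha (D.symm _ _ hac)
            · exact hpo a (List.mem_append_right _ ha) c hc)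
          (by
            intro i hi
            rcases List.mem_cons.1 hi with rfl | hi
            · exact ⟨hwt, D.length_le_twinIndex hF⟩
            · exact hk i hi) _ hgy
        refine ⟨z ++ y, ?_, ?_⟩
        · rw [D.revTrace_append, D.revTrace_append, hy, hz, D.commute_revTrace hoo]
        · rw [List.append_assoc]
          exact .move (bound hw hF hes hp hk) (.touch f r t r' s b w x₁ F F' k ht hE) hg
    intro f x₁ x₂ F es k hx hf hw hF hFo hes hp hpo hk v hv
    cases x₁ with
    | cons c x₁ =>
      obtain ⟨rfl, hx'⟩ := List.cons.inj hx
      exact key f x₁ x₂ F es k hx' hf hw hF hFo hes hp hpo hk v hv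
    | nil =>
      cases f with
      | false => rw [hf rfl] at hx; simp at hx
      | true =>
        rw [List.nil_append] at hx
        subst hx
        obtain ⟨z, hz, hg⟩ := key true [] x F es k rfl (by simp) (.inr (.inl ⟨b, rfl⟩)) hF hFo
          hes hp hpo hk v hv
        exact ⟨z, hz, .move (bound hw hF hes hp hk) (.read r s b F k) hg⟩

/-! ### The transducer for the reachability relation -/

theorem reach_of_mem_accepted (h : P.IsTPDS D) {κ : Type*} {π : κ → MachineState A Q} {p q : Q}
    {u v : FreeMonoid A} (huv : (u, v) ∈ (P.machineTransducer D π p q).accepted) :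
    (D.trace u, D.trace v) ∈ P.Reach D p q := by
  have hg := (mem_accepted_iff (P := P) (D := D) (π := π) (p := p) (q := q)
    u.toList.reverse v.toList.reverse).1 (by simpa using huv)
  obtain ⟨z, v', -, hz, -, ⟨-, -, rfl⟩, hv⟩ := hg.denotes h
  rw [D.revTrace_nil, one_mul] at hv
  have := (reach_iff_run h p q u.toList.reverse (D.trace v)).2 ⟨z, hz, by
    rw [← hv]; simp [DepAlphabet.revTrace]⟩
  simpa [DepAlphabet.revTrace] using this

theorem exists_mem_accepted [Finite A] (h : P.IsTPDS D) {κ : Type*} {π : κ → MachineState A Q}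
    (hπ : P.boundedStates D ⊆ Set.range π) {p q : Q} {u : FreeMonoid A} {y : D.Trace}
    (huy : (D.trace u, y) ∈ P.Reach D p q) :
    ∃ v, (u, v) ∈ (P.machineTransducer D π p q).accepted ∧ D.trace v = y := by
  obtain ⟨o, ho, hoy⟩ := (reach_iff_run h p q u.toList.reverse y).1 (by
    simpa [DepAlphabet.revTrace] using huy)
  obtain ⟨o', ho', hg⟩ := ho.generates h hπ true [] u.toList.reverse [] [] [] rfl (by simp)
    (.inl rfl) List.Pairwise.nil (by simp) rfl List.Pairwise.nil (by simp) (by simp) []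
    (.empty (hπ ⟨by simp, by simp⟩))
  refine ⟨FreeMonoid.ofList o'.reverse, ?_, ?_⟩
  · simpa using (mem_accepted_iff _ _).2 hg
  · rw [← hoy, ← ho']; simp [DepAlphabet.revTrace]

/-- Acceptance is sound for reachability of traces and complete for every representing input word.
Replacing the input by an equivalent word therefore changes the output only within its class. -/
theorem leftClosed_accepted [Finite A] (h : P.IsTPDS D) {κ : Type*} {π : κ → MachineState A Q}
    (hπ : P.boundedStates D ⊆ Set.range π) (p q : Q) :
    LeftClosed D (P.machineTransducer D π p q).accepted := by
  intro u u' v' hu huv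
  have hr := reach_of_mem_accepted h huv
  rw [← (D.trace_eq_iff _ _).2 hu] at hr
  obtain ⟨v, hv, hvv⟩ := exists_mem_accepted h hπ hr
  exact ⟨v, hv, (D.trace_eq_iff _ _).1 hvv⟩

theorem traceRel_accepted [Finite A] (h : P.IsTPDS D) {κ : Type*} {π : κ → MachineState A Q}
    (hπ : P.boundedStates D ⊆ Set.range π) (p q : Q) :
    traceRel D (P.machineTransducer D π p q).accepted = P.Reach D p q := by
  ext ⟨x, y⟩
  constructor
  · rintro ⟨u, v, huv, he⟩
    rw [he]
    exact reach_of_mem_accepted h huv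
  · intro hxy
    obtain ⟨u, rfl⟩ := Con.mk'_surjective x
    obtain ⟨v, hv, rfl⟩ := exists_mem_accepted h hπ (u := u) hxy
    exact ⟨u, v, hv, rfl⟩

theorem finite_boundedStates [Finite A] [Finite Q] (P : PushdownSystem A Q) (D : DepAlphabet A) :
    (P.boundedStates D).Finite := by
  have hw : {x | P.ItemWord x}.Finite := by
    have h₁ : {x : List A | ∃ c, x = [c]}.Finite :=
      (Set.finite_range fun c : A => [c]).subset (by rintro x ⟨c, rfl⟩; exact ⟨c, rfl⟩)
    have h₂ : {x : List A | ∃ t b v r', (t, b, v, r') ∈ P.trans ∧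
        x <:+ v.toList.reverse}.Finite := by
      refine (P.trans.finite_toSet.biUnion (t := fun t => {x | x <:+ t.2.2.1.toList.reverse})
        fun t _ => ?_).subset ?_
      · exact (List.finite_toSet t.2.2.1.toList.reverse.tails).subset
          fun x hx => (List.mem_tails _ _).2 hx
      · rintro x ⟨t, b, v, r', ht, hx⟩
        exact Set.mem_biUnion ht hx
    exact ((Set.finite_singleton []).union (h₁.union h₂)).subset fun x hx => hx
  have hi : {i : Item A Q | P.ItemWord i.2.1 ∧ i.2.2.2.length ≤ D.twinIndex}.Finite :=
    (Set.finite_univ.prod (hw.prod (Set.finite_univ.prod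
      (List.finite_length_le A D.twinIndex)))).subset
      fun i hi => ⟨trivial, hi.1, trivial, hi.2⟩
  have hl : {k : List (Item A Q) | k.length ≤ D.twinIndex + 1 ∧
      ∀ i ∈ k, P.ItemWord i.2.1 ∧ i.2.2.2.length ≤ D.twinIndex}.Finite := by
    have := hi.to_subtype
    refine ((List.finite_length_le {i : Item A Q | P.ItemWord i.2.1 ∧
      i.2.2.2.length ≤ D.twinIndex} (D.twinIndex + 1)).image
      (List.map Subtype.val)).subset ?_
    rintro k ⟨hk, hk'⟩
    refine ⟨k.attachWith _ hk', ?_, ?_⟩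
    · rw [Set.mem_ofPred_eq, List.length_attachWith]; exact hk
    · exact List.attachWith_map_subtype_val hk'
  exact (Set.finite_univ.prod hl).subset fun σ hσ => ⟨trivial, hσ⟩

end PushdownSystem

/-! ### Finite transducers accept rational relations -/

theorem IsRational.biUnion {M ι : Type*} [Monoid M] {s : Set ι} (hs : s.Finite) {f : ι → Set M}
    (h : ∀ i ∈ s, IsRational (f i)) : IsRational (⋃ i ∈ s, f i) := by
  induction s, hs using Set.Finite.induction_on with
  | empty => simpa using IsRational.finite (∅ : Set M) Set.finite_empty
  | insert _ _ ih =>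
    rw [Set.biUnion_insert]
    exact .union _ _ (h _ (Set.mem_insert _ _)) (ih fun i hi => h i (Set.mem_insert_of_mem _ hi))

namespace Transducer

variable {A S : Type*} (T : Transducer A S)

/-- Paths all of whose interior states belong to `X`. -/
inductive Via (X : Set S) : S → FreeMonoid A × FreeMonoid A → S → Prop
  | refl (i : S) : Via X i 1 i
  | edge {i j : S} {x : FreeMonoid A × FreeMonoid A} : (i, x, j) ∈ T.trans → Via X i x j
  | step {i j k : S} {x y : FreeMonoid A × FreeMonoid A} :
      (i, x, k) ∈ T.trans → k ∈ X → Via X k y j → Via X i (x * y) j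

variable {T}

theorem Via.mono {X Y : Set S} (h : X ⊆ Y) {i j : S} {x : FreeMonoid A × FreeMonoid A}
    (hx : T.Via X i x j) : T.Via Y i x j := by
  induction hx with
  | refl i => exact .refl i
  | edge ht => exact .edge ht
  | step ht hk _ ih => exact .step ht (h hk) ih

theorem Via.append {X : Set S} {i j k : S} {x y : FreeMonoid A × FreeMonoid A}
    (hx : T.Via X i x k) (hk : k ∈ X) (hy : T.Via X k y j) : T.Via X i (x * y) j := by
  induction hx with
  | refl i => simpa using hy
  | edge ht => exact .step ht hk hy
  | step ht hl _ ih => rw [mul_assoc]; exact .step ht hl (ih hk hy)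

theorem via_univ_iff {i j : S} {x : FreeMonoid A × FreeMonoid A} :
    T.Via Set.univ i x j ↔ T.Path i x j := by
  constructor
  · intro h
    induction h with
    | refl i => exact .refl i
    | edge ht => simpa using Path.step _ _ _ _ _ ht (.refl _)
    | step ht _ _ ih => exact .step _ _ _ _ _ ht ih
  · intro h
    induction h with
    | refl i => exact .refl i
    | step i k j x y ht _ ih => exact .step ht trivial ih

/-- Kleene's decomposition: a path is cut at all its visits to `k`, which yields a first part, a
sequence of loops at `k` and a last part, all of them avoiding `k` inside. -/
theorem setOf_via_insert (k : S) (X : Set S) (i j : S) :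
    {x | T.Via (insert k X) i x j} = {x | T.Via X i x j} ∪ {x | T.Via X i x k} *
      ((Submonoid.closure {x | T.Via X k x k} : Set (FreeMonoid A × FreeMonoid A)) *
        {x | T.Via X k x j}) := by
  ext x
  constructor
  · intro h
    replace h : T.Via (insert k X) i x j := h
    induction h with
    | refl i => exact .inl (.refl i)
    | edge ht => exact .inl (.edge ht)
    | @step i j l x y ht hl _ ih =>
      rcases hl with rfl | hl
      · right
        rcases ih with hy | ⟨a, ha, _, ⟨b, hb, c, hc, rfl⟩, rfl⟩
        · exact ⟨x, .edge ht, y, ⟨1, Submonoid.one_mem _, y, hy, by simp⟩, rfl⟩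
        · exact ⟨x, .edge ht, _, ⟨a * b, Submonoid.mul_mem _ (Submonoid.subset_closure ha) hb, c,
            hc, rfl⟩, by simp [mul_assoc]⟩
      · rcases ih with hy | ⟨a, ha, _, ⟨b, hb, c, hc, rfl⟩, rfl⟩
        · exact .inl (Via.step ht hl hy)
        · exact .inr ⟨x * a, Via.step ht hl ha, _, ⟨b, hb, c, hc, rfl⟩, by simp [mul_assoc]⟩
  · have hX : X ⊆ insert k X := Set.subset_insert _ _
    have hk : k ∈ insert k X := Set.mem_insert _ _
    rintro (h | ⟨a, ha, _, ⟨b, hb, c, hc, rfl⟩, rfl⟩)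
    · exact Via.mono hX h
    · refine (Via.mono hX ha).append hk (Via.append ?_ hk (Via.mono hX hc))
      replace hb : b ∈ Submonoid.closure {x | T.Via X k x k} := hb
      induction hb using Submonoid.closure_induction with
      | mem x hx => exact Via.mono hX hx
      | one => exact .refl k
      | mul x y _ _ hx hy => exact hx.append hk hy

theorem isRational_via (hT : T.trans.Finite) {X : Set S} (hX : X.Finite) (i j : S) :
    IsRational {x | T.Via X i x j} := by
  induction X, hX using Set.Finite.induction_on generalizing i j with
  | empty =>
    refine .finite _ (((Set.finite_singleton 1).union (hT.image fun t => t.2.1)).subset ?_)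
    intro x hx
    replace hx : T.Via ∅ i x j := hx
    cases hx with
    | refl => exact .inl rfl
    | edge ht => exact .inr ⟨_, ht, rfl⟩
    | step _ hk => exact absurd hk (Set.notMem_empty _)
  | insert _ _ ih =>
    rw [setOf_via_insert]
    exact .union _ _ (ih i j) (.mul _ _ (ih _ _) (.mul _ _ (.star _ (ih _ _)) (ih _ _)))

theorem finite_trans [Finite A] [Finite S] (T : Transducer A S) : T.trans.Finite := by
  have hA : {w : FreeMonoid A | w.length ≤ 1}.Finite := List.finite_length_le A 1
  refine (Set.finite_univ.prod ((hA.prod hA).prod Set.finite_univ)).subset ?_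
  rintro ⟨i, ⟨u, v⟩, j⟩ h
  have := T.label_le i u v j h
  rw [FreeMonoid.length_mul] at this
  refine ⟨trivial, ⟨?_, ?_⟩, trivial⟩
  · show u.length ≤ 1
    omega
  · show v.length ≤ 1
    omega

theorem isRational_accepted [Finite A] [Finite S] (T : Transducer A S) :
    IsRational T.accepted := by
  have : T.accepted = ⋃ i ∈ T.init, ⋃ j ∈ T.final, {x | T.Via Set.univ i x j} := by
    ext x
    simp [accepted, via_univ_iff]
  rw [this]
  exact .biUnion (Set.toFinite _) fun i _ => .biUnion (Set.toFinite _) fun j _ =>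
    isRational_via T.finite_trans Set.finite_univ i j

end Transducer

/-! ### Reachability is lc-rational, and the classical case. -/

namespace PushdownSystem

theorem lcRational_reach {A Q : Type*} [Finite A] [Finite Q] {D : DepAlphabet A}
    {P : PushdownSystem A Q} (h : P.IsTPDS D) (p q : Q) : LCRational D (P.Reach D p q) := by
  have := (finite_boundedStates P D).to_subtype
  have hπ : P.boundedStates D ⊆ Set.range (Subtype.val : P.boundedStates D → _) := by simp
  exact ⟨_, Transducer.isRational_accepted _, leftClosed_accepted h hπ p q,
    (traceRel_accepted h hπ p q).symm⟩

/-! ### The case that all letters are dependent -/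

theorem isTPDS_full {A Q : Type*} (P : PushdownSystem A Q) : P.IsTPDS (DepAlphabet.full A) where
  dep_subset _ _ _ _ _ := fun _ _ => trivial
  diamond _ a _ _ b _ _ _ _ h := absurd trivial (h a (by simp) b (by simp))

/-- There are no independent pairs, hence no generators, and the generated congruence is equality.
-/
theorem trace_full_injective (A : Type*) : Function.Injective (DepAlphabet.full A).trace := by
  intro u v h
  have h' : (DepAlphabet.full A).traceCon u v := (DepAlphabet.trace_eq_iff _ _ _).1 h
  have hle : (DepAlphabet.full A).traceCon ≤ ⊥ := by
    refine Con.conGen_le.2 ?_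
    rintro _ _ ⟨a, b, hab, -, -⟩
    exact absurd trivial hab
  exact hle h'

theorem step_full_iff {A Q : Type*} (P : PushdownSystem A Q) (c d : Q × FreeMonoid A) :
    P.Step (DepAlphabet.full A) (c.1, (DepAlphabet.full A).trace c.2)
      (d.1, (DepAlphabet.full A).trace d.2) ↔ P.WordStep c d := by
  simp only [Step, WordStep, (trace_full_injective A).eq_iff]

theorem reach_full_iff {A Q : Type*} (P : PushdownSystem A Q) (p q : Q) (u v : FreeMonoid A) :
    ((DepAlphabet.full A).trace u, (DepAlphabet.full A).trace v) ∈
        P.Reach (DepAlphabet.full A) p q ↔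
      Relation.ReflTransGen P.WordStep (p, u) (q, v) := by
  let f : Q × FreeMonoid A → Q × (DepAlphabet.full A).Trace :=
    fun c => (c.1, (DepAlphabet.full A).trace c.2)
  constructor
  · intro h
    have key : ∀ e, Relation.ReflTransGen (P.Step (DepAlphabet.full A)) (f (p, u)) e →
        ∀ d, f d = e → Relation.ReflTransGen P.WordStep (p, u) d := by
      intro e he
      induction he with
      | refl =>
        rintro ⟨r, w⟩ hd
        obtain ⟨h₁, h₂⟩ := Prod.mk.inj hd
        have h₁ : r = p := h₁
        have h₂ : w = u := trace_full_injective A h₂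
        rw [h₁, h₂]
      | @tail b c _ hs ih =>
        intro d hd
        obtain ⟨w, hw⟩ := Con.mk'_surjective b.2
        have hb : f (b.1, w) = b := Prod.ext rfl hw
        refine (ih _ hb).tail ((step_full_iff P _ _).1 ?_)
        rw [← hb, ← hd] at hs
        exact hs
    exact key _ h (q, v) rfl
  · intro h
    exact Relation.ReflTransGen.lift f (fun c d hs => (step_full_iff P c d).2 hs) _ _ h

theorem isRational_wordReach {A Q : Type*} [Finite A] [Finite Q] (P : PushdownSystem A Q)
    (p q : Q) : IsRational {x : FreeMonoid A × FreeMonoid A |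
      Relation.ReflTransGen P.WordStep (p, x.1) (q, x.2)} := by
  obtain ⟨R, hR, -, he⟩ := lcRational_reach (isTPDS_full P) p q
  convert hR using 1
  ext ⟨u, v⟩
  show Relation.ReflTransGen P.WordStep (p, u) (q, v) ↔ _
  rw [← reach_full_iff, he]
  constructor
  · rintro ⟨u', v', h, e⟩
    obtain ⟨e₁, e₂⟩ := Prod.mk.inj e
    rwa [trace_full_injective A e₁, trace_full_injective A e₂]
  · exact fun h => ⟨u, v, h, rfl⟩

end PushdownSystem

/-! ### Bounds on running times -/

theorem BTree.size_pos (x : BTree) : 0 < x.size := by cases x <;> simp [BTree.size]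

theorem BTree.size_left_le (x : BTree) : x.left.size ≤ x.size := by
  cases x <;> simp [BTree.size, BTree.left]; omega

theorem BTree.size_right_le (x : BTree) : x.right.size ≤ x.size := by
  cases x <;> simp [BTree.size, BTree.right]; omega

/-- Every instruction is charged the size of its argument, so a bound on the time is also a bound on
the size of the result. Most later size bounds come for free from this. -/
theorem Runs.size_le {c : Prog} {x y : BTree} {t : ℕ} (h : Runs c x y t) :
    x.size ≤ t ∧ y.size ≤ t := by
  induction h with
  | id => simp
  | nil x => exact ⟨le_rfl, x.size_pos⟩
  | left x => exact ⟨le_rfl, x.size_left_le⟩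
  | right x => exact ⟨le_rfl, x.size_right_le⟩
  | pair c d x y z s t _ _ ih₁ ih₂ =>
    have := x.size_pos
    simp only [BTree.size]
    omega
  | _ => omega

theorem Polynomial.eval_nat_mono (p : Polynomial ℕ) : Monotone fun n => p.eval n := by
  intro a b hab
  simp only [Polynomial.eval_eq_sum, Polynomial.sum]
  exact Finset.sum_le_sum fun i _ => Nat.mul_le_mul_left _ (Nat.pow_le_pow_left hab i)

/-- Chains of iterations of a loop. -/
theorem Runs.loop_chain {b c : Prog} {N B : ℕ} (s : ℕ → BTree)
    (hb : ∀ j < N, ∃ l r t, Runs b (s j) (BTree.node l r) t ∧ t ≤ B)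
    (hc : ∀ j < N, ∃ t, Runs c (s j) (s (j + 1)) t ∧ t ≤ B)
    (hN : ∃ t, Runs b (s N) BTree.nil t ∧ t ≤ B) :
    ∃ t, Runs (Prog.loop b c) (s 0) (s N) t ∧ t ≤ (N + 1) * (3 * B) := by
  induction N generalizing s with
  | zero =>
    obtain ⟨t, ht, htB⟩ := hN
    refine ⟨_, Runs.loop_nil _ _ _ _ ht, ?_⟩
    have := ht.size_le
    omega
  | succ N ih =>
    obtain ⟨t, ht, htB⟩ := ih (fun j => s (j + 1)) (fun j hj => hb (j + 1) (by omega))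
      (fun j hj => hc (j + 1) (by omega)) hN
    obtain ⟨l, r, t₁, h₁, h₁B⟩ := hb 0 (by omega)
    obtain ⟨t₂, h₂, h₂B⟩ := hc 0 (by omega)
    refine ⟨_, Runs.loop_node _ _ _ _ _ _ _ _ _ _ h₁ h₂ ht, ?_⟩
    -- The charge for the loop instruction itself is covered by the time of its test, so a round
    -- costs at most three times `B`: charge, test and body.
    have := h₁.size_le
    have e : (N + 1 + 1) * (3 * B) = (N + 1) * (3 * B) + 3 * B := by ring
    omega

/-! ### Sizes of encodings and polynomial bounds. -/

/-- The size of the encoding. -/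
def encSize {α : Type} [TreeEncoding α] (x : α) : ℕ := (TreeEncoding.enc x).size

theorem encSize_pos {α : Type} [TreeEncoding α] (x : α) : 0 < encSize x := BTree.size_pos _

instance instTreeEncodingBTree : TreeEncoding BTree := ⟨fun x => x⟩

instance instTreeEncodingBool : TreeEncoding Bool :=
  ⟨fun b => if b then BTree.node BTree.nil BTree.nil else BTree.nil⟩

instance instTreeEncodingUnit : TreeEncoding Unit := ⟨fun _ => BTree.nil⟩

section PolyLE

variable {ι : Type} {X : ι → Type}

/-- `V` is bounded by a polynomial in `W`. -/
def PolyLE (V W : ∀ i, X i → ℕ) : Prop := ∃ b : Polynomial ℕ, ∀ i x, V i x ≤ b.eval (W i x)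

variable {V V' W : ∀ i, X i → ℕ}

theorem PolyLE.of_le (h : ∀ i x, V i x ≤ W i x) : PolyLE V W :=
  ⟨Polynomial.X, by simpa using h⟩

theorem PolyLE.const (c : ℕ) : PolyLE (fun _ _ => c) W :=
  ⟨Polynomial.C c, by simp⟩

theorem PolyLE.add (h : PolyLE V W) (h' : PolyLE V' W) :
    PolyLE (fun i x => V i x + V' i x) W := by
  obtain ⟨b, hb⟩ := h
  obtain ⟨b', hb'⟩ := h'
  exact ⟨b + b', fun i x => by rw [Polynomial.eval_add]; exact Nat.add_le_add (hb i x) (hb' i x)⟩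

theorem PolyLE.mul (h : PolyLE V W) (h' : PolyLE V' W) :
    PolyLE (fun i x => V i x * V' i x) W := by
  obtain ⟨b, hb⟩ := h
  obtain ⟨b', hb'⟩ := h'
  exact ⟨b * b', fun i x => by rw [Polynomial.eval_mul]; exact Nat.mul_le_mul (hb i x) (hb' i x)⟩

theorem PolyLE.eval (h : PolyLE V W) (p : Polynomial ℕ) :
    PolyLE (fun i x => p.eval (V i x)) W := by
  obtain ⟨b, hb⟩ := h
  exact ⟨p.comp b, fun i x => by rw [Polynomial.eval_comp]; exact p.eval_nat_mono (hb i x)⟩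

theorem PolyLE.mono (h : PolyLE V W) (h' : ∀ i x, V' i x ≤ V i x) : PolyLE V' W := by
  obtain ⟨b, hb⟩ := h
  exact ⟨b, fun i x => (h' i x).trans (hb i x)⟩

end PolyLE

/-! ### Functions computed in polynomial time -/

section PolyTime

variable {ι : Type} {X Y Z : ι → Type} [∀ i, TreeEncoding (X i)] [∀ i, TreeEncoding (Y i)]
  [∀ i, TreeEncoding (Z i)]

/-- A family of functions is computed by one program in time polynomial in the weight `W`. -/
def PolyTimeIn (W : ∀ i, X i → ℕ) (f : ∀ i, X i → Y i) : Prop :=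
  ∃ (c : Prog) (V : ∀ i, X i → ℕ), PolyLE V W ∧ ∀ i x, ∃ t,
    Runs c (TreeEncoding.enc x) (TreeEncoding.enc (f i x)) t ∧ t ≤ V i x

/-- A family of functions is computed by one program in time polynomial in the size of the input. -/
abbrev PolyTime (f : ∀ i, X i → Y i) : Prop := PolyTimeIn (fun _ x => encSize x) f

variable {W : ∀ i, X i → ℕ} {f : ∀ i, X i → Y i} {g : ∀ i, X i → Z i}

theorem PolyTime.exists_polynomial (hf : PolyTime f) : ∃ (c : Prog) (p : Polynomial ℕ), ∀ i x, ∃ t,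
    Runs c (TreeEncoding.enc x) (TreeEncoding.enc (f i x)) t ∧ t ≤ p.eval (encSize x) := by
  obtain ⟨c, V, ⟨p, hp⟩, h⟩ := hf
  refine ⟨c, p, fun i x => ?_⟩
  obtain ⟨t, ht, htV⟩ := h i x
  exact ⟨t, ht, htV.trans (hp i x)⟩

namespace PolyTimeIn

theorem encSize_arg (hf : PolyTimeIn W f) : PolyLE (fun _ x => encSize x) W := by
  obtain ⟨c, V, hV, h⟩ := hf
  refine hV.mono fun i x => ?_
  obtain ⟨t, ht, htV⟩ := h i x
  exact ht.size_le.1.trans htV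

theorem encSize_val (hf : PolyTimeIn W f) : PolyLE (fun i x => encSize (f i x)) W := by
  obtain ⟨c, V, hV, h⟩ := hf
  refine hV.mono fun i x => ?_
  obtain ⟨t, ht, htV⟩ := h i x
  exact ht.size_le.2.trans htV

/-- Programs see only encodings, so passing between types with the same encoding costs nothing: a
nonempty list is a pair, a word is a list, and an element of `Fin n` is a number. -/
theorem congr_enc {g : ∀ i, X i → Z i} (hf : PolyTimeIn W f)
    (h : ∀ i x, TreeEncoding.enc (f i x) = TreeEncoding.enc (g i x)) : PolyTimeIn W g := by
  obtain ⟨c, V, hV, hc⟩ := hf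
  exact ⟨c, V, hV, fun i x => h i x ▸ hc i x⟩

theorem congr {f' : ∀ i, X i → Y i} (hf : PolyTimeIn W f) (h : ∀ i x, f i x = f' i x) :
    PolyTimeIn W f' :=
  hf.congr_enc fun i x => by rw [h]

/-- The outer function must be polynomial in the size of its own argument, which is at most the time
spent on computing that argument. -/
theorem comp {h : ∀ i, Y i → Z i} (hh : PolyTime h) (hf : PolyTimeIn W f) :
    PolyTimeIn W (fun i x => h i (f i x)) := by
  have hs := hf.encSize_arg
  have hs' := hf.encSize_val
  obtain ⟨c, V, hV, hc⟩ := hf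
  obtain ⟨d, p, hd⟩ := hh.exists_polynomial
  refine ⟨.seq c d, _, (hs.add hV).add (hs'.eval p), fun i x => ?_⟩
  obtain ⟨t, ht, htV⟩ := hc i x
  obtain ⟨s, hs, hsV⟩ := hd i (f i x)
  refine ⟨_, Runs.seq _ _ _ _ _ _ _ ht hs, ?_⟩
  exact Nat.add_le_add (Nat.add_le_add le_rfl htV) hsV

theorem id_of_le (h : PolyLE (fun _ x => encSize x) W) : PolyTimeIn W (fun _ x => x) :=
  ⟨.id, _, h, fun _ _ => ⟨_, Runs.id _, le_rfl⟩⟩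

theorem of_polyTime (hf : PolyTime f) (h : PolyLE (fun _ x => encSize x) W) : PolyTimeIn W f :=
  comp hf (id_of_le h)

theorem prodMk (hf : PolyTimeIn W f) (hg : PolyTimeIn W g) :
    PolyTimeIn W (fun i x => (f i x, g i x)) := by
  have hs := hf.encSize_arg
  obtain ⟨c, V, hV, hc⟩ := hf
  obtain ⟨d, V', hV', hd⟩ := hg
  refine ⟨.pair c d, _, (hs.add hV).add hV', fun i x => ?_⟩
  obtain ⟨t, ht, htV⟩ := hc i x
  obtain ⟨s, hs, hsV⟩ := hd i x
  exact ⟨_, Runs.pair _ _ _ _ _ _ _ ht hs, Nat.add_le_add (Nat.add_le_add le_rfl htV) hsV⟩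

theorem ite {b : ∀ i, X i → Bool} {f g : ∀ i, X i → Y i} (hb : PolyTimeIn W b)
    (hf : PolyTimeIn W f) (hg : PolyTimeIn W g) :
    PolyTimeIn W (fun i x => if b i x = true then f i x else g i x) := by
  have hs := hf.encSize_arg
  obtain ⟨e, V'', hV'', he⟩ := hb
  obtain ⟨c, V, hV, hc⟩ := hf
  obtain ⟨d, V', hV', hd⟩ := hg
  refine ⟨.cond e c d, _, (hs.add hV'').add (hV.add hV'), fun i x => ?_⟩
  obtain ⟨r, hr, hrV⟩ := he i x
  cases hb : b i x with
  | true =>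
    obtain ⟨t, ht, htV⟩ := hc i x
    rw [hb] at hr
    simp only [hb, if_true]
    exact ⟨_, Runs.cond_node _ _ _ _ _ _ _ _ _ hr ht, by simp only [encSize]; omega⟩
  | false =>
    obtain ⟨t, ht, htV⟩ := hd i x
    rw [hb] at hr
    simp only [hb, Bool.false_eq_true, if_false]
    exact ⟨_, Runs.cond_nil _ _ _ _ _ _ _ hr ht, by simp only [encSize]; omega⟩

end PolyTimeIn

namespace PolyTime

theorem id : PolyTime (fun (i : ι) (x : X i) => x) := .id_of_le (.of_le fun _ _ => le_rfl)

theorem prod_fst : PolyTime (fun (i : ι) (x : X i × Y i) => x.1) :=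
  ⟨.left, _, .of_le fun _ _ => le_rfl, fun _ _ => ⟨_, Runs.left _, le_rfl⟩⟩

theorem prod_snd : PolyTime (fun (i : ι) (x : X i × Y i) => x.2) :=
  ⟨.right, _, .of_le fun _ _ => le_rfl, fun _ _ => ⟨_, Runs.right _, le_rfl⟩⟩

theorem tree_left : PolyTime (fun (_ : ι) (x : BTree) => x.left) :=
  ⟨.left, _, .of_le fun _ _ => le_rfl, fun _ _ => ⟨_, Runs.left _, le_rfl⟩⟩

theorem tree_right : PolyTime (fun (_ : ι) (x : BTree) => x.right) :=
  ⟨.right, _, .of_le fun _ _ => le_rfl, fun _ _ => ⟨_, Runs.right _, le_rfl⟩⟩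

theorem encode : PolyTime (fun (i : ι) (x : X i) => (TreeEncoding.enc x : BTree)) :=
  id.congr_enc fun _ _ => rfl

theorem tree_nil : PolyTime (fun (i : ι) (_ : X i) => BTree.nil) :=
  ⟨.nil, _, .of_le fun _ _ => le_rfl, fun _ _ => ⟨_, Runs.nil _, le_rfl⟩⟩

theorem of_enc_nil {y : ∀ i, X i → Y i} (h : ∀ i x, TreeEncoding.enc (y i x) = BTree.nil) :
    PolyTime y :=
  tree_nil.congr_enc fun i x => (h i x).symm

theorem tree_node : PolyTime (fun (_ : ι) (x : BTree × BTree) => BTree.node x.1 x.2) :=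
  id.congr_enc fun _ _ => rfl

theorem bool_true : PolyTime (fun (i : ι) (_ : X i) => true) :=
  (tree_nil.prodMk tree_nil).congr_enc fun _ _ => rfl

theorem bool_false : PolyTime (fun (i : ι) (_ : X i) => false) := of_enc_nil fun _ _ => rfl

end PolyTime

/-- Whether a tree is not the leaf. -/
def BTree.isNode : BTree → Bool
  | BTree.nil => false
  | BTree.node _ _ => true

theorem PolyTime.tree_isNode : PolyTime (fun (_ : ι) (x : BTree) => x.isNode) := by
  obtain ⟨c, p, hc⟩ := (PolyTime.bool_true (ι := ι) (X := fun _ => BTree)).exists_polynomial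
  obtain ⟨d, q, hd⟩ := (PolyTime.bool_false (ι := ι) (X := fun _ => BTree)).exists_polynomial
  have h0 : PolyLE (fun (_ : ι) (x : BTree) => encSize x) (fun _ x => encSize x) :=
    .of_le fun _ _ => le_rfl
  refine ⟨.cond .id c d, _, (h0.add h0).add ((h0.eval p).add (h0.eval q)), fun i x => ?_⟩
  obtain ⟨t, ht, htV⟩ := hc i x
  obtain ⟨s, hs, hsV⟩ := hd i x
  cases x with
  | nil => exact ⟨_, Runs.cond_nil _ _ _ _ _ _ _ (Runs.id _) hs, by simp only [encSize] at *; omega⟩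
  | node l r =>
    exact ⟨_, Runs.cond_node _ _ _ _ _ _ _ _ _ (Runs.id _) ht, by simp only [encSize] at *; omega⟩

namespace PolyTimeIn

theorem const_of_enc_nil {y : ∀ i, X i → Y i} (h : PolyLE (fun _ x => encSize x) W)
    (hy : ∀ i x, TreeEncoding.enc (y i x) = BTree.nil) : PolyTimeIn W y :=
  of_polyTime (.of_enc_nil hy) h

theorem fst {f : ∀ i, X i → Y i × Z i} (hf : PolyTimeIn W f) :
    PolyTimeIn W (fun i x => (f i x).1) := comp PolyTime.prod_fst hf

theorem snd {f : ∀ i, X i → Y i × Z i} (hf : PolyTimeIn W f) :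
    PolyTimeIn W (fun i x => (f i x).2) := comp PolyTime.prod_snd hf

theorem and {b c : ∀ i, X i → Bool} (hb : PolyTimeIn W b) (hc : PolyTimeIn W c) :
    PolyTimeIn W (fun i x => b i x && c i x) :=
  (hb.ite hc (of_polyTime PolyTime.bool_false hb.encSize_arg)).congr fun i x => by
    cases b i x <;> simp

theorem or {b c : ∀ i, X i → Bool} (hb : PolyTimeIn W b) (hc : PolyTimeIn W c) :
    PolyTimeIn W (fun i x => b i x || c i x) :=
  (hb.ite (of_polyTime PolyTime.bool_true hb.encSize_arg) hc).congr fun i x => by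
    cases b i x <;> simp

theorem not {b : ∀ i, X i → Bool} (hb : PolyTimeIn W b) : PolyTimeIn W (fun i x => !b i x) :=
  (hb.ite (of_polyTime PolyTime.bool_false hb.encSize_arg)
    (of_polyTime PolyTime.bool_true hb.encSize_arg)).congr fun i x => by cases b i x <;> simp

theorem left {f : ∀ i, X i → BTree} (hf : PolyTimeIn W f) :
    PolyTimeIn W (fun i x => (f i x).left) := comp (Z := fun _ => BTree) PolyTime.tree_left hf

theorem right {f : ∀ i, X i → BTree} (hf : PolyTimeIn W f) :
    PolyTimeIn W (fun i x => (f i x).right) := comp (Z := fun _ => BTree) PolyTime.tree_right hf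

theorem node {f g : ∀ i, X i → BTree} (hf : PolyTimeIn W f) (hg : PolyTimeIn W g) :
    PolyTimeIn W (fun i x => BTree.node (f i x) (g i x)) :=
  comp (Z := fun _ => BTree) PolyTime.tree_node (hf.prodMk hg)

theorem isNode {f : ∀ i, X i → BTree} (hf : PolyTimeIn W f) :
    PolyTimeIn W (fun i x => (f i x).isNode) := comp (Z := fun _ => Bool) PolyTime.tree_isNode hf

end PolyTimeIn

end PolyTime

/-! ### Equality of trees -/

namespace BTree

/-- One step of the comparison of two trees. The state is a stack of pairs of trees that are still
to be compared, together with a flag that is set when a difference has been found. -/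
def compareStep (s : BTree) : BTree :=
  if s.left.left.left.isNode = true then
    if s.left.left.right.isNode = true then
      node (node (node s.left.left.left.left s.left.left.right.left)
        (node (node s.left.left.left.right s.left.left.right.right) s.left.right)) nil
    else node nil (node nil nil)
  else
    if s.left.left.right.isNode = true then node nil (node nil nil)
    else node s.left.right nil

/-- The state of the comparison of `x` and `y`. -/
def compareState (x y k : BTree) : BTree := node (node (node x y) k) nil

end BTree

theorem polyTime_compareStep : PolyTime (fun (_ : Unit) (s : BTree) => s.compareStep) := by
  have h : PolyTime (fun (_ : Unit) (s : BTree) => s) := PolyTime.id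
  have hn : PolyTime (fun (_ : Unit) (_ : BTree) => BTree.nil) := PolyTime.tree_nil
  have hx := h.left.left.left
  have hy := h.left.left.right
  have hm := hn.node (hn.node hn)
  exact (hx.isNode).ite (hy.isNode.ite (((hx.left.node hy.left).node
    ((hx.right.node hy.right).node h.left.right)).node hn) hm)
    (hy.isNode.ite hm (h.left.right.node hn))

/-- Stated with a continuation: whatever time `T` the loop needs after `x` and `y` have been
compared, the comparison adds at most one round per node or leaf of `x`. Splitting two nodes
rearranges the state without enlarging it, so one bound `M` serves all rounds. A difference clears
the stack and thus ends the loop. -/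
theorem compare_chain {c : Prog} {p : Polynomial ℕ}
    (hc : ∀ s : BTree, ∃ t, Runs c s s.compareStep t ∧ t ≤ p.eval s.size) (M : ℕ)
    (x y k : BTree) (hM : (BTree.compareState x y k).size ≤ M) :
    (x = y → ∀ z T, Runs (.loop .left c) (BTree.node k BTree.nil) z T → ∃ t,
      Runs (.loop .left c) (BTree.compareState x y k) z t ∧
        t ≤ T + x.size * (2 * M + p.eval M)) ∧
    (x ≠ y → ∀ z T, Runs (.loop .left c) (BTree.node .nil (.node .nil .nil)) z T → ∃ t,
      Runs (.loop .left c) (BTree.compareState x y k) z t ∧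
        t ≤ T + x.size * (2 * M + p.eval M)) := by
  have step : ∀ (x y k s' : BTree), (BTree.compareState x y k).size ≤ M →
      (BTree.compareState x y k).compareStep = s' → ∀ z T, Runs (.loop .left c) s' z T →
      ∃ t, Runs (.loop .left c) (BTree.compareState x y k) z t ∧
        t ≤ T + (2 * M + p.eval M) := by
    intro x y k s' hM hs z T h
    obtain ⟨t, ht, htp⟩ := hc (BTree.compareState x y k)
    rw [hs] at ht
    refine ⟨_, Runs.loop_node _ _ _ _ _ _ _ _ _ _ (Runs.left _) ht h, ?_⟩
    have : t ≤ p.eval M := htp.trans (p.eval_nat_mono hM)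
    omega
  induction x generalizing y k with
  | nil =>
    cases y with
    | nil =>
      refine ⟨fun _ z T h => ?_, fun h => absurd rfl h⟩
      simpa [BTree.size] using step _ _ _ _ hM rfl z T h
    | node y₁ y₂ =>
      refine ⟨fun h => by simp at h, fun _ z T h => ?_⟩
      simpa [BTree.size] using step _ _ _ _ hM rfl z T h
  | node x₁ x₂ ih₁ ih₂ =>
    have hexp : (BTree.node x₁ x₂).size * (2 * M + p.eval M) = x₁.size * (2 * M + p.eval M) +
        x₂.size * (2 * M + p.eval M) + (2 * M + p.eval M) := by
      simp only [BTree.size]; ring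
    cases y with
    | nil =>
      refine ⟨fun h => by simp at h, fun _ z T h => ?_⟩
      obtain ⟨t, ht, htT⟩ := step _ _ _ _ hM rfl z T h
      exact ⟨t, ht, by omega⟩
    | node y₁ y₂ =>
      have hM₁ : (BTree.compareState x₁ y₁ (.node (.node x₂ y₂) k)).size ≤ M := by
        simp only [BTree.compareState, BTree.size] at hM ⊢
        omega
      have hM₂ : (BTree.compareState x₂ y₂ k).size ≤ M := by
        simp only [BTree.compareState, BTree.size] at hM ⊢
        omega
      constructor
      · intro he z T h
        obtain ⟨e₁, e₂⟩ := BTree.node.inj he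
        obtain ⟨t₂, h₂, ht₂⟩ := (ih₂ y₂ k hM₂).1 e₂ z T h
        obtain ⟨t₁, h₁, ht₁⟩ := (ih₁ y₁ _ hM₁).1 e₁ z t₂ h₂
        obtain ⟨t, ht, htT⟩ := step _ _ _ _ hM rfl z t₁ h₁
        exact ⟨t, ht, by omega⟩
      · intro he z T h
        by_cases e₁ : x₁ = y₁
        · have e₂ : x₂ ≠ y₂ := fun e₂ => he (by rw [e₁, e₂])
          obtain ⟨t₂, h₂, ht₂⟩ := (ih₂ y₂ k hM₂).2 e₂ z T h
          obtain ⟨t₁, h₁, ht₁⟩ := (ih₁ y₁ _ hM₁).1 e₁ z t₂ h₂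
          obtain ⟨t, ht, htT⟩ := step _ _ _ _ hM rfl z t₁ h₁
          exact ⟨t, ht, by omega⟩
        · obtain ⟨t₁, h₁, ht₁⟩ := (ih₁ y₁ _ hM₁).2 e₁ z T h
          obtain ⟨t, ht, htT⟩ := step _ _ _ _ hM rfl z t₁ h₁
          exact ⟨t, ht, by omega⟩

section PolyTime

variable {ι : Type} {X Y Z : ι → Type} [∀ i, TreeEncoding (X i)] [∀ i, TreeEncoding (Y i)]
  [∀ i, TreeEncoding (Z i)] {W : ∀ i, X i → ℕ}

open Classical in
theorem PolyTime.tree_eq :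
    PolyTime (fun (_ : ι) (x : BTree × BTree) => decide (x.1 = x.2)) := by
  obtain ⟨c, p, hc⟩ := polyTime_compareStep.exists_polynomial
  have hloop : PolyTime (fun (_ : ι) (x : BTree × BTree) =>
      if x.1 = x.2 then BTree.node .nil .nil else BTree.node .nil (.node .nil .nil)) := by
    let init : Prog := .pair (.pair .id .nil) .nil
    have h0 : PolyLE (fun (_ : ι) (x : BTree × BTree) => encSize x) (fun _ x => encSize x) :=
      .of_le fun _ _ => le_rfl
    -- The initial state wraps two nodes and two leaves around the given pair, which adds 4 to its
    -- size.
    have hM : PolyLE (fun (_ : ι) (x : BTree × BTree) => encSize x + 4) (fun _ x => encSize x) :=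
      h0.add (.const 4)
    refine ⟨.seq init (.loop .left c), _,
      ((hM.mul (.const 20)).add (h0.mul ((hM.mul (.const 2)).add (hM.eval p)))), fun i x => ?_⟩
    have hinit : ∃ t, Runs init (TreeEncoding.enc x) (BTree.compareState x.1 x.2 .nil) t ∧
        t ≤ 5 * encSize x := by
      refine ⟨_, Runs.pair _ _ _ _ _ _ _ (Runs.pair _ _ _ _ _ _ _ (Runs.id _) (Runs.nil _))
        (Runs.nil _), ?_⟩
      simp only [encSize]
      omega
    obtain ⟨t, ht, htx⟩ := hinit
    have hsz : encSize x = x.1.size + x.2.size + 1 := rfl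
    obtain ⟨h₁, h₂⟩ := compare_chain (fun s => hc () s) (encSize x + 4) x.1 x.2 .nil (by
      simp only [hsz, BTree.compareState, BTree.size]; omega)
    have hmul : x.1.size * (2 * (encSize x + 4) + p.eval (encSize x + 4)) ≤
        encSize x * (2 * (encSize x + 4) + p.eval (encSize x + 4)) :=
      Nat.mul_le_mul_right _ (by omega)
    have hpos : 0 < encSize x := encSize_pos x
    have hxe : (TreeEncoding.enc x).size = encSize x := rfl
    by_cases he : x.1 = x.2
    · obtain ⟨s, hs, hsT⟩ := h₁ he _ _ (Runs.loop_nil _ _ _ _ (Runs.left _))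
      simp only [if_pos he]
      refine ⟨_, Runs.seq _ _ _ _ _ _ _ ht hs, ?_⟩
      simp only [BTree.size] at hsT
      rw [Nat.mul_comm (encSize x + 4) 2]
      omega
    · obtain ⟨s, hs, hsT⟩ := h₂ he _ _ (Runs.loop_nil _ _ _ _ (Runs.left _))
      simp only [if_neg he]
      refine ⟨_, Runs.seq _ _ _ _ _ _ _ ht hs, ?_⟩
      simp only [BTree.size] at hsT
      rw [Nat.mul_comm (encSize x + 4) 2]
      omega
  refine (hloop.right.isNode.not).congr fun i x => ?_
  by_cases he : x.1 = x.2 <;> simp [he, BTree.right, BTree.isNode]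

/-- Types with an injective encoding. -/
class InjEncoding (α : Type) [TreeEncoding α] : Prop where
  inj : Function.Injective (TreeEncoding.enc : α → BTree)

theorem PolyTimeIn.eq [∀ i, InjEncoding (Y i)] [∀ i, DecidableEq (Y i)] {f g : ∀ i, X i → Y i}
    (hf : PolyTimeIn W f) (hg : PolyTimeIn W g) :
    PolyTimeIn W (fun i x => decide (f i x = g i x)) := by
  have h := PolyTimeIn.comp (Z := fun _ => Bool) PolyTime.tree_eq
    ((PolyTimeIn.comp (Z := fun _ => BTree) PolyTime.encode hf).prodMk
      (PolyTimeIn.comp (Z := fun _ => BTree) PolyTime.encode hg))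
  refine h.congr fun i x => ?_
  simp only [InjEncoding.inj.eq_iff]

end PolyTime

/-! ### Lists -/

section Encoding

variable {α β : Type} [TreeEncoding α] [TreeEncoding β]

theorem enc_cons (a : α) (l : List α) :
    TreeEncoding.enc (a :: l) = BTree.node (TreeEncoding.enc a) (TreeEncoding.enc l) := rfl

@[simp] theorem encSize_nil : encSize ([] : List α) = 1 := rfl

@[simp] theorem encSize_cons (a : α) (l : List α) :
    encSize (a :: l) = encSize a + encSize l + 1 := rfl

@[simp] theorem encSize_prod (x : α × β) : encSize x = encSize x.1 + encSize x.2 + 1 := rfl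

theorem encSize_bool_le (b : Bool) : encSize b ≤ 3 := by cases b <;> decide

@[simp] theorem encSize_nat (n : ℕ) : encSize n = 2 * n + 1 := by
  induction n with
  | zero => rfl
  | succ n ih =>
    have : encSize (n + 1) = 1 + encSize n + 1 := rfl
    omega

theorem encSize_append (l₁ l₂ : List α) :
    encSize (l₁ ++ l₂) + 1 = encSize l₁ + encSize l₂ := by
  induction l₁ with
  | nil => simp [Nat.add_comm]
  | cons a l ih => simp only [List.cons_append, encSize_cons]; omega

theorem encSize_reverse (l : List α) : encSize l.reverse = encSize l := by
  induction l with
  | nil => rfl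
  | cons a l ih =>
    have := encSize_append l.reverse [a]
    simp only [List.reverse_cons, encSize_cons, encSize_nil] at *
    omega

theorem encSize_flatten_le (L : List (List α)) : encSize L.flatten ≤ encSize L := by
  induction L with
  | nil => simp
  | cons l L ih =>
    have := encSize_append l L.flatten
    simp only [List.flatten_cons, encSize_cons]
    omega

theorem length_le_encSize (l : List α) : l.length ≤ encSize l := by
  induction l with
  | nil => simp
  | cons a l ih => simp only [List.length_cons, encSize_cons]; omega

theorem encSize_le_of_mem {l : List α} {a : α} (h : a ∈ l) : encSize a ≤ encSize l := by
  induction l with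
  | nil => simp at h
  | cons b l ih =>
    rcases List.mem_cons.1 h with rfl | h
    · simp only [encSize_cons]; omega
    · have := ih h
      simp only [encSize_cons]; omega

theorem encSize_list_le {l : List α} {M : ℕ} (h : ∀ a ∈ l, encSize a ≤ M) :
    encSize l ≤ l.length * (M + 1) + 1 := by
  induction l with
  | nil => simp
  | cons a l ih =>
    have h₁ := h a (by simp)
    have h₂ := ih fun b hb => h b (List.mem_cons_of_mem _ hb)
    rw [List.length_cons, Nat.add_mul]
    simp only [encSize_cons]
    omega

theorem encSize_of_sublist {l₁ l₂ : List α} (h : l₁.Sublist l₂) : encSize l₁ ≤ encSize l₂ := by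
  induction h with
  | slnil => rfl
  | cons a _ ih => simp only [encSize_cons]; omega
  | cons_cons a _ ih => simp only [encSize_cons]; omega

instance instInjEncodingNat : InjEncoding ℕ where
  inj a b h := by
    simpa using show encSize a = encSize b from congrArg BTree.size h

instance instInjEncodingFin (n : ℕ) : InjEncoding (Fin n) where
  inj _ _ h := Fin.ext (instInjEncodingNat.inj h)

instance instInjEncodingBool : InjEncoding Bool where
  inj a b h := by cases a <;> cases b <;> first | rfl | cases h

instance instInjEncodingProd [InjEncoding α] [InjEncoding β] : InjEncoding (α × β) where
  inj _ _ h := by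
    obtain ⟨h₁, h₂⟩ := BTree.node.inj h
    exact Prod.ext (InjEncoding.inj h₁) (InjEncoding.inj h₂)

instance instInjEncodingList [InjEncoding α] : InjEncoding (List α) where
  inj a := by
    induction a with
    | nil => intro b h; cases b <;> first | rfl | cases h
    | cons x l ih =>
      intro b h
      cases b with
      | nil => cases h
      | cons y k =>
        obtain ⟨h₁, h₂⟩ := BTree.node.inj h
        rw [InjEncoding.inj h₁, ih h₂]

end Encoding

/-- The test whether `a` is an entry of the list `l`. -/
def memb {α : Type} [DecidableEq α] (a : α) (l : List α) : Bool := decide (a ∈ l)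

theorem memb_eq_true {α : Type} [DecidableEq α] (a : α) (l : List α) :
    (memb a l = true) = (a ∈ l) := by simp [memb]

theorem memb_eq_false {α : Type} [DecidableEq α] (a : α) (l : List α) :
    (memb a l = false) = (a ∉ l) := by simp [memb]

section PolyTime

variable {ι : Type} {X Y Z B α : ι → Type} [∀ i, TreeEncoding (X i)] [∀ i, TreeEncoding (Y i)]
  [∀ i, TreeEncoding (Z i)] [∀ i, TreeEncoding (B i)] [∀ i, TreeEncoding (α i)]
  {W : ∀ i, X i → ℕ}

namespace PolyTimeIn

theorem nil (h : PolyLE (fun _ x => encSize x) W) :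
    PolyTimeIn W (fun i _ => ([] : List (α i))) := const_of_enc_nil h fun _ _ => rfl

theorem cons {a : ∀ i, X i → α i} {l : ∀ i, X i → List (α i)} (ha : PolyTimeIn W a)
    (hl : PolyTimeIn W l) : PolyTimeIn W (fun i x => a i x :: l i x) :=
  (ha.prodMk hl).congr_enc fun _ _ => rfl

/-- The program that performs one step of a fold: it is run on a list, an accumulator and a context,
and applies the program `c` to the context, the accumulator and the head of the list. -/
def foldlBody (c : Prog) : Prog :=
  .pair (.seq .left .right) (.pair
    (.seq (.pair (.pair (.seq .right .right) (.seq .right .left)) (.seq .left .left)) c)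
    (.seq .right .right))

theorem runs_foldlBody {c : Prog} {a l b x b' : BTree} {t : ℕ}
    (h : Runs c (.node (.node x b) a) b' t) :
    ∃ s, Runs (foldlBody c) (.node (.node a l) (.node b x)) (.node l (.node b' x)) s ∧
      s ≤ t + 50 * (BTree.node (.node a l) (.node b x)).size := by
  refine ⟨_, Runs.pair _ _ _ _ _ _ _ (Runs.seq _ _ _ _ _ _ _ (Runs.left _) (Runs.right _))
    (Runs.pair _ _ _ _ _ _ _ (Runs.seq _ _ _ _ _ _ _
      (Runs.pair _ _ _ _ _ _ _ (Runs.pair _ _ _ _ _ _ _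
        (Runs.seq _ _ _ _ _ _ _ (Runs.right _) (Runs.right _))
        (Runs.seq _ _ _ _ _ _ _ (Runs.right _) (Runs.left _)))
        (Runs.seq _ _ _ _ _ _ _ (Runs.left _) (Runs.left _))) h)
      (Runs.seq _ _ _ _ _ _ _ (Runs.right _) (Runs.right _))), ?_⟩
  simp only [BTree.size, BTree.left, BTree.right]
  omega

/-- A polynomial step may still let the accumulator grow exponentially over many rounds. A bound on
the accumulators of all prefixes is therefore required separately; with it each round takes
polynomial time, and there are at most as many rounds as the size of the list. -/
theorem foldl {l : ∀ i, X i → List (α i)} {b : ∀ i, X i → B i} {f : ∀ i, X i → B i → α i → B i}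
    (hl : PolyTimeIn W l) (hb : PolyTimeIn W b)
    (hf : PolyTime (fun i (y : (X i × B i) × α i) => f i y.1.1 y.1.2 y.2))
    {V : ∀ i, X i → ℕ} (hV : PolyLE V W)
    (hsz : ∀ i x l₁ l₂, l i x = l₁ ++ l₂ → encSize (l₁.foldl (f i x) (b i x)) ≤ V i x) :
    PolyTimeIn W (fun i x => (l i x).foldl (f i x) (b i x)) := by
  have hX := hl.encSize_arg
  have hL := hl.encSize_val
  have hi := (hl.prodMk (hb.prodMk (id_of_le hX)))
  obtain ⟨cf, p, hcf⟩ := hf.exists_polynomial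
  obtain ⟨ci, Vi, hVi, hci⟩ := hi
  -- The loop state consists of the rest of the list, the accumulator and the context, joined by two
  -- nodes.
  let M : ∀ i, X i → ℕ := fun i x => encSize (l i x) + V i x + encSize x + 2
  have hM : PolyLE M W := ((hL.add hV).add hX).add (.const 2)
  let T : ∀ i, X i → ℕ := fun i x => 50 * M i x + p.eval (M i x)
  have hT : PolyLE T W := ((PolyLE.const 50).mul hM).add (hM.eval p)
  refine ⟨.seq ci (.seq (.loop .left (foldlBody cf)) (.seq .right .left)),
    fun i x => 10 * M i x + Vi i x + (encSize (l i x) + 1) * (3 * T i x) + encSize x,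
    ((((PolyLE.const 10).mul hM).add hVi).add
      ((hL.add (.const 1)).mul ((PolyLE.const 3).mul hT))).add hX, fun i x => ?_⟩
  obtain ⟨ti, hti, htiV⟩ := hci i x
  let s : ℕ → BTree := fun j => .node (TreeEncoding.enc ((l i x).drop j))
    (.node (TreeEncoding.enc (((l i x).take j).foldl (f i x) (b i x))) (TreeEncoding.enc x))
  have hs : ∀ j, (s j).size ≤ M i x := by
    intro j
    have h₁ : encSize ((l i x).drop j) ≤ encSize (l i x) :=
      encSize_of_sublist (List.drop_sublist j _)
    have h₂ := hsz i x _ _ (List.take_append_drop j (l i x)).symm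
    simp only [s, M, BTree.size, encSize] at *
    omega
  have hstep : ∀ j < (l i x).length, ∃ a, (l i x).drop j = a :: (l i x).drop (j + 1) ∧
      ((l i x).take (j + 1)).foldl (f i x) (b i x) =
        f i x (((l i x).take j).foldl (f i x) (b i x)) a := by
    intro j hj
    refine ⟨(l i x)[j], List.drop_eq_getElem_cons hj, ?_⟩
    rw [List.take_succ_eq_append_getElem hj, List.foldl_append]
    rfl
  obtain ⟨t, ht, htT⟩ := Runs.loop_chain (b := .left) (c := foldlBody cf) (N := (l i x).length)
    (B := T i x) s
    (fun j hj => by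
      obtain ⟨a, ha, -⟩ := hstep j hj
      refine ⟨TreeEncoding.enc a, TreeEncoding.enc ((l i x).drop (j + 1)), _, ?_,
        (hs j).trans (by simp only [T]; omega)⟩
      have h := Runs.left (s j)
      have e : (s j).left = .node (TreeEncoding.enc a) (TreeEncoding.enc ((l i x).drop (j + 1))) := by
        simp only [s, ha, BTree.left, enc_cons]
      rwa [e] at h)
    (fun j hj => by
      obtain ⟨a, ha, hfa⟩ := hstep j hj
      obtain ⟨t, ht, htp⟩ := hcf i ((x, ((l i x).take j).foldl (f i x) (b i x)), a)
      obtain ⟨r, hr, hrt⟩ := runs_foldlBody (l := TreeEncoding.enc ((l i x).drop (j + 1))) ht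
      have e : s j = .node (.node (TreeEncoding.enc a) (TreeEncoding.enc ((l i x).drop (j + 1))))
          (.node (TreeEncoding.enc (((l i x).take j).foldl (f i x) (b i x)))
            (TreeEncoding.enc x)) := by
        simp only [s, ha, enc_cons]
      have e' : s (j + 1) = .node (TreeEncoding.enc ((l i x).drop (j + 1)))
          (.node (TreeEncoding.enc (f i x (((l i x).take j).foldl (f i x) (b i x)) a))
            (TreeEncoding.enc x)) := by
        simp only [s, hfa]
      have hsj := hs j
      rw [e] at hsj
      refine ⟨r, by rw [e, e']; exact hr, hrt.trans ?_⟩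
      have hle : t ≤ p.eval (M i x) := htp.trans (p.eval_nat_mono (by
        simp only [encSize_prod]
        simp only [BTree.size, encSize] at hsj ⊢
        omega))
      simp only [T]
      omega)
    (by
      refine ⟨_, ?_, (hs (l i x).length).trans (by simp only [T]; omega)⟩
      have h := Runs.left (s (l i x).length)
      have e : (s (l i x).length).left = .nil := by
        simp only [s, List.drop_length, BTree.left]
        rfl
      rwa [e] at h)
  have e0 : s 0 = TreeEncoding.enc (l i x, b i x, x) := rfl
  have eN : TreeEncoding.enc ((l i x).foldl (f i x) (b i x)) = (s (l i x).length).right.left := by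
    simp only [s, List.take_length, BTree.right, BTree.left]
  rw [e0] at ht
  rw [eN]
  refine ⟨_, Runs.seq _ _ _ _ _ _ _ hti (Runs.seq _ _ _ _ _ _ _ ht
    (Runs.seq _ _ _ _ _ _ _ (Runs.right _) (Runs.left _))), ?_⟩
  have h0 := hs 0
  have hN := hs (l i x).length
  have hNr := (s (l i x).length).size_right_le
  rw [e0] at h0
  have hlen : ((l i x).length + 1) * (3 * T i x) ≤ (encSize (l i x) + 1) * (3 * T i x) :=
    Nat.mul_le_mul_right _ (Nat.succ_le_succ (length_le_encSize _))
  simp only [encSize] at *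
  omega

theorem reverse {l : ∀ i, X i → List (α i)} (hl : PolyTimeIn W l) :
    PolyTimeIn W (fun i x => (l i x).reverse) := by
  have h := foldl (f := fun i (_ : X i) (acc : List (α i)) a => a :: acc) hl
    (nil (α := α) hl.encSize_arg)
    ((PolyTime.id (X := fun i => (X i × List (α i)) × α i)).snd.cons PolyTime.id.fst.snd)
    hl.encSize_val (by
      intro i x l₁ l₂ h
      have e : l₁.foldl (fun acc a => a :: acc) [] = l₁.reverse := by simp
      rw [e, encSize_reverse, h]
      exact encSize_of_sublist (List.sublist_append_left _ _))
  exact h.congr fun i x => by simp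

theorem foldr {l : ∀ i, X i → List (α i)} {b : ∀ i, X i → B i} {f : ∀ i, X i → α i → B i → B i}
    (hl : PolyTimeIn W l) (hb : PolyTimeIn W b)
    (hf : PolyTime (fun i (y : (X i × B i) × α i) => f i y.1.1 y.2 y.1.2))
    {V : ∀ i, X i → ℕ} (hV : PolyLE V W)
    (hsz : ∀ i x l₁ l₂, l i x = l₁ ++ l₂ → encSize (l₂.foldr (f i x) (b i x)) ≤ V i x) :
    PolyTimeIn W (fun i x => (l i x).foldr (f i x) (b i x)) := by
  have h := foldl (f := fun i x acc a => f i x a acc) hl.reverse hb hf hV (by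
    intro i x l₁ l₂ h
    have h' := congrArg List.reverse h
    rw [List.reverse_reverse, List.reverse_append] at h'
    have := hsz i x _ _ h'
    rwa [List.foldr_reverse] at this)
  exact h.congr fun i x => by rw [List.foldl_reverse]

theorem map {l : ∀ i, X i → List (α i)} {f : ∀ i, X i → α i → B i} (hl : PolyTimeIn W l)
    (hf : PolyTime (fun i (y : X i × α i) => f i y.1 y.2)) :
    PolyTimeIn W (fun i x => (l i x).map (f i x)) := by
  have hX := hl.encSize_arg
  have hL := hl.encSize_val
  obtain ⟨cf, p, hcf⟩ := hf.exists_polynomial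
  have hy : PolyTime (fun i (y : (X i × List (B i)) × α i) => f i y.1.1 y.2) :=
    comp hf ((PolyTime.id (X := fun i => (X i × List (B i)) × α i)).fst.fst.prodMk PolyTime.id.snd)
  have h := foldr (f := fun i x a (acc : List (B i)) => f i x a :: acc) hl
    (nil (α := B) hX) (hy.cons PolyTime.id.fst.snd)
    ((hL.mul ((((hX.add hL).add (.const 1)).eval p).add (.const 1))).add (.const 1)) (by
      intro i x l₁ l₂ h
      have e : l₂.foldr (fun a acc => f i x a :: acc) [] = l₂.map (f i x) := by
        induction l₂ generalizing l₁ with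
        | nil => rfl
        | cons a l ih =>
          rw [List.foldr_cons, List.map_cons, ih (l₁ ++ [a]) (by simpa using h)]
      rw [e]
      have hlen : l₂.length ≤ encSize (l i x) := by
        refine le_trans ?_ (length_le_encSize _)
        rw [h, List.length_append]
        omega
      refine (encSize_list_le (M := p.eval (encSize x + encSize (l i x) + 1)) ?_).trans ?_
      · intro c hc
        obtain ⟨a, ha, rfl⟩ := List.mem_map.1 hc
        -- The size of each image is bounded by the time needed to compute it.
        obtain ⟨t, ht, htp⟩ := hcf i (x, a)
        refine ht.size_le.2.trans (htp.trans (p.eval_nat_mono ?_))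
        have : encSize a ≤ encSize (l i x) :=
          encSize_le_of_mem (by rw [h]; exact List.mem_append_right _ ha)
        simp only [encSize_prod]
        omega
      · rw [List.length_map]
        exact Nat.add_le_add_right (Nat.mul_le_mul_right _ hlen) 1)
  refine h.congr fun i x => ?_
  generalize l i x = k
  induction k with
  | nil => rfl
  | cons a k ih => rw [List.foldr_cons, List.map_cons, ih]

theorem append {k l : ∀ i, X i → List (α i)} (hk : PolyTimeIn W k) (hl : PolyTimeIn W l) :
    PolyTimeIn W (fun i x => k i x ++ l i x) := by
  have h := foldr (f := fun i (_ : X i) a (acc : List (α i)) => a :: acc) hk hl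
    ((PolyTime.id (X := fun i => (X i × List (α i)) × α i)).snd.cons PolyTime.id.fst.snd)
    (hk.encSize_val.add hl.encSize_val) (by
      intro i x l₁ l₂ h
      rw [List.foldr_cons_eq_append]
      have h₁ := encSize_append l₂ (l i x)
      have h₂ : encSize l₂ ≤ encSize (k i x) := by
        rw [h]; exact encSize_of_sublist (List.sublist_append_right _ _)
      simp only [List.map_id']
      omega)
  exact h.congr fun i x => by simp

theorem flatten {L : ∀ i, X i → List (List (α i))} (hL : PolyTimeIn W L) :
    PolyTimeIn W (fun i x => (L i x).flatten) := by
  have e : ∀ {β : Type} (L : List (List β)), L.foldr (fun a acc => a ++ acc) [] = L.flatten := by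
    intro β L
    induction L with
    | nil => rfl
    | cons a L ih => rw [List.foldr_cons, ih, List.flatten_cons]
  have h := foldr (f := fun i (_ : X i) a (acc : List (α i)) => a ++ acc) hL
    (nil (α := α) hL.encSize_arg)
    ((PolyTime.id (X := fun i => (X i × List (α i)) × List (α i))).snd.append PolyTime.id.fst.snd)
    hL.encSize_val (by
      intro i x l₁ l₂ h
      rw [e, h]
      exact (encSize_flatten_le _).trans (encSize_of_sublist (List.sublist_append_right _ _)))
  exact h.congr fun i x => by rw [e]

theorem flatMap {l : ∀ i, X i → List (α i)} {f : ∀ i, X i → α i → List (B i)}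
    (hl : PolyTimeIn W l) (hf : PolyTime (fun i (y : X i × α i) => f i y.1 y.2)) :
    PolyTimeIn W (fun i x => (l i x).flatMap (f i x)) :=
  (hl.map hf).flatten.congr fun i x => by rw [List.flatMap_def]

theorem filter {l : ∀ i, X i → List (α i)} {f : ∀ i, X i → α i → Bool}
    (hl : PolyTimeIn W l) (hf : PolyTime (fun i (y : X i × α i) => f i y.1 y.2)) :
    PolyTimeIn W (fun i x => (l i x).filter (f i x)) := by
  have hs : PolyTime (fun i (y : X i × α i) => [y.2]) :=
    PolyTime.id.snd.cons (nil (.of_le fun _ _ => le_rfl))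
  refine (hl.flatMap (f := fun i x a => if f i x a = true then [a] else [])
    (hf.ite hs (nil (.of_le fun _ _ => le_rfl)))).congr fun i x => ?_
  generalize l i x = k
  induction k with
  | nil => rfl
  | cons a k ih =>
    rw [List.flatMap_cons, ih, List.filter_cons]
    cases f i x a <;> simp

theorem any {l : ∀ i, X i → List (α i)} {f : ∀ i, X i → α i → Bool}
    (hl : PolyTimeIn W l) (hf : PolyTime (fun i (y : X i × α i) => f i y.1 y.2)) :
    PolyTimeIn W (fun i x => (l i x).any (f i x)) := by
  have hy : PolyTime (fun i (y : (X i × Bool) × α i) => f i y.1.1 y.2) :=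
    comp hf ((PolyTime.id (X := fun i => (X i × Bool) × α i)).fst.fst.prodMk PolyTime.id.snd)
  have h := foldr (B := fun _ => Bool) (f := fun i x a acc => f i x a || acc) hl
    (of_polyTime PolyTime.bool_false hl.encSize_arg) (hy.or PolyTime.id.fst.snd)
    (.const 3) (fun i x l₁ l₂ h => encSize_bool_le _)
  refine h.congr fun i x => ?_
  generalize l i x = k
  induction k with
  | nil => rfl
  | cons a k ih => rw [List.foldr_cons, List.any_cons, ih]

theorem all {l : ∀ i, X i → List (α i)} {f : ∀ i, X i → α i → Bool}
    (hl : PolyTimeIn W l) (hf : PolyTime (fun i (y : X i × α i) => f i y.1 y.2)) :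
    PolyTimeIn W (fun i x => (l i x).all (f i x)) :=
  (hl.any hf.not).not.congr fun i x => by rw [List.all_eq_not_any_not]

theorem memb [∀ i, InjEncoding (α i)] [∀ i, DecidableEq (α i)] {a : ∀ i, X i → α i}
    {l : ∀ i, X i → List (α i)} (ha : PolyTimeIn W a) (hl : PolyTimeIn W l) :
    PolyTimeIn W (fun i x => memb (a i x) (l i x)) := by
  have h := (PolyTime.id (X := fun i => α i × List (α i))).snd.any
    (f := fun i y b => decide (y.1 = b))
    (PolyTimeIn.eq (PolyTime.id (X := fun i => (α i × List (α i)) × α i)).fst.fst PolyTime.id.snd)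
  refine (comp h (ha.prodMk hl)).congr fun i x => ?_
  rw [Bool.eq_iff_iff]
  simp [_root_.memb]

/-- In unary, a number is encoded like the list of that many units, so the length results from
mapping all entries to the unit. The same observation, read backwards, turns counters into lists to
be folded over. -/
theorem length {l : ∀ i, X i → List (α i)} (hl : PolyTimeIn W l) :
    PolyTimeIn W (fun i x => (l i x).length) := by
  have hu : PolyTime (fun i (_ : X i × α i) => ()) := .of_enc_nil fun _ _ => rfl
  refine (hl.map (B := fun _ => Unit) (f := fun _ _ _ => ()) hu).congr_enc fun i x => ?_
  generalize l i x = k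
  induction k with
  | nil => rfl
  | cons a k ih =>
    show BTree.node .nil _ = BTree.node .nil _
    exact congrArg _ ih

theorem replicate {k : ∀ i, X i → ℕ} (hk : PolyTimeIn W k) :
    PolyTimeIn W (fun i x => List.replicate (k i x) ()) := by
  refine hk.congr_enc fun i x => ?_
  generalize k i x = n
  induction n with
  | zero => rfl
  | succ n ih =>
    show BTree.node .nil _ = BTree.node .nil _
    exact congrArg _ ih

theorem iterate {k : ∀ i, X i → ℕ} {b : ∀ i, X i → B i} {f : ∀ i, X i → B i → B i}
    (hk : PolyTimeIn W k) (hb : PolyTimeIn W b)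
    (hf : PolyTime (fun i (y : X i × B i) => f i y.1 y.2))
    {V : ∀ i, X i → ℕ} (hV : PolyLE V W)
    (hsz : ∀ i x, ∀ j ≤ k i x, encSize ((f i x)^[j] (b i x)) ≤ V i x) :
    PolyTimeIn W (fun i x => (f i x)^[k i x] (b i x)) := by
  have e : ∀ i x (l : List Unit), l.foldl (fun acc _ => f i x acc) (b i x) =
      (f i x)^[l.length] (b i x) := by
    intro i x l
    generalize b i x = c
    induction l generalizing c with
    | nil => rfl
    | cons a l ih => rw [List.foldl_cons, ih, List.length_cons, Function.iterate_succ_apply]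
  have h := foldl (α := fun _ => Unit) (f := fun i x acc _ => f i x acc) hk.replicate hb
    (comp hf PolyTime.prod_fst) hV (by
      intro i x l₁ l₂ h
      rw [e]
      refine hsz i x _ ?_
      have := congrArg List.length h
      simp only [List.length_replicate, List.length_append] at this
      omega)
  exact h.congr fun i x => by rw [e, List.length_replicate]

theorem freeMonoid_toList {w : ∀ i, X i → FreeMonoid (α i)} (hw : PolyTimeIn W w) :
    PolyTimeIn W (fun i x => (w i x).toList) := hw.congr_enc fun _ _ => rfl

theorem freeMonoid_ofList {w : ∀ i, X i → List (α i)} (hw : PolyTimeIn W w) :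
    PolyTimeIn W (fun i x => FreeMonoid.ofList (w i x)) := hw.congr_enc fun _ _ => rfl

end PolyTimeIn

end PolyTime

/-! ### The construction of the transducer by list operations -/

section ListLemmas

variable {α : Type}

/-- By monotonicity the iterates from the empty list form an ascending chain of sublists of `c`.
Until it becomes stationary the length grows in every round, which can happen at most `c.length`
times. -/
theorem List.filter_iterate_fixed (c : List α) (φ : List α → α → Bool)
    (hφ : ∀ T T' : List α, T ⊆ T' → ∀ a, φ T a = true → φ T' a = true) :
    (fun T => c.filter (φ T))^[c.length + 1] [] = (fun T => c.filter (φ T))^[c.length] [] := by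
  let F : List α → List α := fun T => c.filter (φ T)
  have hstep : ∀ j, F^[j] [] ⊆ F^[j + 1] [] := by
    intro j
    induction j with
    | zero => simp
    | succ j ih =>
      rw [Function.iterate_succ_apply', Function.iterate_succ_apply' F (j + 1)]
      intro a ha
      obtain ⟨h₁, h₂⟩ := List.mem_filter.1 ha
      exact List.mem_filter.2 ⟨h₁, hφ _ _ ih a h₂⟩
  have hsub : ∀ j, (F^[j] []).Sublist (F^[j + 1] []) := by
    intro j
    cases j with
    | zero => simp
    | succ j =>
      rw [Function.iterate_succ_apply', Function.iterate_succ_apply' F (j + 1)]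
      exact List.monotone_filter_right c (hφ _ _ (hstep j))
  by_contra hne
  -- A repetition at any round would persist, and in particular would hold at the last one.
  have hlt : ∀ j ≤ c.length, F^[j] [] ≠ F^[j + 1] [] := by
    intro j hj he
    apply hne
    have hst : ∀ k, F^[j + k] [] = F^[j] [] := by
      intro k
      induction k with
      | zero => rfl
      | succ k ih => rw [← Nat.add_assoc, Function.iterate_succ_apply', ih,
          ← Function.iterate_succ_apply' F, he]
    have h₁ := hst (c.length + 1 - j)
    have h₂ := hst (c.length - j)
    rw [Nat.add_sub_cancel' (by omega)] at h₁ h₂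
    exact h₁.trans h₂.symm
  have hlen : ∀ j ≤ c.length + 1, j ≤ (F^[j] []).length := by
    intro j hj
    induction j with
    | zero => simp
    | succ j ih =>
      have h₁ := ih (by omega)
      have h₂ := (hsub j).length_le
      by_contra h
      exact hlt j (by omega) ((hsub j).eq_of_length_le (by omega))
  have h₁ := hlen _ le_rfl
  have h₂ : (F^[c.length + 1] []).length ≤ c.length := by
    rw [Function.iterate_succ_apply']
    exact List.length_filter_le _ _
  omega

/-- The lists of length at most `k` with entries from `l`. -/
def listsUpTo (k : ℕ) (l : List α) : List (List α) :=
  (fun L => [] :: l.flatMap fun a => L.map fun x => a :: x)^[k] [[]]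

theorem mem_listsUpTo {k : ℕ} {l x : List α} :
    x ∈ listsUpTo k l ↔ x.length ≤ k ∧ ∀ a ∈ x, a ∈ l := by
  induction k generalizing x with
  | zero => simp +contextual [listsUpTo]
  | succ k ih =>
    rw [listsUpTo, Function.iterate_succ_apply']
    change x ∈ [] :: l.flatMap (fun a => (listsUpTo k l).map fun x => a :: x) ↔ _
    cases x with
    | nil => simp
    | cons a x =>
      simp only [List.mem_cons, reduceCtorEq, List.mem_flatMap, List.mem_map, ih, false_or,
        List.cons.injEq, List.length_cons, Nat.add_le_add_iff_right, forall_eq_or_imp]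
      constructor
      · rintro ⟨b, hb, y, ⟨h₁, h₂⟩, rfl, rfl⟩
        exact ⟨h₁, hb, h₂⟩
      · rintro ⟨h₁, h₂, h₃⟩
        exact ⟨a, h₂, x, ⟨h₁, h₃⟩, rfl, rfl⟩

/-- Tags the entries of a list by the number of subsequent entries. -/
def tagged (l : List α) : List (α × ℕ) := l.foldr (fun a k => (a, k.length) :: k) []

theorem tagged_cons (a : α) (l : List α) :
    tagged (a :: l) = (a, (tagged l).length) :: tagged l := rfl

theorem length_tagged (l : List α) : (tagged l).length = l.length := by
  induction l with
  | nil => rfl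
  | cons a l ih => rw [tagged_cons, List.length_cons, ih, List.length_cons]

theorem mem_tagged {l : List α} {a : α} {j : ℕ} : (a, j) ∈ tagged l ↔ l.reverse[j]? = some a := by
  induction l with
  | nil => simp [tagged]
  | cons b l ih =>
    rw [tagged_cons, length_tagged, List.mem_cons, ih, List.reverse_cons, List.getElem?_append]
    split_ifs with h
    · rw [List.length_reverse] at h
      constructor
      · rintro (h' | h')
        · have := (Prod.mk.inj h').2
          omega
        · exact h'
      · exact .inr
    · rw [List.length_reverse] at h ⊢
      rw [List.getElem?_eq_none (by simpa using h)]
      constructor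
      · rintro (h' | h')
        · obtain ⟨rfl, rfl⟩ := Prod.mk.inj h'
          simp
        · simp at h'
      · intro h'
        left
        obtain ⟨h₁, h₂⟩ := List.getElem?_eq_some_iff.1 h'
        simp only [List.length_singleton] at h₁
        simp only [List.getElem_singleton] at h₂
        exact Prod.ext h₂.symm (by simp only; omega)

/-- The suffixes of a list. -/
theorem List.foldr_tails (l : List α) :
    l.foldr (fun a s => (a :: s.1, (a :: s.1) :: s.2)) (([] : List α), [([] : List α)]) =
      (l, l.tails) := by
  induction l with
  | nil => rfl
  | cons a l ih => rw [List.foldr_cons, ih]; rfl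

end ListLemmas

/-! ### The components of the transducer as lists, and their correctness. -/

namespace PushdownSystem

section Construction

variable {A Q : Type} [DecidableEq A] [DecidableEq Q]

/-- The words of items. -/
def itemWords (letters : List A) (trans : List (Q × A × FreeMonoid A × Q)) : List (List A) :=
  [] :: (letters.map (fun c => [c]) ++ trans.flatMap fun t => t.2.2.1.toList.reverse.tails)

/-- All candidates for runs without output. -/
def popCandidates (states : List Q) (words : List (List A)) : List (Q × List A × Q) :=
  states.flatMap fun r => words.flatMap fun x => states.map fun s => (r, x, s)

/-- The test whether a candidate is a run without output composed of runs from the table `T`. -/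
def popTest (words : List (List A)) (trans : List (Q × A × FreeMonoid A × Q))
    (T : List (Q × List A × Q)) (c : Q × List A × Q) : Bool :=
  (decide (c.2.1 = []) && decide (c.1 = c.2.2)) ||
    trans.any fun t => words.any fun x =>
      decide (c.2.1 = t.2.1 :: x) && (memb (c.1, x, t.1) T &&
        memb (t.2.2.2, t.2.2.1.toList.reverse, c.2.2) T)

/-- The table of all runs without output. -/
def popTable (states : List Q) (words : List (List A)) (trans : List (Q × A × FreeMonoid A × Q)) :
    List (Q × List A × Q) :=
  (fun T => (popCandidates states words).filter (popTest words trans T))^[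
    (popCandidates states words).length] []

/-- A list of letters that contains exactly one letter of each class of twins. -/
def twinReps (letters : List A) (deps : List (A × A)) : List A :=
  letters.foldr (fun a R => if (R.any fun b => letters.all fun c =>
    decide (memb (a, c) deps = memb (b, c) deps)) = true then R else a :: R) []

/-- The items whose words and whose lists of letters are taken from given lists. -/
def itemList (states : List Q) (words lists : List (List A)) : List (Item A Q) :=
  states.flatMap fun r => words.flatMap fun x => states.flatMap fun s =>
    lists.map fun F => (r, x, s, F)

/-- The lists that represent the union of `D(F)` and `D(b)`. -/
def extensions (letters : List A) (deps : List (A × A)) (b : A) (F : List A) : List (List A) :=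
  (b :: F) :: if (F.any fun e => letters.all fun d =>
    !memb (b, d) deps || memb (e, d) deps) = true then [F] else []

/-- A labeled move of the machine. -/
abbrev LabeledMove (A Q : Type) : Type :=
  MachineState A Q × (List A × List A) × MachineState A Q

/-- The moves of the machine that manipulate the item `i` on top of the stack `k`, or put it there.
-/
def itemMoves (letters : List A) (deps : List (A × A)) (trans : List (Q × A × FreeMonoid A × Q))
    (pop : List (Q × List A × Q)) (f : Bool) (i : Item A Q) (k : List (Item A Q)) :
    List (LabeledMove A Q) :=
  (if (decide (i.2.1 = []) && decide (i.1 = i.2.2.1)) = true then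
    [((f, i :: k), ([], []), (false, k))] else []) ++
  ((letters.flatMap fun b => if (i.2.2.2.all fun e => !memb (b, e) deps) = true then
    [((f, (i.1, b :: i.2.1, i.2.2.1, i.2.2.2) :: k), ([], [b]), (f, i :: k))] else []) ++
  ((trans.flatMap fun t => (extensions letters deps t.2.1 i.2.2.2).flatMap fun F' =>
    (if memb (t.2.2.2, t.2.2.1.toList.reverse, i.2.2.1) pop = true then
      [((f, (i.1, t.2.1 :: i.2.1, i.2.2.1, i.2.2.2) :: k), ([], []),
        (f, (i.1, i.2.1, t.1, F') :: k))] else []) ++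
    [((f, (i.1, t.2.1 :: i.2.1, i.2.2.1, i.2.2.2) :: k), ([], []),
      (f, (i.1, i.2.1, t.1, F') :: (t.2.2.2, t.2.2.1.toList.reverse, i.2.2.1, i.2.2.2) :: k))]) ++
  (if (f && decide (i.2.1 = [])) = true then letters.map fun c =>
    ((f, i :: k), ([c], []), (f, (i.1, [c], i.2.2.1, i.2.2.2) :: k)) else [])))

/-- The moves of the machine whose remainders are built from given items and given remainders. -/
def moveList (letters : List A) (deps : List (A × A)) (trans : List (Q × A × FreeMonoid A × Q))
    (pop : List (Q × List A × Q)) (items : List (Item A Q)) (remainders : List (List (Item A Q))) :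
    List (LabeledMove A Q) :=
  [true, false].flatMap fun f => items.flatMap fun i => remainders.flatMap fun k =>
    itemMoves letters deps trans pop f i k

/-- The states of the machine with given remainders. -/
def stateList (remainders : List (List (Item A Q))) : List (MachineState A Q) :=
  [true, false].flatMap fun f => remainders.map fun k => (f, k)

/-- The transitions of the transducer. -/
def transitionList (moves : List (LabeledMove A Q)) (tags : List (MachineState A Q × ℕ)) :
    List (ℕ × (FreeMonoid A × FreeMonoid A) × ℕ) :=
  moves.flatMap fun v => tags.flatMap fun s => tags.flatMap fun t =>
    if (decide (v.1 = s.1) && decide (v.2.2 = t.1)) = true then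
      [(t.2, (FreeMonoid.ofList v.2.1.1, FreeMonoid.ofList v.2.1.2), s.2)] else []

/-- The numbers of the states that equal `σ`. -/
def numbersOf (σ : MachineState A Q) (tags : List (MachineState A Q × ℕ)) : List ℕ :=
  (tags.filter fun s => decide (s.1 = σ)).map fun s => s.2

end Construction

section Correctness

variable {A Q : Type} {D : DepAlphabet A}
  {P : PushdownSystem A Q} {letters : List A} {states : List Q} {deps : List (A × A)}
  {trans : List (Q × A × FreeMonoid A × Q)}

theorem mem_itemWords (hl : ∀ a, a ∈ letters) (ht : ∀ t, t ∈ trans ↔ t ∈ P.trans) {x : List A} :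
    x ∈ itemWords letters trans ↔ P.ItemWord x := by
  simp only [itemWords, List.mem_cons, List.mem_append, List.mem_map, hl, true_and,
    List.mem_flatMap, List.mem_tails, ht, ItemWord, Prod.exists]
  refine or_congr Iff.rfl (or_congr ⟨fun ⟨c, h⟩ => ⟨c, h.symm⟩, fun ⟨c, h⟩ => ⟨c, h.symm⟩⟩ Iff.rfl)

theorem mem_stateList {remainders : List (List (Item A Q))} {σ : MachineState A Q} :
    σ ∈ stateList remainders ↔ σ.2 ∈ remainders := by
  obtain ⟨f, k⟩ := σ
  cases f <;> simp [stateList]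

theorem mem_itemList (hs : ∀ r, r ∈ states) {words lists : List (List A)} {i : Item A Q} :
    i ∈ itemList states words lists ↔ i.2.1 ∈ words ∧ i.2.2.2 ∈ lists := by
  obtain ⟨r, x, s, F⟩ := i
  simp [itemList, hs]

variable [DecidableEq A] [DecidableEq Q]

/-- The table is the least fixed point of the rules for output-free runs. Its entries are sound by
induction on the rounds; it is complete by induction on runs, since item words are closed under
tails and include the reversed words of all transitions. -/
theorem mem_popTable (hs : ∀ r, r ∈ states) (ht : ∀ t, t ∈ trans ↔ t ∈ P.trans)
    {words : List (List A)} (hw : ∀ x, x ∈ words ↔ P.ItemWord x) {r s : Q} {x : List A} :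
    (r, x, s) ∈ popTable states words trans ↔ P.ItemWord x ∧ P.Run D r x s [] := by
  let c := popCandidates states words
  have hc : ∀ r x s, (r, x, s) ∈ c ↔ P.ItemWord x := by
    intro r x s
    simp [c, popCandidates, hs, hw]
  let F : List (Q × List A × Q) → List (Q × List A × Q) :=
    fun T => c.filter (popTest words trans T)
  have hF : ∀ T r x s, (r, x, s) ∈ F T ↔ P.ItemWord x ∧ ((x = [] ∧ r = s) ∨ ∃ t b v r' x',
      (t, b, v, r') ∈ P.trans ∧ x = b :: x' ∧ (r, x', t) ∈ T ∧
        (r', v.toList.reverse, s) ∈ T) := by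
    intro T r x s
    simp only [F, List.mem_filter, hc, popTest, memb_eq_true, Bool.or_eq_true, Bool.and_eq_true,
      decide_eq_true_eq, List.any_eq_true, ht, hw]
    refine and_congr_right fun hx => or_congr Iff.rfl ⟨?_, ?_⟩
    · rintro ⟨⟨t, b, v, r'⟩, h₁, x', -, h₂, h₃, h₄⟩
      exact ⟨t, b, v, r', x', h₁, h₂, h₃, h₄⟩
    · rintro ⟨t, b, v, r', x', h₁, h₂, h₃, h₄⟩
      exact ⟨(t, b, v, r'), h₁, x', (h₂ ▸ hx).tail, h₂, h₃, h₄⟩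
  have hfix : F (popTable states words trans) = popTable states words trans := by
    have := List.filter_iterate_fixed c (popTest words trans) (by
      intro T T' hT a
      simp only [popTest, memb_eq_true, Bool.or_eq_true, Bool.and_eq_true,
        decide_eq_true_eq, List.any_eq_true]
      rintro (h | ⟨t, h₁, x', h₂, h₃, h₄, h₅⟩)
      · exact .inl h
      · exact .inr ⟨t, h₁, x', h₂, h₃, hT h₄, hT h₅⟩)
    rwa [Function.iterate_succ_apply'] at this
  constructor
  · have key : ∀ j r x s, (r, x, s) ∈ F^[j] [] → P.ItemWord x ∧ P.Run D r x s [] := by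
      intro j
      induction j with
      | zero => simp
      | succ j ih =>
        intro r x s h
        rw [Function.iterate_succ_apply', hF] at h
        obtain ⟨hx, ⟨rfl, rfl⟩ | ⟨t, b, v, r', x', h₁, rfl, h₂, h₃⟩⟩ := h
        · exact ⟨hx, .nil r⟩
        · exact ⟨hx, .touch (o := []) (o' := []) (ih _ _ _ h₂).2 (by simp) h₁ (ih _ _ _ h₃).2⟩
    exact key _ r x s
  · rintro ⟨hx, hr⟩
    have key : ∀ {r x s o}, P.Run D r x s o → o = [] → P.ItemWord x →
        (r, x, s) ∈ popTable states words trans := by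
      intro r x s o hr
      induction hr with
      | nil r =>
        intro _ hx
        rw [← hfix, hF]
        exact ⟨hx, .inl ⟨rfl, rfl⟩⟩
      | keep b _ _ => intro h; simp at h
      | @touch r t r' s x o o' b v _ _ hb _ ih₁ ih₂ =>
        intro h hx
        obtain ⟨rfl, rfl⟩ := List.append_eq_nil_iff.1 h
        rw [← hfix, hF]
        exact ⟨hx, .inr ⟨t, b, v, r', x, hb, rfl, ih₁ rfl hx.tail,
          ih₂ rfl (.inr (.inr ⟨t, b, v, r', hb, List.suffix_rfl⟩))⟩⟩
    exact key hr rfl hx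

/-- This makes the twin index available to the program, which needs it as the length of the lists to
be enumerated. The list has no two twins, and every letter has a twin in it. -/
theorem length_twinReps [Finite A] (hl : ∀ a, a ∈ letters)
    (hd : ∀ a b, (a, b) ∈ deps ↔ D.Dep a b) :
    (twinReps letters deps).length = D.twinIndex := by
  have htw : ∀ a b : A, (letters.all fun c =>
      decide (memb (a, c) deps = memb (b, c) deps)) = true ↔
        D.ofLetter a = D.ofLetter b := by
    intro a b
    simp only [List.all_eq_true, hl, true_imp_iff, decide_eq_true_eq]
    refine (forall_congr' fun c => Bool.eq_iff_iff).trans ?_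
    simp only [memb_eq_true, hd]
    constructor
    · exact fun h => Set.ext h
    · exact fun h c => Set.ext_iff.1 h c
  have key : ∀ l : List A, ∀ R, R = l.foldr (fun a R => if (R.any fun b => letters.all fun c =>
      decide (memb (a, c) deps = memb (b, c) deps)) = true then R else a :: R) [] →
      R.Pairwise (fun a b => D.ofLetter a ≠ D.ofLetter b) ∧
        ∀ a ∈ l, ∃ b ∈ R, D.ofLetter a = D.ofLetter b := by
    intro l
    induction l with
    | nil => rintro R rfl; simp
    | cons a l ih =>
      rintro R rfl
      obtain ⟨h₁, h₂⟩ := ih _ rfl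
      rw [List.foldr_cons]
      set R := l.foldr (fun a R => if (R.any fun b => letters.all fun c =>
        decide (memb (a, c) deps = memb (b, c) deps)) = true then R else a :: R) []
      by_cases h : (R.any fun b => letters.all fun c =>
          decide (memb (a, c) deps = memb (b, c) deps)) = true
      · rw [if_pos h]
        obtain ⟨b, hb, hab⟩ := List.any_eq_true.1 h
        refine ⟨h₁, fun c hc => ?_⟩
        rcases List.mem_cons.1 hc with rfl | hc
        · exact ⟨b, hb, (htw _ _).1 hab⟩
        · exact h₂ c hc
      · rw [if_neg h]
        refine ⟨List.pairwise_cons.2 ⟨fun b hb hab => h ?_, h₁⟩, fun c hc => ?_⟩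
        · exact List.any_eq_true.2 ⟨b, hb, (htw _ _).2 hab⟩
        · rcases List.mem_cons.1 hc with rfl | hc
          · exact ⟨c, by simp, rfl⟩
          · obtain ⟨b, hb, hcb⟩ := h₂ c hc
            exact ⟨b, List.mem_cons_of_mem _ hb, hcb⟩
  obtain ⟨h₁, h₂⟩ := key letters _ rfl
  refine le_antisymm (D.length_le_twinIndex h₁) ?_
  have hsub : Set.range D.twins ⊆ D.twins '' {b | b ∈ twinReps letters deps} := by
    rintro _ ⟨a, rfl⟩
    obtain ⟨b, hb, hab⟩ := h₂ a (hl a)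
    exact ⟨b, hb, by simp only [DepAlphabet.twins, hab]⟩
  refine (Set.ncard_le_ncard hsub (Set.toFinite _)).trans
    ((Set.ncard_image_le (Set.toFinite _)).trans ?_)
  rw [← List.coe_toFinset, Set.ncard_coe_finset]
  exact List.toFinset_card_le _

theorem mem_extensions (hl : ∀ a, a ∈ letters) (hd : ∀ a b, (a, b) ∈ deps ↔ D.Dep a b) {b : A}
    {F F' : List A} : F' ∈ extensions letters deps b F ↔ Extends D b F F' := by
  simp only [extensions, memb_eq_true, memb_eq_false, List.mem_cons, List.mem_ite_nil_right,
    List.not_mem_nil, or_false,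
    List.any_eq_true, List.all_eq_true, hl, true_imp_iff, Extends, Bool.or_eq_true,
    Bool.not_eq_true', hd, ← imp_iff_not_or]
  exact or_congr Iff.rfl and_comm

theorem mem_itemMoves (hl : ∀ a, a ∈ letters) (hd : ∀ a b, (a, b) ∈ deps ↔ D.Dep a b)
    (ht : ∀ t, t ∈ trans ↔ t ∈ P.trans) {pop : List (Q × List A × Q)}
    (hp : ∀ r x s, (r, x, s) ∈ pop ↔ P.ItemWord x ∧ P.Run D r x s [])
    {f : Bool} {r s : Q} {x F : List A} {k : List (Item A Q)} {v : LabeledMove A Q} :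
    v ∈ itemMoves letters deps trans pop f (r, x, s, F) k ↔
      (x = [] ∧ r = s ∧ v = ((f, (r, x, s, F) :: k), ([], []), (false, k))) ∨
      (∃ b, (∀ e ∈ F, ¬ D.Dep b e) ∧
        v = ((f, (r, b :: x, s, F) :: k), ([], [b]), (f, (r, x, s, F) :: k))) ∨
      (∃ t b w r' F', (t, b, w, r') ∈ P.trans ∧ Extends D b F F' ∧
        ((P.Run D r' w.toList.reverse s [] ∧
          v = ((f, (r, b :: x, s, F) :: k), ([], []), (f, (r, x, t, F') :: k))) ∨
        v = ((f, (r, b :: x, s, F) :: k), ([], []),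
          (f, (r, x, t, F') :: (r', w.toList.reverse, s, F) :: k)))) ∨
      (f = true ∧ x = [] ∧ ∃ c, v = ((f, (r, x, s, F) :: k), ([c], []), (f, (r, [c], s, F) :: k)))
      := by
  simp only [itemMoves, memb_eq_true, memb_eq_false, List.mem_append, List.mem_flatMap,
    List.mem_ite_nil_right, hl, true_and,
    List.mem_singleton, Bool.and_eq_true, decide_eq_true_eq, List.all_eq_true, Bool.not_eq_true',
    hd, ht, mem_extensions hl hd, hp, List.mem_map, Prod.exists, and_assoc]
  refine or_congr Iff.rfl (or_congr Iff.rfl (or_congr ?_ ?_))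
  · constructor
    · rintro ⟨t, b, w, r', h₁, F', h₂, ⟨-, h₃⟩ | h₃⟩
      · exact ⟨t, b, w, r', F', h₁, h₂, .inl h₃⟩
      · exact ⟨t, b, w, r', F', h₁, h₂, .inr h₃⟩
    · rintro ⟨t, b, w, r', F', h₁, h₂, h₃ | h₃⟩
      · exact ⟨t, b, w, r', h₁, F', h₂,
          .inl ⟨.inr (.inr ⟨t, b, w, r', h₁, List.suffix_rfl⟩), h₃⟩⟩
      · exact ⟨t, b, w, r', h₁, F', h₂, .inr h₃⟩
  · exact and_congr_right fun _ => and_congr_right fun _ =>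
      ⟨fun ⟨c, h⟩ => ⟨c, h.symm⟩, fun ⟨c, h⟩ => ⟨c, h.symm⟩⟩

/-- Moves are enumerated from the item and the stack that remain after a letter has been removed,
and may therefore start outside the listed stacks. For a source among them, the closure of items and
stacks under tails guarantees that the remaining data are enumerated. -/
theorem mem_moveList (hl : ∀ a, a ∈ letters) (hd : ∀ a b, (a, b) ∈ deps ↔ D.Dep a b)
    (ht : ∀ t, t ∈ trans ↔ t ∈ P.trans) {pop : List (Q × List A × Q)}
    (hp : ∀ r x s, (r, x, s) ∈ pop ↔ P.ItemWord x ∧ P.Run D r x s []) {K : ℕ}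
    {items : List (Item A Q)} {remainders : List (List (Item A Q))}
    (hi : ∀ i, i ∈ items ↔ P.ItemWord i.2.1 ∧ i.2.2.2.length ≤ K)
    (hr : ∀ i k, i :: k ∈ remainders → i ∈ items ∧ k ∈ remainders) {σ σ' : MachineState A Q}
    {l : List A × List A} (hσ : σ.2 ∈ remainders) :
    (σ, l, σ') ∈ moveList letters deps trans pop items remainders ↔ P.Move D σ l σ' := by
  have hb : ∀ f : Bool, f ∈ [true, false] := by decide
  constructor
  · intro h
    obtain ⟨f, -, h⟩ := List.mem_flatMap.1 h
    obtain ⟨⟨r, x, s, F⟩, -, h⟩ := List.mem_flatMap.1 h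
    obtain ⟨k, -, h⟩ := List.mem_flatMap.1 h
    rcases (mem_itemMoves hl hd ht hp).1 h with ⟨rfl, rfl, h⟩ | ⟨b, h₁, h⟩ |
      ⟨t, b, w, r', F', h₁, h₂, ⟨h₃, h⟩ | h⟩ | ⟨rfl, rfl, c, h⟩
    all_goals cases h
    · exact .drop f r F k
    · exact .keep f r s b x F k h₁
    · exact .pop f r t r' s b w x F F' k h₁ h₃ h₂
    · exact .touch f r t r' s b w x F F' k h₁ h₂
    · exact .read r s c F k
  · intro h
    have key : ∀ f r x s F k, (r, x, s, F) ∈ items → k ∈ remainders →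
        (σ, l, σ') ∈ itemMoves letters deps trans pop f (r, x, s, F) k →
        (σ, l, σ') ∈ moveList letters deps trans pop items remainders := fun f r x s F k h₁ h₂ h₃ =>
      List.mem_flatMap.2 ⟨f, hb f, List.mem_flatMap.2 ⟨_, h₁, List.mem_flatMap.2 ⟨k, h₂, h₃⟩⟩⟩
    have htail : ∀ {r b x s F}, (r, b :: x, s, F) ∈ items → (r, x, s, F) ∈ items := by
      intro r b x s F h
      rw [hi] at h ⊢
      exact ⟨h.1.tail, h.2⟩
    cases h with
    | drop f r F k =>
      obtain ⟨h₁, h₂⟩ := hr _ _ hσ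
      exact key f r [] r F k h₁ h₂ ((mem_itemMoves hl hd ht hp).2 (.inl ⟨rfl, rfl, rfl⟩))
    | keep f r s b x F k hbF =>
      obtain ⟨h₁, h₂⟩ := hr _ _ hσ
      exact key f r x s F k (htail h₁) h₂
        ((mem_itemMoves hl hd ht hp).2 (.inr (.inl ⟨b, hbF, rfl⟩)))
    | pop f r t r' s b w x F F' k hw hrun hE =>
      obtain ⟨h₁, h₂⟩ := hr _ _ hσ
      exact key f r x s F k (htail h₁) h₂
        ((mem_itemMoves hl hd ht hp).2
          (.inr (.inr (.inl ⟨t, b, w, r', F', hw, hE, .inl ⟨hrun, rfl⟩⟩))))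
    | touch f r t r' s b w x F F' k hw hE =>
      obtain ⟨h₁, h₂⟩ := hr _ _ hσ
      exact key f r x s F k (htail h₁) h₂
        ((mem_itemMoves hl hd ht hp).2 (.inr (.inr (.inl ⟨t, b, w, r', F', hw, hE, .inr rfl⟩))))
    | read r s c F k =>
      obtain ⟨h₁, h₂⟩ := hr _ _ hσ
      exact key true r [] s F k h₁ h₂
        ((mem_itemMoves hl hd ht hp).2 (.inr (.inr (.inr ⟨rfl, rfl, c, rfl⟩))))

theorem mem_transitionList {moves : List (LabeledMove A Q)} {tags : List (MachineState A Q × ℕ)}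
    {t : ℕ × (FreeMonoid A × FreeMonoid A) × ℕ} :
    t ∈ transitionList moves tags ↔ ∃ σ u v σ', (σ, (u, v), σ') ∈ moves ∧ (σ, t.2.2) ∈ tags ∧
      (σ', t.1) ∈ tags ∧ t.2.1 = (FreeMonoid.ofList u, FreeMonoid.ofList v) := by
  simp only [transitionList, List.mem_flatMap, List.mem_ite_nil_right, List.mem_singleton,
    Bool.and_eq_true, decide_eq_true_eq]
  constructor
  · rintro ⟨⟨σ, ⟨u, v⟩, σ'⟩, h, ⟨_, i⟩, hi, ⟨_, j⟩, hj, ⟨rfl, rfl⟩, rfl⟩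
    exact ⟨_, u, v, _, h, hi, hj, rfl⟩
  · rintro ⟨σ, u, v, σ', h, hi, hj, ht⟩
    exact ⟨_, h, _, hi, _, hj, ⟨rfl, rfl⟩, Prod.ext rfl (Prod.ext ht rfl)⟩

theorem mem_numbersOf {σ : MachineState A Q} {tags : List (MachineState A Q × ℕ)} {j : ℕ} :
    j ∈ numbersOf σ tags ↔ (σ, j) ∈ tags := by
  simp only [numbersOf, List.mem_map, List.mem_filter, decide_eq_true_eq]
  constructor
  · rintro ⟨⟨_, j⟩, ⟨h, rfl⟩, rfl⟩
    exact h
  · exact fun h => ⟨_, ⟨h, rfl⟩, rfl⟩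

end Correctness

end PushdownSystem

/-! ### The construction of the transducer takes polynomial time -/

section PolyTime

variable {ι : Type} {X α : ι → Type} [∀ i, TreeEncoding (X i)] [∀ i, TreeEncoding (α i)]
  {W : ∀ i, X i → ℕ}

namespace PolyTimeIn

theorem singleton {a : ∀ i, X i → α i} (ha : PolyTimeIn W a) :
    PolyTimeIn W (fun i x => [a i x]) := ha.cons (nil ha.encSize_arg)

theorem tails {l : ∀ i, X i → List (α i)} (hl : PolyTimeIn W l) :
    PolyTimeIn W (fun i x => (l i x).tails) := by
  have hX := hl.encSize_arg
  have hL := hl.encSize_val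
  have hb : PolyTimeIn W (fun i (_ : X i) => (([] : List (α i)), [([] : List (α i))])) :=
    (nil hX).prodMk (nil hX).singleton
  have hy := PolyTime.id (X := fun i => (X i × (List (α i) × List (List (α i)))) × α i)
  have hc := hy.snd.cons hy.fst.snd.fst
  have h := foldr (B := fun i => List (α i) × List (List (α i)))
    (f := fun i (_ : X i) a s => (a :: s.1, (a :: s.1) :: s.2)) hl hb
    (hc.prodMk (hc.cons hy.fst.snd.snd))
    (((hL.add (.const 1)).mul (hL.add (.const 1))).add (hL.add (.const 2))) (by
      intro i x l₁ l₂ h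
      rw [List.foldr_tails]
      have h₁ : encSize l₂ ≤ encSize (l i x) := by
        rw [h]; exact encSize_of_sublist (List.sublist_append_right _ _)
      have h₂ := encSize_list_le (l := l₂.tails) (M := encSize (l i x)) fun y hy =>
        (encSize_of_sublist ((List.mem_tails _ _).1 hy).sublist).trans h₁
      rw [List.length_tails] at h₂
      have h₃ := (length_le_encSize l₂).trans h₁
      have h₄ : (l₂.length + 1) * (encSize (l i x) + 1) ≤
          (encSize (l i x) + 1) * (encSize (l i x) + 1) := Nat.mul_le_mul_right _ (by omega)
      simp only [encSize_prod]
      omega)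
  exact h.snd.congr fun i x => by rw [List.foldr_tails]

/-- Folding over a list of units and prepending the current length counts upwards. The numbers
obtained have the same encodings as the elements of `Fin`. -/
theorem finRange {k : ι → ℕ} (hk : PolyTimeIn W (fun i (_ : X i) => k i)) :
    PolyTimeIn W (fun i (_ : X i) => List.finRange (k i)) := by
  have e : ∀ l : List Unit, l.foldr (fun _ (acc : List ℕ) => acc.length :: acc) [] =
      (List.range l.length).reverse := by
    intro l
    induction l with
    | nil => rfl
    | cons a l ih => rw [List.foldr_cons, ih, List.length_cons, List.range_succ]; simp
  have hK := hk.encSize_val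
  have h := foldr (B := fun _ => List ℕ) (f := fun _ _ _ acc => acc.length :: acc) hk.replicate
    (nil (α := fun _ => ℕ) hk.encSize_arg)
    ((PolyTime.id (X := fun i => (X i × List ℕ) × Unit)).fst.snd.length.cons PolyTime.id.fst.snd)
    ((hK.mul (hK.add (.const 1))).add (.const 1)) (by
      intro i x l₁ l₂ h
      have hlen : l₂.length ≤ k i := by
        have := congrArg List.length h
        simp only [List.length_replicate, List.length_append] at this
        omega
      rw [e]
      refine (encSize_list_le (M := encSize (k i)) fun a ha => ?_).trans ?_
      · simp only [List.mem_reverse, List.mem_range] at ha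
        simp only [encSize_nat]
        omega
      · simp only [List.length_reverse, List.length_range, encSize_nat]
        exact Nat.add_le_add_right (Nat.mul_le_mul_right _ (by omega)) 1)
  refine h.reverse.congr_enc fun i x => ?_
  rw [e, List.reverse_reverse, List.length_replicate, ← List.map_coe_finRange_eq_range]
  generalize List.finRange (k i) = l
  induction l with
  | nil => rfl
  | cons a l ih => rw [List.map_cons, enc_cons, ih]; rfl

theorem tagged {l : ∀ i, X i → List (α i)} (hl : PolyTimeIn W l) :
    PolyTimeIn W (fun i x => tagged (l i x)) := by
  have hL := hl.encSize_val
  have hy := PolyTime.id (X := fun i => (X i × List (α i × ℕ)) × α i)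
  exact foldr (B := fun i => List (α i × ℕ)) (f := fun i (_ : X i) a k => (a, k.length) :: k) hl
    (nil hl.encSize_arg) ((hy.snd.prodMk hy.fst.snd.length).cons hy.fst.snd)
    ((hL.mul (((hL.add ((PolyLE.const 2).mul hL)).add (.const 2)).add (.const 1))).add (.const 1))
    (by
      intro i x l₁ l₂ h
      change encSize (_root_.tagged l₂) ≤ _
      have h₁ : encSize l₂ ≤ encSize (l i x) := by
        rw [h]; exact encSize_of_sublist (List.sublist_append_right _ _)
      have h₂ := (length_le_encSize l₂).trans h₁
      refine (encSize_list_le (M := encSize (l i x) + 2 * encSize (l i x) + 2) ?_).trans ?_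
      · rintro ⟨a, j⟩ ha
        rw [mem_tagged] at ha
        obtain ⟨hj, ha⟩ := List.getElem?_eq_some_iff.1 ha
        have h₃ : encSize a ≤ encSize l₂ :=
          encSize_le_of_mem (List.mem_reverse.1 (ha ▸ List.getElem_mem _))
        rw [List.length_reverse] at hj
        simp only [encSize_prod, encSize_nat]
        omega
      · rw [length_tagged]
        exact Nat.add_le_add_right (Nat.mul_le_mul_right _ h₂) 1)

/-- Prepending one letter `a` to all lists multiplies the total size by at most the size of `a` plus
2. Summed over the letters this gives a factor of at most twice the size of `l` per round, and the
slack in 3 absorbs the empty list. -/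
theorem encSize_listsUpTo_le {β : Type} [TreeEncoding β] (k : ℕ) (l : List β) :
    encSize (listsUpTo k l) ≤ (2 * encSize l + 3) ^ (k + 1) := by
  have hmap : ∀ (a : β) (L : List (List β)),
      encSize (L.map fun x => a :: x) ≤ encSize L * (encSize a + 2) := by
    intro a L
    induction L with
    | nil => simp
    | cons x L ih =>
      simp only [List.map_cons, encSize_cons, Nat.add_mul] at ih ⊢
      have : encSize x * 2 ≤ encSize x * (encSize a + 2) := Nat.mul_le_mul_left _ (by omega)
      have := encSize_pos x
      nlinarith [Nat.zero_le (encSize x * encSize a)]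
  have hflat : ∀ (l : List β) (L : List (List β)),
      encSize (l.flatMap fun a => L.map fun x => a :: x) ≤ encSize L * (2 * encSize l) := by
    intro l L
    induction l with
    | nil =>
      have := encSize_pos L
      simp only [List.flatMap_nil, encSize_nil]; omega
    | cons a l ih =>
      have h₁ := encSize_append (L.map fun x => a :: x)
        (l.flatMap fun a => L.map fun x => a :: x)
      have h₂ := hmap a L
      have h₃ := encSize_pos a
      rw [List.flatMap_cons]
      simp only [encSize_cons]
      nlinarith [encSize_pos L, Nat.zero_le (encSize L * encSize a)]
  induction k with
  | zero =>
    change 3 ≤ _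
    have := encSize_pos l
    simp only [Nat.zero_add, pow_one]; omega
  | succ k ih =>
    have e : listsUpTo (k + 1) l =
        [] :: l.flatMap fun a => (listsUpTo k l).map fun x => a :: x := by
      rw [listsUpTo, Function.iterate_succ_apply']; rfl
    rw [e, pow_succ]
    have h₁ := hflat l (listsUpTo k l)
    have h₂ := encSize_pos (listsUpTo k l)
    simp only [encSize_cons, encSize_nil]
    calc 1 + encSize (l.flatMap fun a => (listsUpTo k l).map fun x => a :: x) + 1
        ≤ encSize (listsUpTo k l) * (2 * encSize l + 3) := by
          rw [Nat.mul_add]; omega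
      _ ≤ _ := Nat.mul_le_mul_right _ ih

/-- The result is exponential in `k`, so this is not polynomial in the input. It is polynomial in
any weight that dominates the input and the bound on the result. -/
theorem listsUpTo {k : ∀ i, X i → ℕ} {l : ∀ i, X i → List (α i)} (hk : PolyTimeIn W k)
    (hl : PolyTimeIn W l) (h : PolyLE (fun i x => (2 * encSize (l i x) + 3) ^ (k i x + 1)) W) :
    PolyTimeIn W (fun i x => listsUpTo (k i x) (l i x)) := by
  have hy := PolyTime.id (X := fun i => (List (α i) × List (List (α i))))
  have hz := PolyTime.id (X := fun i => ((List (α i) × List (List (α i))) × α i) × List (α i))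
  have hstep : PolyTime (fun i (y : List (α i) × List (List (α i))) =>
      ([] : List (α i)) :: y.1.flatMap fun a => y.2.map fun x => a :: x) :=
    (nil (.of_le fun _ _ => le_rfl)).cons (hy.fst.flatMap
      (f := fun i y a => y.2.map fun x => a :: x)
      ((PolyTime.id (X := fun i => (List (α i) × List (List (α i))) × α i)).fst.snd.map
        (f := fun i y x => y.2 :: x) (hz.fst.snd.cons hz.snd)))
  -- The enumeration is analysed on pairs of a length and a list with a weight of their own. The
  -- composition at the end is done by hand, as `comp` would require time polynomial in the size of
  -- such a pair.
  have hlist : PolyTimeIn (fun i (y : ℕ × List (α i)) => encSize y +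
      (2 * encSize y.2 + 3) ^ (y.1 + 1)) (fun i (y : ℕ × List (α i)) => _root_.listsUpTo y.1 y.2) := by
    have hid : PolyTimeIn (fun i (y : ℕ × List (α i)) => encSize y +
      (2 * encSize y.2 + 3) ^ (y.1 + 1)) (fun i (y : ℕ × List (α i)) => y) :=
      id_of_le (.of_le fun _ _ => Nat.le_add_right _ _)
    have hx : PolyTime (fun i (y : (ℕ × List (α i)) × List (List (α i))) =>
        ([] : List (α i)) :: y.1.2.flatMap fun a => y.2.map fun x => a :: x) :=
      comp (f := fun i (y : (ℕ × List (α i)) × List (List (α i))) => (y.1.2, y.2)) hstep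
        (PolyTime.id.fst.snd.prodMk PolyTime.id.snd)
    refine iterate (B := fun i => List (List (α i)))
      (f := fun i y L => [] :: y.2.flatMap fun a => L.map fun x => a :: x) hid.fst
      (nil hid.encSize_arg).singleton hx
      (V := fun i (y : ℕ × List (α i)) => (2 * encSize y.2 + 3) ^ (y.1 + 1))
      (.of_le fun _ _ => Nat.le_add_left _ _) fun i y j hj => ?_
    exact (encSize_listsUpTo_le j y.2).trans (Nat.pow_le_pow_right (by omega) (by omega))
  have hp := hk.prodMk hl
  have hs := hp.encSize_val.add h
  obtain ⟨c, V, ⟨b, hb⟩, hc⟩ := hlist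
  obtain ⟨d, V', hV', hd⟩ := hp
  refine ⟨.seq d c, _, (hl.encSize_arg.add hV').add (hs.eval b), fun i x => ?_⟩
  obtain ⟨t, ht, htV⟩ := hd i x
  obtain ⟨s, hs, hsV⟩ := hc i (k i x, l i x)
  exact ⟨_, Runs.seq _ _ _ _ _ _ _ ht hs,
    Nat.add_le_add (Nat.add_le_add le_rfl htV) (hsV.trans (hb i _))⟩

end PolyTimeIn

end PolyTime

section PolyTime

variable {ι : Type}

/-! ### Each component of the construction is computed in polynomial time. -/

namespace PushdownSystem

section

variable {A Q : ι → Type} [∀ i, TreeEncoding (A i)] [∀ i, TreeEncoding (Q i)]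

/-- The definition is composed of operations under which polynomial time is preserved, and the proof
follows its syntax. The same holds for the other components that use no iteration. -/
theorem polyTime_itemWords : PolyTime (fun i (x : List (A i) ×
    List (Q i × A i × FreeMonoid (A i) × Q i)) => itemWords x.1 x.2) := by
  unfold itemWords
  repeat' with_reducible first
    | exact PolyTime.id
    | exact PolyTimeIn.nil (.of_le fun _ _ => le_rfl)
    | exact PolyTime.bool_true
    | exact PolyTime.bool_false
    | apply PolyTimeIn.append
    | apply PolyTimeIn.flatMap
    | apply PolyTimeIn.filter
    | apply PolyTimeIn.map
    | apply PolyTimeIn.any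
    | apply PolyTimeIn.all
    | apply PolyTimeIn.ite
    | apply PolyTimeIn.and
    | apply PolyTimeIn.or
    | apply PolyTimeIn.not
    | apply PolyTimeIn.memb
    | apply PolyTimeIn.eq
    | apply PolyTimeIn.cons
    | apply PolyTimeIn.reverse
    | apply PolyTimeIn.tails
    | apply PolyTimeIn.freeMonoid_ofList
    | apply PolyTimeIn.freeMonoid_toList
    | apply PolyTimeIn.fst
    | apply PolyTimeIn.snd

theorem polyTime_popCandidates : PolyTime (fun i (x : List (Q i) × List (List (A i))) =>
    popCandidates x.1 x.2) := by
  unfold popCandidates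
  repeat' with_reducible first
    | exact PolyTime.id
    | exact PolyTimeIn.nil (.of_le fun _ _ => le_rfl)
    | exact PolyTime.bool_true
    | exact PolyTime.bool_false
    | apply PolyTimeIn.append
    | apply PolyTimeIn.flatMap
    | apply PolyTimeIn.filter
    | apply PolyTimeIn.map
    | apply PolyTimeIn.any
    | apply PolyTimeIn.all
    | apply PolyTimeIn.ite
    | apply PolyTimeIn.and
    | apply PolyTimeIn.or
    | apply PolyTimeIn.not
    | apply PolyTimeIn.memb
    | apply PolyTimeIn.eq
    | apply PolyTimeIn.cons
    | apply PolyTimeIn.reverse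
    | apply PolyTimeIn.tails
    | apply PolyTimeIn.freeMonoid_ofList
    | apply PolyTimeIn.freeMonoid_toList
    | apply PolyTimeIn.fst
    | apply PolyTimeIn.snd
    | apply PolyTimeIn.prodMk

theorem polyTime_itemList : PolyTime (fun i (x : List (Q i) × List (List (A i)) ×
    List (List (A i))) => itemList x.1 x.2.1 x.2.2) := by
  unfold itemList
  repeat' with_reducible first
    | exact PolyTime.id
    | exact PolyTimeIn.nil (.of_le fun _ _ => le_rfl)
    | exact PolyTime.bool_true
    | exact PolyTime.bool_false
    | apply PolyTimeIn.append
    | apply PolyTimeIn.flatMap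
    | apply PolyTimeIn.filter
    | apply PolyTimeIn.map
    | apply PolyTimeIn.any
    | apply PolyTimeIn.all
    | apply PolyTimeIn.ite
    | apply PolyTimeIn.and
    | apply PolyTimeIn.or
    | apply PolyTimeIn.not
    | apply PolyTimeIn.memb
    | apply PolyTimeIn.eq
    | apply PolyTimeIn.cons
    | apply PolyTimeIn.reverse
    | apply PolyTimeIn.tails
    | apply PolyTimeIn.freeMonoid_ofList
    | apply PolyTimeIn.freeMonoid_toList
    | apply PolyTimeIn.fst
    | apply PolyTimeIn.snd
    | apply PolyTimeIn.prodMk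

theorem polyTime_stateList : PolyTime (fun i (x : List (List (Item (A i) (Q i)))) =>
    stateList x) := by
  unfold stateList
  repeat' with_reducible first
    | exact PolyTime.id
    | exact PolyTimeIn.nil (.of_le fun _ _ => le_rfl)
    | exact PolyTime.bool_true
    | exact PolyTime.bool_false
    | apply PolyTimeIn.append
    | apply PolyTimeIn.flatMap
    | apply PolyTimeIn.filter
    | apply PolyTimeIn.map
    | apply PolyTimeIn.any
    | apply PolyTimeIn.all
    | apply PolyTimeIn.ite
    | apply PolyTimeIn.and
    | apply PolyTimeIn.or
    | apply PolyTimeIn.not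
    | apply PolyTimeIn.memb
    | apply PolyTimeIn.eq
    | apply PolyTimeIn.cons
    | apply PolyTimeIn.reverse
    | apply PolyTimeIn.tails
    | apply PolyTimeIn.freeMonoid_ofList
    | apply PolyTimeIn.freeMonoid_toList
    | apply PolyTimeIn.fst
    | apply PolyTimeIn.snd
    | apply PolyTimeIn.prodMk

end

variable {A Q : ι → Type} [∀ i, TreeEncoding (A i)] [∀ i, TreeEncoding (Q i)]
  [∀ i, InjEncoding (A i)] [∀ i, InjEncoding (Q i)] [∀ i, DecidableEq (A i)]
  [∀ i, DecidableEq (Q i)]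

theorem polyTime_popTest : PolyTime (fun i (x : List (List (A i)) ×
    List (Q i × A i × FreeMonoid (A i) × Q i) × List (Q i × List (A i) × Q i) ×
    (Q i × List (A i) × Q i)) => popTest x.1 x.2.1 x.2.2.1 x.2.2.2) := by
  unfold popTest
  repeat' with_reducible first
    | exact PolyTime.id
    | exact PolyTimeIn.nil (.of_le fun _ _ => le_rfl)
    | exact PolyTime.bool_true
    | exact PolyTime.bool_false
    | apply PolyTimeIn.append
    | apply PolyTimeIn.flatMap
    | apply PolyTimeIn.filter
    | apply PolyTimeIn.map
    | apply PolyTimeIn.any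
    | apply PolyTimeIn.all
    | apply PolyTimeIn.ite
    | apply PolyTimeIn.and
    | apply PolyTimeIn.or
    | apply PolyTimeIn.not
    | apply PolyTimeIn.memb
    | apply PolyTimeIn.eq
    | apply PolyTimeIn.cons
    | apply PolyTimeIn.reverse
    | apply PolyTimeIn.tails
    | apply PolyTimeIn.freeMonoid_ofList
    | apply PolyTimeIn.freeMonoid_toList
    | apply PolyTimeIn.fst
    | apply PolyTimeIn.snd
    | apply PolyTimeIn.prodMk

theorem polyTime_moveList : PolyTime (fun i (x : List (A i) × List (A i × A i) ×
    List (Q i × A i × FreeMonoid (A i) × Q i) × List (Q i × List (A i) × Q i) ×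
    List (Item (A i) (Q i)) × List (List (Item (A i) (Q i)))) =>
    moveList x.1 x.2.1 x.2.2.1 x.2.2.2.1 x.2.2.2.2.1 x.2.2.2.2.2) := by
  unfold moveList itemMoves extensions
  repeat' with_reducible first
    | exact PolyTime.id
    | exact PolyTimeIn.nil (.of_le fun _ _ => le_rfl)
    | exact PolyTime.bool_true
    | exact PolyTime.bool_false
    | apply PolyTimeIn.append
    | apply PolyTimeIn.flatMap
    | apply PolyTimeIn.filter
    | apply PolyTimeIn.map
    | apply PolyTimeIn.any
    | apply PolyTimeIn.all
    | apply PolyTimeIn.ite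
    | apply PolyTimeIn.and
    | apply PolyTimeIn.or
    | apply PolyTimeIn.not
    | apply PolyTimeIn.memb
    | apply PolyTimeIn.eq
    | apply PolyTimeIn.cons
    | apply PolyTimeIn.reverse
    | apply PolyTimeIn.tails
    | apply PolyTimeIn.freeMonoid_ofList
    | apply PolyTimeIn.freeMonoid_toList
    | apply PolyTimeIn.fst
    | apply PolyTimeIn.snd
    | apply PolyTimeIn.prodMk

set_option synthInstance.maxSize 1000 in
theorem polyTime_transitionList : PolyTime (fun i (x : List (LabeledMove (A i) (Q i)) ×
    List (MachineState (A i) (Q i) × ℕ)) => transitionList x.1 x.2) := by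
  unfold transitionList
  repeat' with_reducible first
    | exact PolyTime.id
    | exact PolyTimeIn.nil (.of_le fun _ _ => le_rfl)
    | exact PolyTime.bool_true
    | exact PolyTime.bool_false
    | apply PolyTimeIn.append
    | apply PolyTimeIn.flatMap
    | apply PolyTimeIn.filter
    | apply PolyTimeIn.map
    | apply PolyTimeIn.any
    | apply PolyTimeIn.all
    | apply PolyTimeIn.ite
    | apply PolyTimeIn.and
    | apply PolyTimeIn.or
    | apply PolyTimeIn.not
    | apply PolyTimeIn.memb
    | apply PolyTimeIn.eq
    | apply PolyTimeIn.cons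
    | apply PolyTimeIn.reverse
    | apply PolyTimeIn.tails
    | apply PolyTimeIn.freeMonoid_ofList
    | apply PolyTimeIn.freeMonoid_toList
    | apply PolyTimeIn.fst
    | apply PolyTimeIn.snd
    | apply PolyTimeIn.prodMk

set_option synthInstance.maxSize 1000 in
theorem polyTime_numbersOf : PolyTime (fun i (x : MachineState (A i) (Q i) ×
    List (MachineState (A i) (Q i) × ℕ)) => numbersOf x.1 x.2) := by
  unfold numbersOf
  repeat' with_reducible first
    | exact PolyTime.id
    | exact PolyTimeIn.nil (.of_le fun _ _ => le_rfl)
    | exact PolyTime.bool_true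
    | exact PolyTime.bool_false
    | apply PolyTimeIn.append
    | apply PolyTimeIn.flatMap
    | apply PolyTimeIn.filter
    | apply PolyTimeIn.map
    | apply PolyTimeIn.any
    | apply PolyTimeIn.all
    | apply PolyTimeIn.ite
    | apply PolyTimeIn.and
    | apply PolyTimeIn.or
    | apply PolyTimeIn.not
    | apply PolyTimeIn.memb
    | apply PolyTimeIn.eq
    | apply PolyTimeIn.cons
    | apply PolyTimeIn.reverse
    | apply PolyTimeIn.tails
    | apply PolyTimeIn.freeMonoid_ofList
    | apply PolyTimeIn.freeMonoid_toList
    | apply PolyTimeIn.fst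
    | apply PolyTimeIn.snd

/-- All iterates are obtained by filtering the same list of candidates, which bounds their sizes. -/
theorem polyTime_popTable : PolyTime (fun i (x : List (Q i) × List (List (A i)) ×
    List (Q i × A i × FreeMonoid (A i) × Q i)) => popTable x.1 x.2.1 x.2.2) := by
  have hx := PolyTime.id (X := fun i => List (Q i) × List (List (A i)) ×
    List (Q i × A i × FreeMonoid (A i) × Q i))
  have hy := PolyTime.id (X := fun i => (List (Q i) × List (List (A i)) ×
    List (Q i × A i × FreeMonoid (A i) × Q i)) × List (Q i × List (A i) × Q i))
  have hz := PolyTime.id (X := fun i => ((List (Q i) × List (List (A i)) ×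
    List (Q i × A i × FreeMonoid (A i) × Q i)) × List (Q i × List (A i) × Q i)) ×
      (Q i × List (A i) × Q i))
  have hc := PolyTimeIn.comp polyTime_popCandidates (hx.fst.prodMk hx.snd.fst)
  have hc' := PolyTimeIn.comp hc hy.fst
  have ht := PolyTimeIn.comp polyTime_popTest (hz.fst.fst.snd.fst.prodMk
    (hz.fst.fst.snd.snd.prodMk (hz.fst.snd.prodMk hz.snd)))
  refine hc.length.iterate (B := fun i => List (Q i × List (A i) × Q i))
    (f := fun i x T => (popCandidates x.1 x.2.1).filter (popTest x.2.1 x.2.2 T))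
    (.nil (.of_le fun _ _ => le_rfl))
    (hc'.filter (f := fun i y c => popTest y.1.2.1 y.1.2.2 y.2 c) ht) hc.encSize_val
    fun i x j _ => ?_
  cases j with
  | zero => exact encSize_pos _
  | succ j =>
    rw [Function.iterate_succ_apply']
    exact encSize_of_sublist List.filter_sublist

theorem twinReps_sublist {A : Type} [DecidableEq A] (letters l : List A) (deps : List (A × A)) :
    (l.foldr (fun a R => if (R.any fun b => letters.all fun c =>
      decide (memb (a, c) deps = memb (b, c) deps)) = true then R else a :: R) []).Sublist l := by
  induction l with
  | nil => exact .slnil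
  | cons a l ih =>
    rw [List.foldr_cons]
    split_ifs
    · exact ih.cons a
    · exact ih.cons_cons a

theorem polyTime_twinReps : PolyTime (fun i (x : List (A i) × List (A i × A i)) =>
    twinReps x.1 x.2) := by
  have hx := PolyTime.id (X := fun i => List (A i) × List (A i × A i))
  refine hx.fst.foldr (B := fun i => List (A i))
    (f := fun i x a R => if (R.any fun b => x.1.all fun c =>
      decide (memb (a, c) x.2 = memb (b, c) x.2)) = true then R else a :: R)
    (.nil (.of_le fun _ _ => le_rfl)) ?_ hx.fst.encSize_val fun i x l₁ l₂ h => ?_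
  · repeat' with_reducible first
      | exact PolyTime.id
      | exact PolyTimeIn.nil (.of_le fun _ _ => le_rfl)
      | exact PolyTime.bool_true
      | exact PolyTime.bool_false
      | apply PolyTimeIn.append
      | apply PolyTimeIn.flatMap
      | apply PolyTimeIn.filter
      | apply PolyTimeIn.map
      | apply PolyTimeIn.any
      | apply PolyTimeIn.all
      | apply PolyTimeIn.ite
      | apply PolyTimeIn.and
      | apply PolyTimeIn.or
      | apply PolyTimeIn.not
      | apply PolyTimeIn.memb
      | apply PolyTimeIn.eq
      | apply PolyTimeIn.cons
      | apply PolyTimeIn.reverse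
      | apply PolyTimeIn.tails
      | apply PolyTimeIn.freeMonoid_ofList
      | apply PolyTimeIn.freeMonoid_toList
      | apply PolyTimeIn.fst
      | apply PolyTimeIn.snd
      | apply PolyTimeIn.prodMk
  · have h' : l₂.Sublist x.1 := by
      rw [show x.1 = l₁ ++ l₂ from h]
      exact List.sublist_append_right _ _
    exact encSize_of_sublist ((twinReps_sublist x.1 l₂ x.2).trans h')

end PushdownSystem

end PolyTime

/-! ### Bounds of the form `s ^ poly(K)` -/

section PowLE

variable {ι : Type} {s K : ι → ℕ} {V V' : ι → ℕ}

/-- `V` is bounded by a power of `s + 1` whose exponent is a polynomial in `K`. -/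
def PowLE (V s K : ι → ℕ) : Prop := ∃ G : Polynomial ℕ, ∀ i, V i ≤ (s i + 1) ^ G.eval (K i)

namespace PowLE

theorem mono (h : PowLE V s K) (h' : ∀ i, V' i ≤ V i) : PowLE V' s K := by
  obtain ⟨G, hG⟩ := h
  exact ⟨G, fun i => (h' i).trans (hG i)⟩

theorem base : PowLE s s K := ⟨1, fun i => by simp⟩

theorem mul (h : PowLE V s K) (h' : PowLE V' s K) : PowLE (fun i => V i * V' i) s K := by
  obtain ⟨G, hG⟩ := h
  obtain ⟨H, hH⟩ := h'
  exact ⟨G + H, fun i => by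
    rw [Polynomial.eval_add, pow_add]
    exact Nat.mul_le_mul (hG i) (hH i)⟩

/-- For `s` at least 1 the base `s + 1` is at least 2, so constants can be absorbed into the
exponent. -/
theorem const (hs : ∀ i, 1 ≤ s i) (c : ℕ) : PowLE (fun _ => c) s K :=
  ⟨Polynomial.C c, fun i => by
    rw [Polynomial.eval_C]
    exact Nat.lt_two_pow_self.le.trans (Nat.pow_le_pow_left (by have := hs i; omega) c)⟩

theorem add (hs : ∀ i, 1 ≤ s i) (h : PowLE V s K) (h' : PowLE V' s K) :
    PowLE (fun i => V i + V' i) s K := by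
  obtain ⟨G, hG⟩ := h
  obtain ⟨H, hH⟩ := h'
  -- The additional 1 in the exponent pays for the factor 2 of a sum of two powers.
  refine ⟨G + H + 1, fun i => ?_⟩
  have h₁ : (s i + 1) ^ G.eval (K i) ≤ (s i + 1) ^ (G.eval (K i) + H.eval (K i)) :=
    Nat.pow_le_pow_right (by omega) (by omega)
  have h₂ : (s i + 1) ^ H.eval (K i) ≤ (s i + 1) ^ (G.eval (K i) + H.eval (K i)) :=
    Nat.pow_le_pow_right (by omega) (by omega)
  have h₃ := Nat.mul_le_mul_left ((s i + 1) ^ (G.eval (K i) + H.eval (K i)))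
    (show 2 ≤ s i + 1 by have := hs i; omega)
  simp only [Polynomial.eval_add, Polynomial.eval_one, pow_succ]
  have := hG i
  have := hH i
  omega

theorem pow (h : PowLE V s K) (H : Polynomial ℕ) : PowLE (fun i => V i ^ H.eval (K i)) s K := by
  obtain ⟨G, hG⟩ := h
  exact ⟨G * H, fun i => by
    rw [Polynomial.eval_mul, pow_mul]
    exact Nat.pow_le_pow_left (hG i) _⟩

theorem eval (hs : ∀ i, 1 ≤ s i) (h : PowLE V s K) (p : Polynomial ℕ) :
    PowLE (fun i => p.eval (V i)) s K := by
  induction p using Polynomial.induction_on' with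
  | add p q hp hq => exact (add hs hp hq).mono fun i => by rw [Polynomial.eval_add]
  | monomial n a =>
    refine ((const hs a).mul (h.pow (Polynomial.C n))).mono fun i => ?_
    rw [Polynomial.eval_monomial, Polynomial.eval_C]

theorem of_polyLE {X : ι → Type} {V W : ∀ i, X i → ℕ} (hs : ∀ i, 1 ≤ s i) (h : PolyLE V W)
    {x : ∀ i, X i} (hW : PowLE (fun i => W i (x i)) s K) : PowLE (fun i => V i (x i)) s K := by
  obtain ⟨b, hb⟩ := h
  exact (hW.eval hs b).mono fun i => hb i (x i)

end PowLE

end PowLE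

theorem encSize_fin_le {n : ℕ} (a : Fin n) : encSize a ≤ 2 * n + 1 := by
  have := encSize_nat a.val
  have h : encSize a = encSize a.val := rfl
  have := a.isLt
  omega

theorem PolyTimeIn.succ {ι : Type} {X : ι → Type} [∀ i, TreeEncoding (X i)] {W : ∀ i, X i → ℕ}
    {k : ∀ i, X i → ℕ} (hk : PolyTimeIn W k) : PolyTimeIn W (fun i x => k i x + 1) :=
  ((const_of_enc_nil (y := fun _ _ => ()) hk.encSize_arg fun _ _ => rfl).prodMk hk).congr_enc
    fun _ _ => rfl

/-- Lists of elements in the range of a map that preserves encodings can be lifted. -/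
theorem exists_lift_list {α β : Type} [TreeEncoding α] [TreeEncoding β] (φ : β → α)
    (hφ : ∀ b, TreeEncoding.enc b = TreeEncoding.enc (φ b)) (L : List α)
    (hL : ∀ a ∈ L, a ∈ Set.range φ) :
    ∃ L' : List β, L'.map φ = L ∧ TreeEncoding.enc L' = TreeEncoding.enc L := by
  obtain ⟨L', rfl⟩ : L ∈ Set.range (List.map φ) := by rwa [Set.range_list_map]
  refine ⟨L', rfl, ?_⟩
  clear hL
  induction L' with
  | nil => rfl
  | cons b L' ih => rw [List.map_cons, enc_cons, enc_cons, ih, hφ]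

namespace PushdownSystem

/-! ### The instances of the problem -/

/-- A pushdown system over an initial segment of the natural numbers, together with two
states and listings of the dependence relation and of the transitions. -/
structure Instance : Type where
  n : ℕ
  m : ℕ
  D : DepAlphabet (Fin n)
  P : PushdownSystem (Fin n) (Fin m)
  p : Fin m
  q : Fin m
  deps : List (Fin n × Fin n)
  trans : List (Fin m × Fin n × FreeMonoid (Fin n) × Fin m)
  nodup_deps : deps.Nodup
  isListing_deps : IsListing deps {e | D.Dep e.1 e.2}
  nodup_trans : trans.Nodup
  isListing_trans : IsListing trans {t | t ∈ P.trans}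

namespace Instance

variable (i : Instance)

/-- The letters. -/
abbrev letters : List (Fin i.n) := List.finRange i.n

/-- The states. -/
abbrev states : List (Fin i.m) := List.finRange i.m

/-- The words of items. -/
abbrev words : List (List (Fin i.n)) := itemWords i.letters i.trans

/-- The lists of letters of items. -/
noncomputable abbrev lists : List (List (Fin i.n)) := listsUpTo i.D.twinIndex i.letters

/-- The items. -/
noncomputable abbrev items : List (Item (Fin i.n) (Fin i.m)) := itemList i.states i.words i.lists

/-- The stacks of items. -/
noncomputable abbrev remainders : List (List (Item (Fin i.n) (Fin i.m))) :=
  listsUpTo (i.D.twinIndex + 1) i.items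

/-- The moves of the machine between bounded states. -/
noncomputable abbrev moves : List (LabeledMove (Fin i.n) (Fin i.m)) :=
  moveList i.letters i.deps i.trans (popTable i.states i.words i.trans) i.items i.remainders

/-- The numbering of the bounded states. -/
noncomputable abbrev tags : List (MachineState (Fin i.n) (Fin i.m) × ℕ) :=
  tagged (stateList i.remainders)

/-- The transducer that is constructed. -/
noncomputable abbrev output : ℕ × ℕ × List ℕ ×
    List (ℕ × (FreeMonoid (Fin i.n) × FreeMonoid (Fin i.n)) × ℕ) × List ℕ :=
  (i.n, (stateList i.remainders).length, numbersOf (false, []) i.tags,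
    transitionList i.moves i.tags, numbersOf (true, [(i.p, [], i.q, [])]) i.tags)

/-- The data of the instance. -/
abbrev data : ℕ × List (Fin i.n × Fin i.n) × ℕ ×
    List (Fin i.m × Fin i.n × FreeMonoid (Fin i.n) × Fin i.m) × Fin i.m × Fin i.m :=
  (i.n, i.deps, i.m, i.trans, i.p, i.q)

/-- The type whose only element stands for the data of the instance. -/
inductive Input (i : Instance) : Type
  | mk : Input i

instance instTreeEncodingInput : TreeEncoding i.Input := ⟨fun _ => TreeEncoding.enc i.data⟩

/-- A bound for the sizes of all objects of the construction. -/
noncomputable def weight : ℕ :=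
  encSize i.data + (2 * encSize i.letters + 3) ^ (i.D.twinIndex + 1) +
  (2 * encSize i.items + 3) ^ (i.D.twinIndex + 1 + 1)

/-- The instance serves as the index of the family, since the types of letters and states vary with
it. The program is the same for all instances and sees only the encoded data. -/
theorem polyTime_output : PolyTimeIn (fun i (_ : Input i) => i.weight) (fun i _ => i.output) := by
  have hX : PolyLE (fun i (x : Input i) => encSize x) (fun i _ => i.weight) :=
    .of_le fun i _ => show encSize i.data ≤ i.weight by unfold weight; omega
  have hid := PolyTimeIn.id_of_le hX
  have hdata : PolyTimeIn (fun i (_ : Input i) => i.weight) (fun i _ => i.data) :=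
    hid.congr_enc fun _ _ => rfl
  have hn : PolyTimeIn (fun i (_ : Input i) => i.weight) (fun i _ => i.n) := hdata.fst
  have hdeps := hdata.snd.fst
  have hm : PolyTimeIn (fun i (_ : Input i) => i.weight) (fun i _ => i.m) := hdata.snd.snd.fst
  have htrans := hdata.snd.snd.snd.fst
  have hp := hdata.snd.snd.snd.snd.fst
  have hq := hdata.snd.snd.snd.snd.snd
  have hletters := PolyTimeIn.finRange hn
  have hstates := PolyTimeIn.finRange hm
  have hwords := PolyTimeIn.comp polyTime_itemWords (hletters.prodMk htrans)
  have hpop := PolyTimeIn.comp polyTime_popTable (hstates.prodMk (hwords.prodMk htrans))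
  -- The twin index is computed as the number of representatives of twin classes found in the
  -- listing.
  have hK : PolyTimeIn (fun i (_ : Input i) => i.weight) (fun i _ => i.D.twinIndex) :=
    (PolyTimeIn.comp polyTime_twinReps (hletters.prodMk hdeps)).length.congr fun i _ =>
      length_twinReps (List.mem_finRange) fun a b => i.isListing_deps (a, b)
  have hlists := PolyTimeIn.listsUpTo hK hletters
    (.of_le fun i _ => show (2 * encSize i.letters + 3) ^ (i.D.twinIndex + 1) ≤ i.weight by
      unfold weight; omega)
  have hitems := PolyTimeIn.comp polyTime_itemList (hstates.prodMk (hwords.prodMk hlists))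
  have hrem := PolyTimeIn.listsUpTo hK.succ hitems
    (.of_le fun i _ => show (2 * encSize i.items + 3) ^ (i.D.twinIndex + 1 + 1) ≤ i.weight by
      unfold weight; omega)
  have hmoves := PolyTimeIn.comp polyTime_moveList (hletters.prodMk (hdeps.prodMk
    (htrans.prodMk (hpop.prodMk (hitems.prodMk hrem)))))
  have hslist := PolyTimeIn.comp polyTime_stateList hrem
  have htags := hslist.tagged
  have hnil := PolyTimeIn.nil (α := fun i : Instance => Fin i.n) hX
  have hfin : PolyTimeIn (fun i (_ : Input i) => i.weight) (fun i _ =>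
      ((true, [(i.p, [], i.q, [])]) : MachineState (Fin i.n) (Fin i.m))) :=
    (PolyTimeIn.of_polyTime PolyTime.bool_true hX).prodMk
      (hp.prodMk (hnil.prodMk (hq.prodMk hnil))).singleton
  have hini : PolyTimeIn (fun i (_ : Input i) => i.weight) (fun i _ =>
      ((false, []) : MachineState (Fin i.n) (Fin i.m))) :=
    (PolyTimeIn.of_polyTime PolyTime.bool_false hX).prodMk (.nil hX)
  have h₁ := PolyTimeIn.comp polyTime_numbersOf (hini.prodMk htags)
  have h₂ := PolyTimeIn.comp polyTime_transitionList (hmoves.prodMk htags)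
  have h₃ := PolyTimeIn.comp polyTime_numbersOf (hfin.prodMk htags)
  exact hn.prodMk (hslist.length.prodMk (h₁.prodMk (h₂.prodMk h₃)))

/-! ### Bounds in terms of the size of the pushdown system and the twin index. -/

theorem one_le_size : 1 ≤ i.P.size := by
  have := i.p.pos
  simp only [PushdownSystem.size, Fintype.card_fin]
  omega

theorem n_le_size : i.n ≤ i.P.size := by
  simp only [PushdownSystem.size, Fintype.card_fin]
  omega

theorem m_le_size : i.m ≤ i.P.size := by
  simp only [PushdownSystem.size, Fintype.card_fin]
  omega

/-- The size of the system counts transitions once; only because the listing has no repetitions is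
its length controlled by it. -/
theorem length_trans_le : i.trans.length ≤ i.P.size := by
  classical
  have h : i.trans.toFinset = i.P.trans := Finset.ext fun t => by
    rw [List.mem_toFinset]; exact i.isListing_trans t
  rw [← List.toFinset_card_of_nodup i.nodup_trans, h, PushdownSystem.size]
  exact (Nat.le_mul_of_pos_left _ (Nat.succ_pos _)).trans (Nat.le_add_left _ _)

theorem length_word_le {t : Fin i.m × Fin i.n × FreeMonoid (Fin i.n) × Fin i.m}
    (ht : t ∈ i.trans) : t.2.2.1.length ≤ i.P.size := by
  have ht' : t ∈ i.P.trans := (i.isListing_trans t).1 ht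
  have h₁ := Finset.le_sup (f := fun t => t.2.2.1.length) ht'
  have h₂ := Nat.le_mul_of_pos_right (i.P.trans.sup (fun t => t.2.2.1.length) + 1)
    (Finset.card_pos.2 ⟨t, ht'⟩)
  rw [PushdownSystem.size]
  omega

theorem encSize_letters_le : encSize i.letters ≤ i.P.size * (2 * i.P.size + 2) + 1 := by
  have h := encSize_list_le (l := i.letters) (M := 2 * i.P.size + 1) fun a _ =>
    (encSize_fin_le a).trans (by have := i.n_le_size; omega)
  rw [List.length_finRange] at h
  exact h.trans (Nat.succ_le_succ (Nat.mul_le_mul_right _ i.n_le_size))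

theorem encSize_states_le : encSize i.states ≤ i.P.size * (2 * i.P.size + 2) + 1 := by
  have h := encSize_list_le (l := i.states) (M := 2 * i.P.size + 1) fun a _ =>
    (encSize_fin_le a).trans (by have := i.m_le_size; omega)
  rw [List.length_finRange] at h
  exact h.trans (Nat.succ_le_succ (Nat.mul_le_mul_right _ i.m_le_size))

theorem encSize_deps_le :
    encSize i.deps ≤ i.P.size * i.P.size * (4 * i.P.size + 4) + 1 := by
  have h := encSize_list_le (l := i.deps) (M := 4 * i.P.size + 3) fun a _ => by
    have h₁ := encSize_fin_le a.1
    have h₂ := encSize_fin_le a.2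
    have h₃ := i.n_le_size
    rw [encSize_prod]
    omega
  have h' := i.nodup_deps.length_le_card
  rw [Fintype.card_prod, Fintype.card_fin] at h'
  exact h.trans (Nat.succ_le_succ (Nat.mul_le_mul_right _
    (h'.trans (Nat.mul_le_mul i.n_le_size i.n_le_size))))

theorem encSize_trans_le : encSize i.trans ≤
    i.P.size * (6 * i.P.size + 8 + i.P.size * (2 * i.P.size + 2)) + 1 := by
  have h := encSize_list_le (l := i.trans)
    (M := 6 * i.P.size + 7 + i.P.size * (2 * i.P.size + 2)) fun t ht => by
      have h₁ := encSize_fin_le t.1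
      have h₂ := encSize_fin_le t.2.1
      have h₃ := encSize_fin_le t.2.2.2
      have h₄ := i.n_le_size
      have h₅ := i.m_le_size
      have h₆ : encSize t.2.2.1 ≤ t.2.2.1.toList.length * (2 * i.P.size + 2) + 1 :=
        encSize_list_le (l := t.2.2.1.toList) fun a _ =>
          (encSize_fin_le a).trans (by have := i.n_le_size; omega)
      have h₇ : t.2.2.1.toList.length * (2 * i.P.size + 2) ≤ i.P.size * (2 * i.P.size + 2) :=
        Nat.mul_le_mul_right _ (i.length_word_le ht)
      simp only [encSize_prod]
      omega
  exact h.trans (Nat.succ_le_succ (Nat.mul_le_mul i.length_trans_le (by omega)))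

/-- The data of the instance are polynomial in the size of the system. The twin index enters the
exponent twice, through the lists of letters in items and through the stacks of items; nesting the
two powers keeps the exponent polynomial. -/
theorem powLE_weight : PowLE weight (fun i => i.P.size) (fun i => i.D.twinIndex) := by
  have hs := one_le_size
  have hb : PowLE (fun i : Instance => i.P.size) (fun i => i.P.size) (fun i => i.D.twinIndex) :=
    .base
  have hc : ∀ c : ℕ, PowLE (fun _ : Instance => c) (fun i => i.P.size) (fun i => i.D.twinIndex) :=
    .const hs
  have hlin := PowLE.add hs ((hc 2).mul hb) (hc 2)
  have hrange := PowLE.add hs (hb.mul hlin) (hc 1)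
  have hletters := hrange.mono encSize_letters_le
  have hstates := hrange.mono encSize_states_le
  have hdeps := (PowLE.add hs ((hb.mul hb).mul (PowLE.add hs ((hc 4).mul hb) (hc 4))) (hc 1)).mono
    encSize_deps_le
  have htrans := (PowLE.add hs (hb.mul (PowLE.add hs (PowLE.add hs ((hc 6).mul hb) (hc 8))
    (hb.mul hlin))) (hc 1)).mono encSize_trans_le
  have hfin := PowLE.add hs ((hc 2).mul hb) (hc 1)
  have hdata : PowLE (fun i : Instance => encSize i.data) (fun i => i.P.size)
      (fun i => i.D.twinIndex) := by
    refine (PowLE.add hs (PowLE.add hs (PowLE.add hs hdeps htrans) ((hc 8).mul hb))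
      (hc 9)).mono fun i => ?_
    have h₁ := encSize_fin_le i.p
    have h₂ := encSize_fin_le i.q
    have h₃ := i.n_le_size
    have h₄ := i.m_le_size
    simp only [encSize_prod, encSize_nat]
    omega
  have hpow : PowLE (fun i : Instance => (2 * encSize i.letters + 3) ^ (i.D.twinIndex + 1))
      (fun i => i.P.size) (fun i => i.D.twinIndex) :=
    ((PowLE.add hs ((hc 2).mul hletters) (hc 3)).pow (Polynomial.X + 1)).mono fun i => by simp
  have hwords : PowLE (fun i : Instance => encSize i.words) (fun i => i.P.size)
      (fun i => i.D.twinIndex) :=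
    .of_polyLE (x := fun i : Instance => (i.letters, i.trans)) hs polyTime_itemWords.encSize_val
      ((PowLE.add hs (PowLE.add hs hletters htrans) (hc 1)).mono fun i => by
        simp only [encSize_prod]; omega)
  have hlists : PowLE (fun i : Instance => encSize i.lists) (fun i => i.P.size)
      (fun i => i.D.twinIndex) :=
    hpow.mono fun i => PolyTimeIn.encSize_listsUpTo_le i.D.twinIndex i.letters
  have hitems : PowLE (fun i : Instance => encSize i.items) (fun i => i.P.size)
      (fun i => i.D.twinIndex) :=
    .of_polyLE (x := fun i : Instance => (i.states, i.words, i.lists)) hs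
      polyTime_itemList.encSize_val
      ((PowLE.add hs (PowLE.add hs hstates (PowLE.add hs hwords hlists)) (hc 2)).mono fun i => by
        simp only [encSize_prod]; omega)
  exact PowLE.add hs (PowLE.add hs hdata hpow)
    (((PowLE.add hs ((hc 2).mul hitems) (hc 3)).pow (Polynomial.X + 1 + 1)).mono fun i => by simp)

/-! ### The computed lists encode the transducer of the machine. -/

/-- The bounded states of the machine, by their numbers. -/
noncomputable def state (j : Fin (stateList i.remainders).length) :
    MachineState (Fin i.n) (Fin i.m) :=
  -- Tags count the subsequent entries, so numbers refer to positions in the reversed list.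
  (stateList i.remainders).reverse[j.val]'(by rw [List.length_reverse]; exact j.isLt)

theorem mem_tags {σ : MachineState (Fin i.n) (Fin i.m)}
    (j : Fin (stateList i.remainders).length) : (σ, j.val) ∈ i.tags ↔ i.state j = σ := by
  rw [mem_tagged, List.getElem?_eq_some_iff]
  exact ⟨fun ⟨_, h⟩ => h, fun h => ⟨_, h⟩⟩

theorem lt_of_mem_tags {σ : MachineState (Fin i.n) (Fin i.m)} {j : ℕ} (h : (σ, j) ∈ i.tags) :
    j < (stateList i.remainders).length := by
  rw [mem_tagged, List.getElem?_eq_some_iff] at h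
  obtain ⟨h, -⟩ := h
  rwa [List.length_reverse] at h

theorem mem_deps (a b : Fin i.n) : (a, b) ∈ i.deps ↔ i.D.Dep a b := i.isListing_deps (a, b)

theorem mem_trans (t : Fin i.m × Fin i.n × FreeMonoid (Fin i.n) × Fin i.m) :
    t ∈ i.trans ↔ t ∈ i.P.trans := i.isListing_trans t

theorem mem_words {x : List (Fin i.n)} : x ∈ i.words ↔ i.P.ItemWord x :=
  mem_itemWords List.mem_finRange i.mem_trans

theorem mem_items (x : Item (Fin i.n) (Fin i.m)) :
    x ∈ i.items ↔ i.P.ItemWord x.2.1 ∧ x.2.2.2.length ≤ i.D.twinIndex := by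
  rw [items, mem_itemList List.mem_finRange, mem_words, mem_listsUpTo]
  simp

theorem boundedStates_subset : i.P.boundedStates i.D ⊆ Set.range i.state := by
  rintro σ ⟨h₁, h₂⟩
  have h : σ ∈ (stateList i.remainders).reverse :=
    List.mem_reverse.2 (mem_stateList.2
      (mem_listsUpTo.2 ⟨h₁, fun x hx => (i.mem_items x).2 (h₂ x hx)⟩))
  obtain ⟨j, hj, rfl⟩ := List.getElem_of_mem h
  exact ⟨⟨j, by rwa [List.length_reverse] at hj⟩, rfl⟩

theorem mem_moves {σ σ' : MachineState (Fin i.n) (Fin i.m)} {l : List (Fin i.n) × List (Fin i.n)}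
    (hσ : σ.2 ∈ i.remainders) : (σ, l, σ') ∈ i.moves ↔ i.P.Move i.D σ l σ' := by
  refine mem_moveList List.mem_finRange i.mem_deps i.mem_trans
    (fun r x s => mem_popTable List.mem_finRange i.mem_trans fun _ => i.mem_words) i.mem_items
    (fun x k hk => ?_) hσ
  obtain ⟨h₁, h₂⟩ := mem_listsUpTo.1 hk
  rw [List.length_cons] at h₁
  exact ⟨h₂ x (by simp), mem_listsUpTo.2 ⟨by omega, fun y hy => h₂ y (List.mem_cons_of_mem _ hy)⟩⟩

theorem state_mem_remainders (j : Fin (stateList i.remainders).length) :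
    (i.state j).2 ∈ i.remainders :=
  mem_stateList.1 (List.mem_reverse.1 (List.getElem_mem _))

/-- The program handles state numbers as natural numbers, while a transducer has states in `Fin k`.
Lifting the list does not change its encoding. A machine state that is listed repeatedly has several
numbers, and all of them are collected. -/
theorem exists_numbers (σ : MachineState (Fin i.n) (Fin i.m)) :
    ∃ L : List (Fin (stateList i.remainders).length), IsListing L {j | i.state j = σ} ∧
      TreeEncoding.enc L = TreeEncoding.enc (numbersOf σ i.tags) := by
  obtain ⟨L, hL, he⟩ := exists_lift_list (Fin.val : Fin (stateList i.remainders).length → ℕ)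
    (fun _ => rfl) (numbersOf σ i.tags) fun j hj =>
      ⟨⟨j, i.lt_of_mem_tags (mem_numbersOf.1 hj)⟩, rfl⟩
  refine ⟨L, fun j => ?_, he⟩
  rw [← List.mem_map_of_injective Fin.val_injective, hL, mem_numbersOf, mem_tags]
  rfl

theorem encodesTransducer :
    EncodesTransducer (i.P.machineTransducer i.D i.state i.p i.q) (TreeEncoding.enc i.output) := by
  obtain ⟨L₁, h₁, e₁⟩ := i.exists_numbers (false, [])
  obtain ⟨L₂, h₂, e₂⟩ := i.exists_numbers (true, [(i.p, [], i.q, [])])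
  let φ : Fin (stateList i.remainders).length × (FreeMonoid (Fin i.n) × FreeMonoid (Fin i.n)) ×
      Fin (stateList i.remainders).length →
      ℕ × (FreeMonoid (Fin i.n) × FreeMonoid (Fin i.n)) × ℕ :=
    fun t => (t.1.val, t.2.1, t.2.2.val)
  have hφ : Function.Injective φ := by
    rintro ⟨a, l, b⟩ ⟨a', l', b'⟩ h
    simp only [φ, Prod.mk.injEq, Fin.val_inj] at h
    obtain ⟨rfl, rfl, rfl⟩ := h
    rfl
  obtain ⟨L, hL, e⟩ := exists_lift_list φ (fun _ => rfl) (transitionList i.moves i.tags) (by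
    rintro ⟨a, l, b⟩ h
    obtain ⟨σ, u, v, σ', -, hb, ha, -⟩ := mem_transitionList.1 h
    exact ⟨(⟨a, i.lt_of_mem_tags ha⟩, l, ⟨b, i.lt_of_mem_tags hb⟩), rfl⟩)
  refine ⟨L₁, L, L₂, h₁, fun t => ?_, h₂, ?_⟩
  · rw [← List.mem_map_of_injective hφ, hL, mem_transitionList]
    constructor
    · rintro ⟨σ, u, v, σ', h, hb, ha, hl⟩
      obtain rfl := (i.mem_tags t.2.2).1 hb
      obtain rfl := (i.mem_tags t.1).1 ha
      exact ⟨u, v, (i.mem_moves (i.state_mem_remainders _)).1 h, hl⟩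
    · rintro ⟨u, v, h, hl⟩
      exact ⟨_, u, v, _, (i.mem_moves (i.state_mem_remainders _)).2 h, (i.mem_tags t.2.2).2 rfl,
        (i.mem_tags t.1).2 rfl, hl⟩
  · change BTree.node _ (BTree.node _ (BTree.node _ (BTree.node _ _))) =
      BTree.node _ (BTree.node _ (BTree.node _ (BTree.node _ _)))
    rw [e₁, e₂, e]

/-- In the degenerate case of size 1 there is a state but no letter. Powers of the size are then
useless as bounds, but the twin index is fixed. -/
theorem twinIndex_eq_zero (h : i.P.size = 1) : i.D.twinIndex = 0 := by
  have hn : i.n = 0 := by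
    have := i.p.pos
    simp only [PushdownSystem.size, Fintype.card_fin] at h
    omega
  have : IsEmpty (Fin i.n) := by rw [hn]; infer_instance
  rw [DepAlphabet.twinIndex, Set.range_eq_empty, Set.ncard_empty]

end Instance

theorem exists_prog : ∃ (c : Prog) (f g : Polynomial ℕ), ∀ i : Instance, ∃ t,
    Runs c (TreeEncoding.enc i.data) (TreeEncoding.enc i.output) t ∧
      t ≤ f.eval (i.P.size ^ g.eval i.D.twinIndex) := by
  obtain ⟨c, V, ⟨b, hb⟩, hc⟩ := Instance.polyTime_output
  obtain ⟨G, hG⟩ := Instance.powLE_weight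
  -- For size at least 2 the base `s + 1` is at most the square of `s`, whence the doubled exponent.
  -- For size 1 the twin index is 0, and the constant factor `2 ^ G.eval 0` is the whole bound.
  refine ⟨c, b.comp (Polynomial.C (2 ^ G.eval 0) * Polynomial.X), 2 * G, fun i => ?_⟩
  obtain ⟨t, ht, htV⟩ := hc i .mk
  refine ⟨t, ht, (htV.trans (hb i .mk)).trans ?_⟩
  rw [Polynomial.eval_comp]
  refine b.eval_nat_mono ((hG i).trans ?_)
  simp only [Polynomial.eval_mul, Polynomial.eval_C, Polynomial.eval_X, Polynomial.eval_ofNat]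
  rcases i.one_le_size.eq_or_lt with h | h
  · rw [i.twinIndex_eq_zero h.symm, ← h]
    simp
  · refine le_trans ?_ (Nat.le_mul_of_pos_left _ (by positivity))
    rw [pow_mul]
    exact Nat.pow_le_pow_left (by nlinarith) _

end PushdownSystem

/-! ### The main theorem. -/

theorem mainTheorem2 :
    -- the reachability relation of every trace-pushdown system is lc-rational
    (∀ (A Q : Type*) [Finite A] [Finite Q] (D : DepAlphabet A) (P : PushdownSystem A Q),
      P.IsTPDS D → ∀ p q : Q, LCRational D (P.Reach D p q)) ∧
    -- one program constructs left-closed transducers in time polynomial in `‖P‖ ^ poly(TI(D))`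
    (∃ (c : Prog) (f g : Polynomial ℕ),
      ∀ (n m : ℕ) (D : DepAlphabet (Fin n)) (P : PushdownSystem (Fin n) (Fin m)) (p q : Fin m)
        (x : BTree), P.IsTPDS D → EncodesInput D P p q x →
        ∃ (y : BTree) (t k : ℕ) (T : Transducer (Fin n) (Fin k)),
          Runs c x y t ∧ t ≤ f.eval (P.size ^ g.eval D.twinIndex) ∧
          EncodesTransducer T y ∧ LeftClosed D T.accepted ∧
          traceRel D T.accepted = P.Reach D p q) ∧
    -- if all letters are dependent, then every pushdown system is a trace-pushdown system, the trace
    -- monoid is the free monoid, and the classical reachability relation on words is rational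
    (∀ (A Q : Type*) [Finite A] [Finite Q] (P : PushdownSystem A Q),
      P.IsTPDS (DepAlphabet.full A) ∧
      Function.Injective (DepAlphabet.full A).trace ∧
      ∀ p q : Q, IsRational {x : FreeMonoid A × FreeMonoid A |
        Relation.ReflTransGen P.WordStep (p, x.1) (q, x.2)}) := by
  refine ⟨fun A Q _ _ D P h p q => PushdownSystem.lcRational_reach h p q, ?_, fun A Q _ _ P =>
    ⟨PushdownSystem.isTPDS_full P, PushdownSystem.trace_full_injective A,
      PushdownSystem.isRational_wordReach P⟩⟩
  obtain ⟨c, f, g, hc⟩ := PushdownSystem.exists_prog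
  refine ⟨c, f, g, ?_⟩
  rintro n m D P p q _ h ⟨deps, trans, hd, hd', ht, ht', rfl⟩
  let i : PushdownSystem.Instance := ⟨n, m, D, P, p, q, deps, trans, hd, hd', ht, ht'⟩
  obtain ⟨t, hr, hle⟩ := hc i
  exact ⟨_, t, _, _, hr, hle, i.encodesTransducer,
    PushdownSystem.leftClosed_accepted h i.boundedStates_subset p q,
    PushdownSystem.traceRel_accepted h i.boundedStates_subset p q⟩
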